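/- For $q\in\mathbb{Z}[i]$ coprime to $2$, a character modulo $q$ is a homomorphism $\chi:(\mathbb{Z}[i]/(q))^*\to S^1=\{z\in\mathbb{C}:|z|=1\}$. It is called primitive if it does not factor through $(\mathbb{Z}[i]/(q'))^*$ for any proper divisor $q'$ of $q$. Let $\psi^*(q)$ be the number of primitive characters $\chi$ modulo $q$ with $\chi(-1)=-1$, and let $N$ denote the norm. Every $n\in(\mathbb{Z}[i]/((1+i)^3q))^*$ can be written uniquely as $n=u_n n_0$ with $u_n\in\{\pm1,\pm i\}$ and $n_0\equiv 1 \pmod{(1+i)^3}$. Each character $\chi$ modulo $q$ thus induces a character $\widetilde\chi$ modulo $(1+i)^3q$ by $\widetilde\chi(n)=\chi(n_0)$. Since $\widetilde\chi$ is trivial on units, it defines a Hecke character of trivial infinite type by $\widetilde\chi((a))=\widetilde\chi(a)$ for $a$ coprime to $(1+i)^3q$, and $\widetilde\chi(\mathcal{A})=0$ for the other nonzero ideals $\mathcal{A}$. When $\chi$ is primitive with $\chi(-1)=-1$, let $L(s,\widetilde\chi)$ be the entire function that for $\Re(s)>1$ is given by $$L(s,\widetilde\chi)=\sum_{0\neq\mathcal{A}\subset\mathbb{Z}[i]}\widetilde\chi(\mathcal{A})\,N(\mathcal{A})^{-s}.$$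 Then there are absolute constants $c>0$ and $N_0$ such that for every $q\in\mathbb{Z}[i]$ with $(q,2)=1$ and $N(q)\ge N_0$, $$\#\left\{\widetilde\chi:\ \chi \bmod q \text{ primitive},\ \chi(-1)=-1,\ L\left(\tfrac12,\widetilde\chi\right)\neq0\right\}\ \ge\ c\,\frac{\psi^*(q)}{\log N(q)}.$$ -/

import Mathlib

noncomputable section

namespace GaussHecke

/-- The quotient ring `ℤ[i] / (m)`. -/
abbrev Residue (m : GaussianInt) : Type := GaussianInt ⧸ Ideal.span ({m} : Set GaussianInt)

/-- Characters modulo `m`: homomorphisms `(ℤ[i] / (m))ˣ → S¹`. -/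
abbrev ModChar (m : GaussianInt) : Type := (Residue m)ˣ →* Circle

/-- The reduction map `(ℤ[i] / (m))ˣ → (ℤ[i] / (d))ˣ` for `d ∣ m`. -/
def reduce {d m : GaussianInt} (h : d ∣ m) : (Residue m)ˣ →* (Residue d)ˣ :=
  Units.map (Ideal.Quotient.factor
    (Ideal.span_singleton_le_span_singleton.mpr h)).toMonoidHom

/-- The map `ℤ[i]ˣ → (ℤ[i] / (m))ˣ`. -/
def unitMap (m : GaussianInt) : GaussianIntˣ →* (Residue m)ˣ :=
  Units.map (Ideal.Quotient.mk (Ideal.span ({m} : Set GaussianInt))).toMonoidHom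

/-- `χ` modulo `m` is primitive: it factors through `(ℤ[i] / (d))ˣ` for no proper divisor `d`
of `m` (a divisor that is not an associate of `m`). -/
def IsPrimitive {m : GaussianInt} (χ : ModChar m) : Prop :=
  ∀ (d : GaussianInt) (h : d ∣ m), ¬ m ∣ d → ¬ ∃ χ' : ModChar d, χ = χ'.comp (reduce h)

/-- `χ(-1) = -1`. -/
def IsOdd {m : GaussianInt} (χ : ModChar m) : Prop := (χ (-1) : ℂ) = -1

/-- The number `ψ*(q)` of primitive characters `χ` modulo `q` with `χ(-1) = -1`. -/
def psiStar (q : GaussianInt) : ℕ := Set.ncard {χ : ModChar q | IsPrimitive χ ∧ IsOdd χ}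

/-- The Gaussian integer `(1 + i)³`. -/
def lam : GaussianInt := (⟨1, 1⟩ : GaussianInt) ^ 3

theorem lam_eq : lam = ⟨-2, 2⟩ := by
  rw [lam]; decide

theorem lam_dvd_iff (z : GaussianInt) :
    lam ∣ z ↔ (4 : ℤ) ∣ z.re + z.im ∧ (4 : ℤ) ∣ z.re - z.im := by
  rw [lam_eq]
  constructor
  · rintro ⟨w, rfl⟩
    simp only [Zsqrtd.re_mul, Zsqrtd.im_mul]
    constructor
    · exact ⟨-w.im, by ring⟩
    · exact ⟨-w.re, by ring⟩
  · rintro ⟨⟨a, ha⟩, ⟨b, hb⟩⟩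
    refine ⟨⟨-b, -a⟩, ?_⟩
    ext
    · simp only [Zsqrtd.re_mul]; linarith
    · simp only [Zsqrtd.im_mul]; linarith

theorem mk_eq_mk_iff (m a b : GaussianInt) :
    Ideal.Quotient.mk (Ideal.span ({m} : Set GaussianInt)) a =
      Ideal.Quotient.mk (Ideal.span ({m} : Set GaussianInt)) b ↔ m ∣ a - b := by
  rw [Ideal.Quotient.eq, Ideal.mem_span_singleton]

theorem sq_add_sq_of_unit (u : GaussianIntˣ) :
    (u : GaussianInt).re ^ 2 + (u : GaussianInt).im ^ 2 = 1 := by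
  have h : (u : GaussianInt).norm = 1 :=
    (Zsqrtd.norm_eq_one_iff' (by norm_num) _).mpr u.isUnit
  rw [Zsqrtd.norm_def] at h
  linarith

/-- The unit group `{±1, ±i}` maps isomorphically onto `(ℤ[i] / ((1 + i)³))ˣ`. -/
theorem unitMap_lam_bijective : Function.Bijective (unitMap lam) := by
  constructor
  · intro u v huv
    have h1 : lam ∣ (u : GaussianInt) - v := (mk_eq_mk_iff _ _ _).mp (congrArg Units.val huv)
    rw [lam_dvd_iff] at h1
    simp only [Zsqrtd.re_sub, Zsqrtd.im_sub] at h1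
    have hu := sq_add_sq_of_unit u
    have hv := sq_add_sq_of_unit v
    have a1 : (u : GaussianInt).re ≤ 1 := by nlinarith
    have a2 : -1 ≤ (u : GaussianInt).re := by nlinarith
    have a3 : (u : GaussianInt).im ≤ 1 := by nlinarith
    have a4 : -1 ≤ (u : GaussianInt).im := by nlinarith
    have b1 : (v : GaussianInt).re ≤ 1 := by nlinarith
    have b2 : -1 ≤ (v : GaussianInt).re := by nlinarith
    have b3 : (v : GaussianInt).im ≤ 1 := by nlinarith
    have b4 : -1 ≤ (v : GaussianInt).im := by nlinarith
    apply Units.ext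
    have key : ∀ a b c d : ℤ, a ≤ 1 → -1 ≤ a → b ≤ 1 → -1 ≤ b → c ≤ 1 → -1 ≤ c → d ≤ 1 → -1 ≤ d →
        a ^ 2 + b ^ 2 = 1 → c ^ 2 + d ^ 2 = 1 → (4 ∣ a - c + (b - d) ∧ 4 ∣ a - c - (b - d)) →
        a = c ∧ b = d := by
      intro a b c d _ _ _ _ _ _ _ _
      interval_cases a <;> interval_cases b <;> interval_cases c <;> interval_cases d <;> decide
    obtain ⟨hre, him⟩ := key _ _ _ _ a1 a2 a3 a4 b1 b2 b3 b4 hu hv h1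
    exact Zsqrtd.ext hre him
  · intro x
    obtain ⟨z, hz⟩ := Ideal.Quotient.mk_surjective (x : Residue lam)
    obtain ⟨w, hw⟩ := Ideal.Quotient.mk_surjective ((x⁻¹ : (Residue lam)ˣ) : Residue lam)
    have h1 : lam ∣ z * w - 1 := by
      rw [← mk_eq_mk_iff, map_mul, map_one, hz, hw, Units.mul_inv]
    have h2 := ((lam_dvd_iff _).mp h1).1
    simp only [Zsqrtd.re_sub, Zsqrtd.im_sub, Zsqrtd.re_mul, Zsqrtd.im_mul, Zsqrtd.re_one,
      Zsqrtd.im_one] at h2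
    have hodd : Odd (z.re + z.im) := by
      have h3 : Odd ((z.re + z.im) * (w.re + w.im)) := by
        obtain ⟨k, hk⟩ := h2
        exact ⟨2 * k + z.im * w.im, by linarith⟩
      exact (Int.odd_mul.mp h3).1
    have fin : ∀ u v : GaussianInt, u * v = 1 → 4 ∣ z.re - u.re + (z.im - u.im) →
        4 ∣ z.re - u.re - (z.im - u.im) → ∃ a, unitMap lam a = x := by
      intro u v huv k1 k2
      refine ⟨⟨u, v, huv, by rw [mul_comm, huv]⟩, Units.ext ?_⟩
      rw [← hz]
      exact ((mk_eq_mk_iff _ _ _).mpr ((lam_dvd_iff _).mpr ⟨k1, k2⟩)).symm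
    obtain ⟨k, hk⟩ := hodd
    have hcases : (4 ∣ z.re - 1 + (z.im - 0) ∧ 4 ∣ z.re - 1 - (z.im - 0)) ∨
        (4 ∣ z.re - (-1) + (z.im - 0) ∧ 4 ∣ z.re - (-1) - (z.im - 0)) ∨
        (4 ∣ z.re - 0 + (z.im - 1) ∧ 4 ∣ z.re - 0 - (z.im - 1)) ∨
        (4 ∣ z.re - 0 + (z.im - (-1)) ∧ 4 ∣ z.re - 0 - (z.im - (-1))) := by
      omega
    rcases hcases with h | h | h | h
    · exact fin ⟨1, 0⟩ ⟨1, 0⟩ (by decide) h.1 h.2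
    · exact fin ⟨-1, 0⟩ ⟨-1, 0⟩ (by decide) h.1 h.2
    · exact fin ⟨0, 1⟩ ⟨0, -1⟩ (by decide) h.1 h.2
    · exact fin ⟨0, -1⟩ ⟨0, 1⟩ (by decide) h.1 h.2

/-- The unit `u_n ∈ {±1, ±i}` attached to a reduced class `n` modulo `(1 + i)³ q`: the unique unit
with `n ≡ u_n (mod (1 + i)³)`. -/
def unitPart (q : GaussianInt) : (Residue (lam * q))ˣ →* GaussianIntˣ :=
  (MulEquiv.ofBijective (unitMap lam) unitMap_lam_bijective).symm.toMonoidHom.comp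
    (reduce (Dvd.intro q rfl : lam ∣ lam * q))

/-- The factor `n₀ = u_n⁻¹ n ≡ 1 (mod (1 + i)³)` in the decomposition `n = u_n n₀`. -/
def primaryPart (q : GaussianInt) : (Residue (lam * q))ˣ →* (Residue (lam * q))ˣ :=
  ((unitMap (lam * q)).comp (unitPart q))⁻¹ * MonoidHom.id _

theorem eq_unitPart_mul_primaryPart (q : GaussianInt) (n : (Residue (lam * q))ˣ) :
    n = unitMap (lam * q) (unitPart q n) * primaryPart q n := by
  simp [primaryPart]

theorem reduce_unitMap {d m : GaussianInt} (h : d ∣ m) (u : GaussianIntˣ) :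
    reduce h (unitMap m u) = unitMap d u := by
  ext; simp [reduce, unitMap]

theorem unitPart_unitMap (q : GaussianInt) (u : GaussianIntˣ) :
    unitPart q (unitMap (lam * q) u) = u := by
  have h : reduce (Dvd.intro q rfl : lam ∣ lam * q) (unitMap (lam * q) u) =
      MulEquiv.ofBijective (unitMap lam) unitMap_lam_bijective u := by
    rw [reduce_unitMap]; rfl
  simp only [unitPart, MonoidHom.comp_apply, h]
  exact MulEquiv.symm_apply_apply _ _

theorem reduce_primaryPart (q : GaussianInt) (n : (Residue (lam * q))ˣ) :
    reduce (Dvd.intro q rfl : lam ∣ lam * q) (primaryPart q n) = 1 := by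
  have h : unitMap lam (unitPart q n) = reduce (Dvd.intro q rfl : lam ∣ lam * q) n :=
    MulEquiv.apply_symm_apply (MulEquiv.ofBijective (unitMap lam) unitMap_lam_bijective) _
  simp [primaryPart, reduce_unitMap, h]

/-- The character `χ̃` modulo `(1 + i)³ q` induced by `χ` modulo `q`: `χ̃(n) = χ(n₀)`. -/
def tilde {q : GaussianInt} (χ : ModChar q) : ModChar (lam * q) :=
  (χ.comp (reduce (Dvd.intro_left lam rfl : q ∣ lam * q))).comp (primaryPart q)

/-- `χ̃` is trivial on units. -/
theorem tilde_unitMap {q : GaussianInt} (χ : ModChar q) (u : GaussianIntˣ) :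
    tilde χ (unitMap (lam * q) u) = 1 := by
  simp [tilde, primaryPart, unitPart_unitMap]

open Classical in
/-- A character `ξ` modulo `m`, extended by zero to all Gaussian integers. -/
def ext0 {m : GaussianInt} (ξ : ModChar m) (a : GaussianInt) : ℂ :=
  if h : IsUnit (Ideal.Quotient.mk (Ideal.span ({m} : Set GaussianInt)) a) then (ξ h.unit : ℂ)
  else 0

/-- A character `ξ` modulo `m` which is trivial on units, regarded as a Hecke character modulo
`m` of trivial infinite type: its value at an ideal is its value at a generator of the ideal. -/
def onIdeal {m : GaussianInt} (ξ : ModChar m) (A : Ideal GaussianInt) : ℂ :=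
  ext0 ξ (Submodule.IsPrincipal.generator A)

/-- The value of the Hecke character at an ideal does not depend on the generator. -/
theorem onIdeal_span {m : GaussianInt} (ξ : ModChar m)
    (hξ : ∀ u : GaussianIntˣ, ξ (unitMap m u) = 1) (a : GaussianInt) :
    onIdeal ξ (Ideal.span {a}) = ext0 ξ a := by
  obtain ⟨u, hu⟩ : Associated a (Submodule.IsPrincipal.generator (Ideal.span {a})) := by
    rw [← Ideal.span_singleton_eq_span_singleton, Ideal.span_singleton_generator]
  rw [onIdeal, ← hu]
  by_cases h : IsUnit (Ideal.Quotient.mk (Ideal.span ({m} : Set GaussianInt)) a)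
  · have h2 : IsUnit (Ideal.Quotient.mk (Ideal.span ({m} : Set GaussianInt)) (a * u)) := by
      rw [map_mul]; exact h.mul (u.isUnit.map _)
    have h3 : h2.unit = h.unit * unitMap m u := by
      ext; simp [unitMap]
    rw [ext0, ext0, dif_pos h, dif_pos h2, h3, map_mul, hξ, mul_one]
  · have h2 : ¬ IsUnit (Ideal.Quotient.mk (Ideal.span ({m} : Set GaussianInt)) (a * u)) := by
      rw [map_mul]; intro h2; exact h (isUnit_of_mul_isUnit_left h2)
    rw [ext0, ext0, dif_neg h, dif_neg h2]

/-- `L` is the Hecke `L`-function of the character `ξ` modulo `m`: the entire function which for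
`Re s > 1` is the sum of the absolutely convergent series `∑ ξ(A) N(A)⁻ˢ` over the nonzero ideals
`A` of `ℤ[i]`, where `N(A)` is the cardinality of `ℤ[i] / A`. There is at most one such `L`. -/
def IsLFunction {m : GaussianInt} (ξ : ModChar m) (L : ℂ → ℂ) : Prop :=
  Differentiable ℂ L ∧ ∀ s : ℂ, 1 < s.re →
    HasSum (fun A : {A : Ideal GaussianInt // A ≠ ⊥} =>
      onIdeal ξ A.1 * (Nat.card (GaussianInt ⧸ A.1) : ℂ) ^ (-s)) (L s)

/-- The set of the characters `χ̃`, for `χ` primitive modulo `q` with `χ(-1) = -1`, such that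
`L(1/2, χ̃) ≠ 0`. -/
def nonvanishing (q : GaussianInt) : Set (ModChar (lam * q)) :=
  {ξ | ∃ χ : ModChar q, IsPrimitive χ ∧ IsOdd χ ∧ ξ = tilde χ ∧
    ∃ L : ℂ → ℂ, IsLFunction ξ L ∧ L (1 / 2) ≠ 0}

end GaussHecke

end

/-!
The proof compares the first two moments of `L(1/2, χ̃)` over the primitive odd characters `χ`
modulo `q` (`primOdd q`). By Cauchy–Schwarz the number of nonzero values is at least
`|∑ L(1/2, χ̃)|² / ∑ |L(1/2, χ̃)|²`. The first moment is at least of order `ψ*(q)`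
(`exists_le_norm_sum`) and the second moment is `O(ψ*(q) log N(q))` (`exists_sum_norm_sq_le`). No
mollifier is used, which is why the factor `log N(q)` is lost.

*The central value.* For a primitive character `ξ` modulo `m`, Poisson summation on `ℤ[i]` (in the
form of the functional equations of the one-dimensional Hurwitz theta kernels) and the absolute
value of Gauss sums give the transformation formula `theta_one_div` of
`∑ ξ(a) exp(-π N(a) t)`. Its Mellin transform is the completed L-function, hence an entire function,
and splitting the Mellin integral at `s = 1/2` at an arbitrary point `T` gives the approximate
functional equation `exists_isLFunction`: up to the number of units, `L(1/2, ξ)` is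
`weightedSum ξ T + ε * weightedSum ξ⁻¹ (1 / (T N(m)))` with `|ε| = 1`. The character `χ̃` modulo
`m = (1 + i)³ q` is primitive because `χ` is primitive and odd (`tilde_exists_ne_one`).

*First moment.* A character modulo `q` is primitive if and only if it is nontrivial on the
kernel of the reduction modulo `q / p` for every prime `p ∣ q`. Inclusion-exclusion over the primes
(`sum_primOdd`) gives an orthogonality relation: up to the weights `N(e)`, the sum of `χ̃(a)` over
`primOdd q` is supported on those `a` congruent to a unit modulo a divisor `e = q / ∏ p` of `q`. The
units themselves give the main term `ψ*(q)`. All other `a` in these classes have norm at least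
`N(e) / 4`, so that their contribution is `O(2 ^ ω(q) T^(-5/8))`. With `T = 1 / (K N(m))` this
is `O(N(q)^(5/8 + o(1)))`, while `ψ*(q)` has order at least `N(q)^(1 - o(1))`; the dual sum is small
for every single character if `K` is a large constant.

*Second moment.* With `T = N(m)^(-1/2)` both sums in the approximate functional equation have length
about `N(m)^(1/2)`. By positivity the sum over `primOdd q` is at most the sum over all characters
modulo `m`, where the orthogonality relation leaves the diagonal `∑ 1 / N(a)` over the `a` coprime to
`q`. To get a bound in terms of `ψ*(q)` rather than the number `φ(q)` of all characters, two
savings are matched prime by prime: `ψ*(q)` is about `φ(q) ∏ (1 - 1 / |K_p|)` with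
`|K_p| ≥ N(p) - 1`, where `K_p` is the kernel of the reduction modulo `q / p`, and the coprimality
condition saves `∏ (1 + 1 / N(p))` in the diagonal sum (`sum_inv_nrm_coprime_le`). The product of
these two factors is bounded below (`exists_le_primDensity_mul_primeProd`).
-/

noncomputable section

namespace GaussHecke

open Finset

/-! ### Characters of finite abelian groups and congruence subgroups of finite rings -/

section Characters

variable {G : Type*} [CommGroup G] [Finite G]

instance finite_monoidHom_circle : Finite (G →* Circle) := by
  have e : AddChar (Additive G) Circle ≃ (Multiplicative (Additive G) →* Circle) :=
    AddChar.toMonoidHomEquiv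
  have e' := AddChar.circleEquivComplex (α := Additive G)
  have : Finite (AddChar (Additive G) ℂ) := inferInstance
  have h1 : Finite (AddChar (Additive G) Circle) := Finite.of_equiv _ e'.toEquiv.symm
  exact Finite.of_equiv _ e

/-- Orthogonality of characters, summed over the dual group. -/
theorem sum_char_apply [Fintype (G →* Circle)] [DecidableEq G] (g : G) :
    ∑ χ : G →* Circle, (χ g : ℂ) = if g = 1 then (Nat.card G : ℂ) else 0 := by
  classical
  have : Fintype G := Fintype.ofFinite G
  have h := AddChar.sum_apply_eq_ite (α := Additive G) (Additive.ofMul g)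
  have hG : Fintype.card (Additive G) = Nat.card G := by
    rw [← Nat.card_eq_fintype_card]; rfl
  rw [hG] at h
  simp only [ofMul_eq_zero] at h
  rw [← h]
  let e : (G →* Circle) ≃ AddChar (Additive G) Circle :=
    (AddChar.toMonoidHomEquiv (A := Additive G) (M := Circle)).symm
  let e' := AddChar.circleEquivComplex (α := Additive G)
  refine Fintype.sum_equiv (e.trans e'.toEquiv) _ _ fun χ => ?_
  rfl

end Characters

section CongruenceSubgroups

variable {A : Type*} [CommRing A]

/-- The group of the units `x` with `s (x - 1) = 0`. For `A = ℤ[i] / (q)` and `s ∣ q` these are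
the reduced classes modulo `q` that are congruent to `1` modulo `q / s`. -/
def congrSubgroup (s : A) : Subgroup Aˣ where
  carrier := {x | s * ((x : A) - 1) = 0}
  mul_mem' := by
    intro x y hx hy
    simp only [Set.mem_ofPred_eq, Units.val_mul] at *
    linear_combination (y : A) * hx + hy
  one_mem' := by simp
  inv_mem' := by
    intro x hx
    simp only [Set.mem_ofPred_eq] at *
    have h : (x : A) * ((x⁻¹ : Aˣ) : A) = 1 := x.mul_inv
    linear_combination (-((x⁻¹ : Aˣ) : A)) * hx + s * h

theorem mem_congrSubgroup {s : A} {x : Aˣ} : x ∈ congrSubgroup s ↔ s * ((x : A) - 1) = 0 :=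
  Iff.rfl

theorem congrSubgroup_one : congrSubgroup (1 : A) = ⊥ := by
  ext x
  rw [mem_congrSubgroup, Subgroup.mem_bot, one_mul, sub_eq_zero, Units.val_eq_one]

theorem congrSubgroup_mono {s t : A} (h : s ∣ t) : congrSubgroup s ≤ congrSubgroup t := by
  obtain ⟨r, rfl⟩ := h
  intro x hx
  rw [mem_congrSubgroup] at *
  linear_combination r * hx

theorem eq_one_of_mem_congrSubgroup {s t : A} (h : IsCoprime s t) {x : Aˣ}
    (hs : x ∈ congrSubgroup s) (ht : x ∈ congrSubgroup t) : x = 1 := by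
  obtain ⟨a, b, hab⟩ := h
  rw [mem_congrSubgroup] at *
  apply Units.ext
  rw [Units.val_one]
  linear_combination a * hs + b * ht - ((x : A) - 1) * hab

/-- For coprime `s` and `t` an element of `congrSubgroup (s * t)` is a product of elements of
`congrSubgroup s` and `congrSubgroup t`. -/
theorem exists_mul_of_mem_congrSubgroup {s t : A} (h : IsCoprime s t) {x : Aˣ}
    (hx : x ∈ congrSubgroup (s * t)) :
    ∃ y ∈ congrSubgroup s, ∃ z ∈ congrSubgroup t, y * z = x := by
  obtain ⟨a, b, hab⟩ := h
  rw [mem_congrSubgroup] at hx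
  have hi : (x : A) * ((x⁻¹ : Aˣ) : A) = 1 := x.mul_inv
  set X : A := (x : A)
  set Y : A := ((x⁻¹ : Aˣ) : A)
  -- `e = b * t` acts as an idempotent on `x - 1`, so `1 + e (x - 1)` has inverse `1 + e (x⁻¹ - 1)`.
  have he : b * t * (b * t) * (X - 1) = b * t * (X - 1) := by
    linear_combination (-a * b) * hx + (b * t * (X - 1)) * hab
  have h1 : (1 + b * t * (X - 1)) * (1 + b * t * (Y - 1)) = 1 := by
    linear_combination (Y - 1) * he + b * t * hi
  let y : Aˣ := ⟨1 + b * t * (X - 1), 1 + b * t * (Y - 1), h1, by rw [mul_comm, h1]⟩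
  refine ⟨y, ?_, y⁻¹ * x, ?_, by group⟩
  · rw [mem_congrSubgroup]
    change s * (1 + b * t * (X - 1) - 1) = 0
    linear_combination b * hx
  · rw [mem_congrSubgroup]
    change t * ((1 + b * t * (Y - 1)) * X - 1) = 0
    linear_combination (t * (b * t)) * hi + a * hx - t * (X - 1) * hab

theorem card_congrSubgroup_mul {s t : A} (h : IsCoprime s t) :
    Nat.card (congrSubgroup (s * t)) =
      Nat.card (congrSubgroup s) * Nat.card (congrSubgroup t) := by
  rw [← Nat.card_prod]
  symm
  refine Nat.card_congr (Equiv.ofBijective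
    (fun z : congrSubgroup s × congrSubgroup t => (⟨z.1.1 * z.2.1,
      mul_mem (congrSubgroup_mono (dvd_mul_right s t) z.1.2)
        (congrSubgroup_mono (dvd_mul_left t s) z.2.2)⟩ : congrSubgroup (s * t))) ⟨?_, ?_⟩)
  · rintro ⟨⟨y, hy⟩, ⟨z, hz⟩⟩ ⟨⟨y', hy'⟩, ⟨z', hz'⟩⟩ he
    have he : y * z = y' * z' := congrArg Subtype.val he
    have h1 : y'⁻¹ * y = z' * z⁻¹ := by
      rw [eq_mul_inv_iff_mul_eq, mul_assoc, he, inv_mul_cancel_left]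
    have h2 : y'⁻¹ * y = 1 := eq_one_of_mem_congrSubgroup h (mul_mem (inv_mem hy') hy)
      (h1 ▸ mul_mem hz' (inv_mem hz))
    have hyy : y = y' := (inv_mul_eq_one.mp h2).symm
    have hzz : z = z' := (mul_inv_eq_one.mp (h1.symm.trans h2)).symm
    subst hyy hzz
    rfl
  · rintro ⟨x, hx⟩
    obtain ⟨y, hy, z, hz, rfl⟩ := exists_mul_of_mem_congrSubgroup h hx
    exact ⟨⟨⟨y, hy⟩, ⟨z, hz⟩⟩, rfl⟩

variable {ι : Type*} {f : ι → A} {S : Finset ι}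

theorem card_congrSubgroup_prod
    (hf : (S : Set ι).Pairwise fun i j => IsCoprime (f i) (f j)) :
    Nat.card (congrSubgroup (∏ i ∈ S, f i)) = ∏ i ∈ S, Nat.card (congrSubgroup (f i)) := by
  classical
  induction S using Finset.induction_on with
  | empty => simp [congrSubgroup_one]
  | insert a S ha ih =>
    rw [Finset.prod_insert ha, Finset.prod_insert ha, card_congrSubgroup_mul, ih]
    · exact hf.mono (by simp)
    · refine IsCoprime.prod_right fun i hi => hf (by simp) (by simp [hi]) ?_
      rintro rfl
      exact ha hi

theorem trivial_on_congrSubgroup_prod {M : Type*} [MulOneClass M] (χ : Aˣ →* M)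
    (hf : (S : Set ι).Pairwise fun i j => IsCoprime (f i) (f j)) :
    (∀ x ∈ congrSubgroup (∏ i ∈ S, f i), χ x = 1) ↔
      ∀ i ∈ S, ∀ x ∈ congrSubgroup (f i), χ x = 1 := by
  classical
  induction S using Finset.induction_on with
  | empty => simp [congrSubgroup_one]
  | insert a S ha ih =>
    have hc : IsCoprime (f a) (∏ i ∈ S, f i) := by
      refine IsCoprime.prod_right fun i hi => hf (by simp) (by simp [hi]) ?_
      rintro rfl
      exact ha hi
    rw [Finset.prod_insert ha, Finset.forall_mem_insert, ← ih (hf.mono (by simp))]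
    constructor
    · intro h
      exact ⟨fun x hx => h x (congrSubgroup_mono (dvd_mul_right _ _) hx),
        fun x hx => h x (congrSubgroup_mono (dvd_mul_left _ _) hx)⟩
    · rintro ⟨h1, h2⟩ x hx
      obtain ⟨y, hy, z, hz, rfl⟩ := exists_mul_of_mem_congrSubgroup hc hx
      rw [map_mul, h1 y hy, h2 z hz, one_mul]

end CongruenceSubgroups

section CharacterSums

variable {A : Type*} [CommRing A] [Finite A]

open Classical in
/-- Sum of `χ(n)` over the characters that are trivial on a given subgroup. -/
theorem sum_char_trivial_on {G : Type*} [CommGroup G] [Finite G] [Fintype (G →* Circle)]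
    (K : Subgroup G) (n : G) :
    ∑ χ : G →* Circle, (if ∀ x ∈ K, χ x = 1 then (χ n : ℂ) else 0) =
      if n ∈ K then (Nat.card G : ℂ) / Nat.card K else 0 := by
  have : Fintype K := Fintype.ofFinite K
  have hK : (Nat.card K : ℂ) ≠ 0 := by exact_mod_cast Nat.card_pos.ne'
  have h1 : ∀ χ : G →* Circle, (if ∀ x ∈ K, χ x = 1 then (χ n : ℂ) else 0) =
      (Nat.card K : ℂ)⁻¹ * ∑ k : K, (χ (k * n) : ℂ) := by
    intro χ
    by_cases h : ∀ x ∈ K, χ x = 1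
    · rw [if_pos h]
      have : ∀ k : K, (χ (k * n) : ℂ) = χ n := fun k => by rw [map_mul, h k k.2, one_mul]
      simp only [this, Finset.sum_const, Finset.card_univ, nsmul_eq_mul,
        ← Nat.card_eq_fintype_card]
      field_simp
    · rw [if_neg h]
      push Not at h
      obtain ⟨x, hx, hne⟩ := h
      have h2 : ∑ k : K, (χ (k * n) : ℂ) = (χ x : ℂ) * ∑ k : K, (χ (k * n) : ℂ) := by
        rw [Finset.mul_sum]
        refine (Fintype.sum_equiv (Equiv.mulLeft (⟨x, hx⟩ : K)) _ _ fun k => ?_).symm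
        simp [mul_assoc]
      have h3 : (1 - (χ x : ℂ)) * ∑ k : K, (χ (k * n) : ℂ) = 0 := by linear_combination h2
      rcases mul_eq_zero.mp h3 with h4 | h4
      · exact absurd (Circle.ext (by rw [Circle.coe_one]; linear_combination -h4)) hne
      · rw [h4, mul_zero]
  simp only [h1]
  rw [← Finset.mul_sum, Finset.sum_comm]
  simp only [sum_char_apply]
  by_cases hn : n ∈ K
  · rw [if_pos hn, Finset.sum_eq_single (⟨n⁻¹, inv_mem hn⟩ : K)]
    · simp; field_simp
    · intro b _ hb
      refine if_neg fun h => hb (Subtype.ext (eq_inv_of_mul_eq_one_left h))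
    · simp
  · rw [if_neg hn, Finset.sum_eq_zero, mul_zero]
    intro k _
    refine if_neg fun h => hn ?_
    rw [eq_inv_of_mul_eq_one_right h]
    exact inv_mem k.2

/-- Inclusion-exclusion for the odd characters that are nontrivial on each of the subgroups
`congrSubgroup (f i)`. -/
theorem sum_odd_nontrivial {ι : Type*} (f : ι → A) (P : Finset ι)
    (hf : (P : Set ι).Pairwise fun i j => IsCoprime (f i) (f j)) (F : Finset (Aˣ →* Circle))
    (hF : ∀ χ, χ ∈ F ↔ (∀ i ∈ P, ∃ x ∈ congrSubgroup (f i), χ x ≠ 1) ∧ (χ (-1) : ℂ) = -1)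
    (n : Aˣ) :
    ∑ χ ∈ F, (χ n : ℂ) =
    ∑ S ∈ P.powerset, (-1) ^ #S * ((Nat.card Aˣ : ℂ) / Nat.card (congrSubgroup (∏ i ∈ S, f i))) *
      (((congrSubgroup (∏ i ∈ S, f i) : Set Aˣ).indicator 1 n -
        (congrSubgroup (∏ i ∈ S, f i) : Set Aˣ).indicator 1 (-n)) / 2) := by
  classical
  have : Fintype (Aˣ →* Circle) := Fintype.ofFinite _
  have hF' : F = univ.filter fun χ =>
      (∀ i ∈ P, ∃ x ∈ congrSubgroup (f i), χ x ≠ 1) ∧ (χ (-1) : ℂ) = -1 := by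
    ext χ; rw [hF]; simp
  rw [hF', Finset.sum_filter]
  simp only [Set.indicator_apply, SetLike.mem_coe, Pi.one_apply]
  have hodd : ∀ χ : Aˣ →* Circle, (if (χ (-1) : ℂ) = -1 then (χ n : ℂ) else 0) =
      ((χ n : ℂ) - χ (-n)) / 2 := by
    intro χ
    have h1 : χ (-n) = χ (-1) * χ n := by rw [← map_mul, neg_one_mul]
    have h2 : (χ (-1) : ℂ) * χ (-1) = 1 := by
      rw [← Circle.coe_mul, ← map_mul]; simp
    rw [h1, Circle.coe_mul]
    rcases mul_self_eq_one_iff.mp h2 with h | h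
    · rw [if_neg (by rw [h]; norm_num), h]; ring
    · rw [if_pos h, h]; ring
  have hprim : ∀ χ : Aˣ →* Circle,
      (if ∀ i ∈ P, ∃ x ∈ congrSubgroup (f i), χ x ≠ 1 then (1 : ℂ) else 0) =
      ∑ S ∈ P.powerset, (-1) ^ #S *
        (if ∀ x ∈ congrSubgroup (∏ i ∈ S, f i), χ x = 1 then (1 : ℂ) else 0) := by
    intro χ
    have h1 : (if ∀ i ∈ P, ∃ x ∈ congrSubgroup (f i), χ x ≠ 1 then (1 : ℂ) else 0) =
        ∏ i ∈ P, (1 + -(if ∀ x ∈ congrSubgroup (f i), χ x = 1 then (1 : ℂ) else 0)) := by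
      have : ∀ i ∈ P, (1 + -(if ∀ x ∈ congrSubgroup (f i), χ x = 1 then (1 : ℂ) else 0)) =
          if ∃ x ∈ congrSubgroup (f i), χ x ≠ 1 then 1 else 0 := by
        intro i _
        by_cases h : ∀ x ∈ congrSubgroup (f i), χ x = 1
        · have h' : ¬ ∃ x ∈ congrSubgroup (f i), χ x ≠ 1 := by push Not; exact h
          simp [if_pos h, if_neg h']
        · have h' : ∃ x ∈ congrSubgroup (f i), χ x ≠ 1 := by push Not at h; exact h
          simp [if_neg h, if_pos h']
      rw [Finset.prod_congr rfl this, Finset.prod_ite_zero, Finset.prod_const_one]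
    rw [h1, Finset.prod_one_add]
    refine Finset.sum_congr rfl fun S hS => ?_
    rw [Finset.prod_neg, Finset.prod_ite_zero, Finset.prod_const_one]
    simp only [trivial_on_congrSubgroup_prod χ (hf.mono (by
      simpa using Finset.mem_powerset.mp hS))]
  have hsplit : ∀ χ : Aˣ →* Circle,
      (if (∀ i ∈ P, ∃ x ∈ congrSubgroup (f i), χ x ≠ 1) ∧ (χ (-1) : ℂ) = -1
        then (χ n : ℂ) else 0) =
      ∑ S ∈ P.powerset, (-1) ^ #S *
        (((if ∀ x ∈ congrSubgroup (∏ i ∈ S, f i), χ x = 1 then (χ n : ℂ) else 0) -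
        (if ∀ x ∈ congrSubgroup (∏ i ∈ S, f i), χ x = 1 then (χ (-n) : ℂ) else 0)) / 2) := by
    intro χ
    rw [ite_and, hodd, ← mul_one (((χ n : ℂ) - χ (-n)) / 2), ← mul_ite_zero, hprim, Finset.mul_sum]
    refine Finset.sum_congr rfl fun S _ => ?_
    split_ifs <;> ring
  simp only [hsplit]
  rw [Finset.sum_comm]
  refine Finset.sum_congr rfl fun S _ => ?_
  rw [← Finset.mul_sum, ← Finset.sum_div, Finset.sum_sub_distrib, sum_char_trivial_on,
    sum_char_trivial_on]
  split_ifs <;> ring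

end CharacterSums

/-! ### The norm and residue rings -/

/-- The norm of a Gaussian integer as a real number. -/
def nrm (a : GaussianInt) : ℝ := (a.norm : ℝ)

theorem nrm_eq (a : GaussianInt) : nrm a = (a.re : ℝ) ^ 2 + (a.im : ℝ) ^ 2 := by
  rw [nrm, Zsqrtd.norm_def]; push_cast; ring

theorem nrm_eq_normSq (a : GaussianInt) : nrm a = Complex.normSq (GaussianInt.toComplex a) :=
  GaussianInt.intCast_real_norm a

theorem nrm_mul (a b : GaussianInt) : nrm (a * b) = nrm a * nrm b := by
  simp [nrm, Zsqrtd.norm_mul]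

@[simp] theorem nrm_one : nrm 1 = 1 := by simp [nrm]

@[simp] theorem nrm_zero : nrm 0 = 0 := by simp [nrm]

theorem nrm_nonneg (a : GaussianInt) : 0 ≤ nrm a := by
  rw [nrm_eq]; positivity

theorem nrm_pos {a : GaussianInt} (ha : a ≠ 0) : 0 < nrm a := by
  rw [nrm]; exact_mod_cast GaussianInt.norm_pos.mpr ha

theorem one_le_nrm {a : GaussianInt} (ha : a ≠ 0) : 1 ≤ nrm a := by
  rw [nrm]; exact_mod_cast GaussianInt.norm_pos.mpr ha

theorem nrm_unit (u : GaussianIntˣ) : nrm u = 1 := by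
  rw [nrm_eq]; exact_mod_cast sq_add_sq_of_unit u

theorem nrm_prod {ι : Type*} (S : Finset ι) (f : ι → GaussianInt) :
    nrm (∏ i ∈ S, f i) = ∏ i ∈ S, nrm (f i) := by
  classical
  induction S using Finset.induction_on with
  | empty => simp
  | insert a S ha ih => rw [prod_insert ha, prod_insert ha, nrm_mul, ih]

theorem nrm_lam : nrm lam = 8 := by rw [lam_eq, nrm_eq]; norm_num

theorem lam_ne_zero : lam ≠ 0 := by rw [lam_eq]; decide

/-- The `ℤ`-basis `1, i` of the Gaussian integers. -/
def gaussBasis : Module.Basis (Fin 2) ℤ GaussianInt :=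
  Module.Basis.ofEquivFun
    { toFun := fun z => ![z.re, z.im]
      invFun := fun v => ⟨v 0, v 1⟩
      left_inv := fun z => rfl
      right_inv := fun v => by ext i; fin_cases i <;> rfl
      map_add' := fun x y => by ext i; fin_cases i <;> simp
      map_smul' := fun c x => by ext i; fin_cases i <;> simp }

instance : Module.Free ℤ GaussianInt := Module.Free.of_basis gaussBasis

instance : Module.Finite ℤ GaussianInt := Module.Finite.of_basis gaussBasis

theorem algebra_norm_eq (a : GaussianInt) : Algebra.norm ℤ a = a.norm := by
  rw [Algebra.norm_eq_matrix_det gaussBasis, Matrix.det_fin_two, Zsqrtd.norm_def]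
  have h0 : gaussBasis 0 = 1 := by
    simp only [gaussBasis, Module.Basis.coe_ofEquivFun]; rfl
  have h1 : gaussBasis 1 = ⟨0, 1⟩ := by
    simp only [gaussBasis, Module.Basis.coe_ofEquivFun]; rfl
  have hr0 : ∀ z, gaussBasis.repr z 0 = z.re := fun z => by
    simp only [gaussBasis, Module.Basis.ofEquivFun_repr_apply]; rfl
  have hr1 : ∀ z, gaussBasis.repr z 1 = z.im := fun z => by
    simp only [gaussBasis, Module.Basis.ofEquivFun_repr_apply]; rfl
  simp only [Algebra.leftMulMatrix_eq_repr_mul, h0, h1, hr0, hr1, Zsqrtd.re_mul, Zsqrtd.im_mul,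
    Zsqrtd.re_one, Zsqrtd.im_one]
  ring

theorem card_quotient_span (a : GaussianInt) :
    (Nat.card (GaussianInt ⧸ Ideal.span ({a} : Set GaussianInt)) : ℝ) = nrm a := by
  have h := Ideal.absNorm_span_singleton a
  rw [algebra_norm_eq] at h
  have h2 : Nat.card (GaussianInt ⧸ Ideal.span ({a} : Set GaussianInt)) = a.norm.natAbs := h
  rw [h2, nrm, GaussianInt.natCast_natAbs_norm]

theorem card_residue (m : GaussianInt) : (Nat.card (Residue m) : ℝ) = nrm m :=
  card_quotient_span m

instance finite_residue (m : GaussianInt) [h : NeZero m] : Finite (Residue m) := by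
  refine Nat.finite_of_card_ne_zero fun h0 => ?_
  have := card_residue m
  rw [h0, Nat.cast_zero] at this
  exact (nrm_pos h.out).ne this

instance fintype_residue (m : GaussianInt) [NeZero m] : Fintype (Residue m) := Fintype.ofFinite _

instance fintype_modChar (m : GaussianInt) [NeZero m] : Fintype (ModChar m) := Fintype.ofFinite _

instance neZero_lam : NeZero lam := ⟨lam_ne_zero⟩

instance neZero_lam_mul (q : GaussianInt) [h : NeZero q] : NeZero (lam * q) :=
  ⟨mul_ne_zero lam_ne_zero h.out⟩

instance finite_units : Finite GaussianIntˣ :=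
  Finite.of_injective _ unitMap_lam_bijective.1

instance fintype_units : Fintype GaussianIntˣ := Fintype.ofFinite _

/-- The residue class of `a` modulo `m`. -/
abbrev cls (m : GaussianInt) : GaussianInt →+* Residue m := Ideal.Quotient.mk _

theorem cls_eq_zero {m a : GaussianInt} : cls m a = 0 ↔ m ∣ a := by
  rw [Ideal.Quotient.eq_zero_iff_mem, Ideal.mem_span_singleton]

theorem isUnit_cls {m a : GaussianInt} : IsUnit (cls m a) ↔ IsCoprime a m := by
  constructor
  · rintro ⟨u, hu⟩
    obtain ⟨b, hb⟩ := Ideal.Quotient.mk_surjective ((u⁻¹ : (Residue m)ˣ) : Residue m)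
    have h1 : cls m (a * b) = cls m 1 := by
      rw [map_mul, map_one, hb, ← hu, Units.mul_inv]
    obtain ⟨c, hc⟩ := (mk_eq_mk_iff _ _ _).mp h1
    exact ⟨b, -c, by linear_combination hc⟩
  · rintro ⟨b, c, h⟩
    refine IsUnit.of_mul_eq_one (cls m b) ?_
    rw [← map_mul, ← map_one (Ideal.Quotient.mk _), mk_eq_mk_iff]
    exact ⟨-c, by linear_combination h⟩

/-- The reduced class of an integer coprime to the modulus. -/
def unitCls {m a : GaussianInt} (h : IsCoprime a m) : (Residue m)ˣ := (isUnit_cls.mpr h).unit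

@[simp] theorem coe_unitCls {m a : GaussianInt} (h : IsCoprime a m) :
    (unitCls h : Residue m) = cls m a := rfl

theorem exists_unitCls {m : GaussianInt} (x : (Residue m)ˣ) :
    ∃ a, ∃ h : IsCoprime a m, unitCls h = x := by
  obtain ⟨a, ha⟩ := Ideal.Quotient.mk_surjective (x : Residue m)
  have h : IsUnit (cls m a) := by rw [cls, ha]; exact x.isUnit
  exact ⟨a, isUnit_cls.mp h, Units.ext ha⟩

theorem unitCls_eq_iff {m a b : GaussianInt} (ha : IsCoprime a m) (hb : IsCoprime b m) :
    unitCls ha = unitCls hb ↔ m ∣ a - b := by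
  rw [← mk_eq_mk_iff, Units.ext_iff]; rfl

theorem unitCls_mul {m a b : GaussianInt} (ha : IsCoprime a m) (hb : IsCoprime b m) :
    unitCls ha * unitCls hb = unitCls (ha.mul_left hb) := by
  ext; simp

theorem unitCls_one {m : GaussianInt} : unitCls (isCoprime_one_left : IsCoprime 1 m) = 1 := by
  ext; simp

theorem isCoprime_unit (u : GaussianIntˣ) (m : GaussianInt) : IsCoprime (u : GaussianInt) m :=
  ⟨((u⁻¹ : GaussianIntˣ) : GaussianInt), 0, by simp⟩

theorem unitMap_eq {m : GaussianInt} (u : GaussianIntˣ) (h : IsCoprime (u : GaussianInt) m) :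
    unitMap m u = unitCls h := by
  ext; rfl

theorem reduce_unitCls {d m a : GaussianInt} (h : d ∣ m) (ha : IsCoprime a m)
    (hd : IsCoprime a d) : reduce h (unitCls ha) = unitCls hd := by
  ext; simp [reduce, unitCls]

theorem unitCls_mem_congrSubgroup {m a s : GaussianInt} (ha : IsCoprime a m) :
    unitCls ha ∈ congrSubgroup (cls m s) ↔ m ∣ s * (a - 1) := by
  rw [mem_congrSubgroup, coe_unitCls, ← cls_eq_zero, map_mul, map_sub, map_one]

theorem ext0_of_coprime {m a : GaussianInt} (ξ : ModChar m) (h : IsCoprime a m) :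
    ext0 ξ a = ξ (unitCls h) := by
  rw [ext0, dif_pos (isUnit_cls.mpr h)]; rfl

theorem ext0_of_not_coprime {m a : GaussianInt} (ξ : ModChar m) (h : ¬ IsCoprime a m) :
    ext0 ξ a = 0 := by
  rw [ext0, dif_neg (fun h' => h (isUnit_cls.mp h'))]

theorem norm_ext0_le {m : GaussianInt} (ξ : ModChar m) (a : GaussianInt) : ‖ext0 ξ a‖ ≤ 1 := by
  by_cases h : IsCoprime a m
  · rw [ext0_of_coprime ξ h, Circle.norm_coe]
  · rw [ext0_of_not_coprime ξ h, norm_zero]; exact zero_le_one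

/-! ### Prime factors -/

/-- Every reduced class `r` modulo `d` contains an integer coprime to `m`: shift by `d` times the
product of the primes dividing `m` but not `r`. -/
theorem exists_coprime_shift {d m r : GaussianInt} (hm : m ≠ 0) (hr : IsCoprime r d) :
    ∃ t, IsCoprime (r + d * t) m := by
  classical
  let F := (UniqueFactorizationMonoid.factors m).toFinset.filter fun p => ¬ p ∣ r
  refine ⟨∏ p ∈ F, p, ?_⟩
  refine (isCoprime_of_prime_dvd (fun h => hm h.2) fun p hp h1 h2 => ?_)
  have key : ∀ p : GaussianInt, Prime p → p ∣ m → ¬ p ∣ r → p ∣ ∏ p ∈ F, p := by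
    intro p hp hpm hpr
    obtain ⟨p', hp', hass⟩ :=
      UniqueFactorizationMonoid.exists_mem_factors_of_dvd hm hp.irreducible hpm
    refine hass.dvd.trans (dvd_prod_of_mem _ ?_)
    simp only [F, mem_filter, Multiset.mem_toFinset]
    exact ⟨hp', fun h => hpr (hass.dvd.trans h)⟩
  by_cases hpr : p ∣ r
  · have h3 : p ∣ d * ∏ p ∈ F, p := (dvd_add_right hpr).mp h1
    rcases hp.dvd_or_dvd h3 with h4 | h4
    · exact hp.not_isUnit (hr.isUnit_of_dvd' hpr h4)
    · obtain ⟨p', hp', hpp⟩ := (hp.dvd_finsetProd_iff _).mp h4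
      simp only [F, mem_filter, Multiset.mem_toFinset] at hp'
      have hp'p : Prime p' := UniqueFactorizationMonoid.prime_of_factor p' hp'.1
      exact hp'.2 ((hp.associated_of_dvd hp'p hpp).symm.dvd.trans hpr)
  · exact hpr ((dvd_add_left ((key p hp h2 hpr).mul_left d)).mp h1)

theorem reduce_surjective {d m : GaussianInt} (hm : m ≠ 0) (h : d ∣ m) :
    Function.Surjective (reduce h) := by
  intro x
  obtain ⟨r, hr, rfl⟩ := exists_unitCls x
  obtain ⟨t, ht⟩ := exists_coprime_shift hm hr
  refine ⟨unitCls ht, ?_⟩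
  rw [reduce_unitCls h ht (ht.of_isCoprime_of_dvd_right h), unitCls_eq_iff]
  exact ⟨t, by ring⟩

/-- Chinese remainder theorem for the moduli `lam` and `q`. -/
theorem exists_reduce_eq {q : GaussianInt} (hq : IsCoprime lam q) (u : (Residue lam)ˣ)
    (x : (Residue q)ˣ) : ∃ n : (Residue (lam * q))ˣ,
      reduce (Dvd.intro q rfl : lam ∣ lam * q) n = u ∧
      reduce (Dvd.intro_left lam rfl : q ∣ lam * q) n = x := by
  obtain ⟨a, ha, rfl⟩ := exists_unitCls u
  obtain ⟨b, hb, rfl⟩ := exists_unitCls x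
  obtain ⟨α, β, h⟩ := hq
  have h1 : a * (β * q) + b * (α * lam) - a = lam * (α * (b - a)) := by
    linear_combination a * h
  have h2 : a * (β * q) + b * (α * lam) - b = q * (β * (a - b)) := by
    linear_combination b * h
  have c1 : IsCoprime (a * (β * q) + b * (α * lam)) lam := by
    have : a * (β * q) + b * (α * lam) = a + lam * (α * (b - a)) := by linear_combination h1
    rw [this]; exact ha.add_mul_left_left _
  have c2 : IsCoprime (a * (β * q) + b * (α * lam)) q := by
    have : a * (β * q) + b * (α * lam) = b + q * (β * (a - b)) := by linear_combination h2
    rw [this]; exact hb.add_mul_left_left _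
  refine ⟨unitCls (c1.mul_right c2), ?_, ?_⟩
  · rw [reduce_unitCls _ _ c1, unitCls_eq_iff]; exact ⟨_, h1⟩
  · rw [reduce_unitCls _ _ c2, unitCls_eq_iff]; exact ⟨_, h2⟩

open Classical in
/-- A set of representatives, up to units, of the primes dividing `q`. -/
def primesOf (q : GaussianInt) : Finset GaussianInt :=
  letI := UniqueFactorizationMonoid.strongNormalizationMonoid (α := GaussianInt)
  (UniqueFactorizationMonoid.normalizedFactors q).toFinset

theorem prime_of_mem_primesOf {q p : GaussianInt} (h : p ∈ primesOf q) : Prime p := by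
  let _ := UniqueFactorizationMonoid.strongNormalizationMonoid (α := GaussianInt)
  exact UniqueFactorizationMonoid.prime_of_normalized_factor p (Multiset.mem_toFinset.mp h)

theorem dvd_of_mem_primesOf {q p : GaussianInt} (h : p ∈ primesOf q) : p ∣ q := by
  let _ := UniqueFactorizationMonoid.strongNormalizationMonoid (α := GaussianInt)
  exact UniqueFactorizationMonoid.dvd_of_mem_normalizedFactors (Multiset.mem_toFinset.mp h)

theorem exists_mem_primesOf {q p : GaussianInt} (hq : q ≠ 0) (hp : Prime p) (h : p ∣ q) :
    ∃ p' ∈ primesOf q, Associated p p' := by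
  let _ := UniqueFactorizationMonoid.strongNormalizationMonoid (α := GaussianInt)
  obtain ⟨p', hp', ha⟩ :=
    UniqueFactorizationMonoid.exists_mem_normalizedFactors_of_dvd hq hp.irreducible h
  exact ⟨p', Multiset.mem_toFinset.mpr hp', ha⟩

theorem eq_of_associated_of_mem_primesOf {q p p' : GaussianInt} (h : p ∈ primesOf q)
    (h' : p' ∈ primesOf q) (ha : p ∣ p') : p = p' := by
  have hass := (prime_of_mem_primesOf h).associated_of_dvd (prime_of_mem_primesOf h') ha
  let _ := UniqueFactorizationMonoid.strongNormalizationMonoid (α := GaussianInt)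
  have h1 := UniqueFactorizationMonoid.normalize_normalized_factor p (a := q)
    (Multiset.mem_toFinset.mp h)
  have h2 := UniqueFactorizationMonoid.normalize_normalized_factor p' (a := q)
    (Multiset.mem_toFinset.mp h')
  rw [← h1, ← h2]
  exact normalize_eq_normalize hass.dvd hass.symm.dvd

theorem primesOf_pairwise (q : GaussianInt) :
    (primesOf q : Set GaussianInt).Pairwise fun p p' => IsCoprime p p' := by
  intro p hp p' hp' hne
  rw [Irreducible.coprime_iff_not_dvd (prime_of_mem_primesOf hp).irreducible]
  exact fun h => hne (eq_of_associated_of_mem_primesOf hp hp' h)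

theorem prod_dvd_of_subset {q : GaussianInt} {S : Finset GaussianInt} (hS : S ⊆ primesOf q) :
    ∏ p ∈ S, p ∣ q :=
  Finset.prod_dvd_of_coprime ((primesOf_pairwise q).mono (by simpa using hS))
    fun _ hp => dvd_of_mem_primesOf (hS hp)

theorem mem_of_dvd_prod {q p : GaussianInt} {S : Finset GaussianInt} (hS : S ⊆ primesOf q)
    (hp : p ∈ primesOf q) (h : p ∣ ∏ p ∈ S, p) : p ∈ S := by
  obtain ⟨p', hp', hpp⟩ := ((prime_of_mem_primesOf hp).dvd_finsetProd_iff _).mp h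
  rwa [eq_of_associated_of_mem_primesOf hp (hS hp') hpp]

theorem prod_ne_zero_of_subset {q : GaussianInt} {S : Finset GaussianInt}
    (hS : S ⊆ primesOf q) : ∏ p ∈ S, p ≠ 0 :=
  Finset.prod_ne_zero_iff.mpr fun _ hp => (prime_of_mem_primesOf (hS hp)).ne_zero

/-- The number of reduced classes is at least `N(q) / 2 ^ ω(q)`: a class `x` is determined by the
set of the primes `p ∣ q` not dividing `x` together with the reduced class obtained by adding to
`x` the product of these primes. -/
theorem nrm_le_card_units (q : GaussianInt) [hq : NeZero q] :
    nrm q ≤ 2 ^ #(primesOf q) * Nat.card (Residue q)ˣ := by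
  classical
  have hcop : ∀ a : GaussianInt,
      IsCoprime (a + ∏ p ∈ (primesOf q).filter (fun p => ¬ p ∣ a), p) q := by
    intro a
    refine isCoprime_of_prime_dvd (fun h => hq.out h.2) fun p hp h1 h2 => ?_
    obtain ⟨p', hp', hass⟩ := exists_mem_primesOf hq.out hp h2
    have h1 := hass.symm.dvd.trans h1
    have hpp := prime_of_mem_primesOf hp'
    by_cases hpa : p' ∣ a
    · have h3 := mem_of_dvd_prod (filter_subset _ _) hp' ((dvd_add_right hpa).mp h1)
      exact (mem_filter.mp h3).2 hpa
    · exact hpa ((dvd_add_left (dvd_prod_of_mem _ (mem_filter.mpr ⟨hp', hpa⟩))).mp h1)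
  let rep : Residue q → GaussianInt := Function.surjInv Ideal.Quotient.mk_surjective
  have hrep : ∀ x, cls q (rep x) = x := Function.surjInv_eq Ideal.Quotient.mk_surjective
  let F : Residue q → (primesOf q).powerset × (Residue q)ˣ := fun x =>
    (⟨(primesOf q).filter (fun p => ¬ p ∣ rep x), mem_powerset.mpr (filter_subset _ _)⟩,
      unitCls (hcop (rep x)))
  have hF : Function.Injective F := by
    intro x y hxy
    have h1 := congrArg (fun z => (z.1 : Finset GaussianInt)) hxy
    have h2 := congrArg Prod.snd hxy
    simp only [F] at h1 h2
    rw [unitCls_eq_iff, h1, add_sub_add_right_eq_sub, ← mk_eq_mk_iff] at h2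
    rw [← hrep x, ← hrep y]
    exact h2
  have hc := Nat.card_le_card_of_injective F hF
  rw [Nat.card_prod, Nat.card_eq_fintype_card (α := (primesOf q).powerset), Fintype.card_coe,
    card_powerset] at hc
  rw [← card_residue]
  exact_mod_cast hc

/-! ### Primitive characters -/

/-- The kernel of the reduction modulo `q / s`, in the form used for inclusion-exclusion. -/
theorem ker_reduce {e q s : GaussianInt} (hs : s ≠ 0) (h : q = s * e) :
    (reduce (Dvd.intro_left s h.symm)).ker = congrSubgroup (cls q s) := by
  ext x
  obtain ⟨a, ha, rfl⟩ := exists_unitCls x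
  rw [MonoidHom.mem_ker, unitCls_mem_congrSubgroup,
    reduce_unitCls _ ha (ha.of_isCoprime_of_dvd_right (Dvd.intro_left s h.symm)), ← unitCls_one,
    unitCls_eq_iff, h, mul_dvd_mul_iff_left hs]

/-- A primitive character is nontrivial on the kernel of the reduction modulo `q / p`. -/
theorem IsPrimitive.exists_ne_one {q : GaussianInt} (hq : q ≠ 0) {χ : ModChar q}
    (h : IsPrimitive χ) {p : GaussianInt} (hp : Prime p) (hpq : p ∣ q) :
    ∃ x ∈ congrSubgroup (cls q p), χ x ≠ 1 := by
  by_contra! hcon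
  obtain ⟨e, he⟩ := hpq
  have he0 : e ≠ 0 := by rintro rfl; exact hq (by rw [he, mul_zero])
  have hd : e ∣ q := Dvd.intro_left p he.symm
  have hnd : ¬ q ∣ e := by
    rw [he]
    intro h'
    refine hp.not_isUnit (isUnit_of_dvd_one ?_)
    rwa [← mul_dvd_mul_iff_right he0, one_mul]
  have hker : (reduce hd).ker ≤ χ.ker := by
    rw [ker_reduce hp.ne_zero he]
    exact fun x hx => hcon x hx
  exact h e hd hnd ⟨(reduce hd).liftOfSurjective (reduce_surjective hq hd) ⟨χ, hker⟩,
    Eq.symm (MonoidHom.liftOfRightInverse_comp (reduce hd) _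
      (Function.rightInverse_surjInv (reduce_surjective hq hd)) ⟨χ, hker⟩)⟩

/-- Primitivity need only be tested on the maximal proper divisors `q / p`. -/
theorem isPrimitive_iff {q : GaussianInt} (hq : q ≠ 0) (χ : ModChar q) :
    IsPrimitive χ ↔ ∀ p ∈ primesOf q, ∃ x ∈ congrSubgroup (cls q p), χ x ≠ 1 := by
  refine ⟨fun h p hp => h.exists_ne_one hq (prime_of_mem_primesOf hp) (dvd_of_mem_primesOf hp),
    fun h d hd hnd hχ => ?_⟩
  obtain ⟨χ', rfl⟩ := hχ
  obtain ⟨c, hc⟩ := hd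
  have hc0 : c ≠ 0 := by rintro rfl; exact hq (by rw [hc, mul_zero])
  have hcu : ¬ IsUnit c := fun hu => hnd (by rw [hc]; exact (hu.dvd_mul_right).mp (by simp))
  obtain ⟨p, hp, hpc⟩ := WfDvdMonoid.exists_irreducible_factor hcu hc0
  obtain ⟨p', hp', hass⟩ := exists_mem_primesOf hq hp.prime (hpc.trans (Dvd.intro_left d hc.symm))
  obtain ⟨x, hx, hne⟩ := h p' hp'
  apply hne
  have hpc' := hass.symm.dvd.trans hpc
  have hx2 : x ∈ congrSubgroup (cls q c) := congrSubgroup_mono (map_dvd _ hpc') hx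
  have h2 : q = c * d := by rw [hc, mul_comm]
  rw [← ker_reduce hc0 h2, MonoidHom.mem_ker] at hx2
  rw [MonoidHom.comp_apply, hx2, map_one]

/-- Among the classes `1 + (q / p) t`, for `t` modulo `p`, at most one is not reduced. -/
theorem nrm_sub_one_le_card_congrSubgroup {q p : GaussianInt} [hq : NeZero q] (hp : Prime p)
    (hpq : p ∣ q) : nrm p - 1 ≤ Nat.card (congrSubgroup (cls q p)) := by
  classical
  have : NeZero p := ⟨hp.ne_zero⟩
  obtain ⟨e, he⟩ := hpq
  have he0 : e ≠ 0 := by rintro rfl; exact hq.out (by rw [he, mul_zero])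
  let rep : Residue p → GaussianInt := Function.surjInv Ideal.Quotient.mk_surjective
  have hrep : ∀ x, cls p (rep x) = x := Function.surjInv_eq Ideal.Quotient.mk_surjective
  have hcop : ∀ t : GaussianInt, ¬ p ∣ 1 + e * t → IsCoprime (1 + e * t) q := by
    intro t ht
    refine isCoprime_of_prime_dvd (fun h => hq.out h.2) fun r hr h1 h2 => ?_
    rw [he] at h2
    rcases hr.dvd_or_dvd h2 with h3 | h3
    · exact ht ((hr.associated_of_dvd hp h3).symm.dvd.trans h1)
    · exact hr.not_isUnit (isUnit_of_dvd_one ((dvd_add_left (h3.mul_right t)).mp h1))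
  let F : {t : Residue p // ¬ p ∣ 1 + e * rep t} → congrSubgroup (cls q p) := fun t =>
    ⟨unitCls (hcop _ t.2), by
      rw [unitCls_mem_congrSubgroup, he, add_sub_cancel_left]
      exact ⟨rep t, by ring⟩⟩
  have hF : Function.Injective F := by
    rintro ⟨t, ht⟩ ⟨t', ht'⟩ h
    have h1 := congrArg Subtype.val h
    simp only [F, unitCls_eq_iff] at h1
    have h2 : q ∣ e * (rep t - rep t') := by convert h1 using 1; ring
    rw [he, mul_comm p e, mul_dvd_mul_iff_left he0, ← mk_eq_mk_iff] at h2
    exact Subtype.ext ((hrep t).symm.trans (h2.trans (hrep t')))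
  have hbad : Nat.card {t : Residue p // p ∣ 1 + e * rep t} ≤ 1 := by
    rw [Finite.card_le_one_iff_subsingleton]
    constructor
    rintro ⟨t, ht⟩ ⟨t', ht'⟩
    have h1 : p ∣ e * (rep t - rep t') := by convert dvd_sub ht ht' using 1; ring
    rcases hp.dvd_or_dvd h1 with h2 | h2
    · exact absurd (isUnit_of_dvd_one ((dvd_add_left (h2.mul_right _)).mp ht)) hp.not_isUnit
    · rw [← mk_eq_mk_iff] at h2
      exact Subtype.ext ((hrep t).symm.trans (h2.trans (hrep t')))
  have hsum := Nat.card_congr (Equiv.sumCompl fun t : Residue p => p ∣ 1 + e * rep t)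
  rw [Nat.card_sum] at hsum
  have hle := Nat.card_le_card_of_injective F hF
  rw [← card_residue, sub_le_iff_le_add]
  exact_mod_cast (by omega : Nat.card (Residue p) ≤ Nat.card (congrSubgroup (cls q p)) + 1)

theorem card_div_card_congrSubgroup_le {q s e : GaussianInt} [hq : NeZero q] (h : q = s * e) :
    (Nat.card (Residue q)ˣ : ℝ) / Nat.card (congrSubgroup (cls q s)) ≤ nrm e := by
  have hs : s ≠ 0 := by rintro rfl; exact hq.out (by rw [h, zero_mul])
  have : NeZero e := ⟨by rintro rfl; exact hq.out (by rw [h, mul_zero])⟩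
  have hK : (0 : ℝ) < Nat.card (congrSubgroup (cls q s)) := by exact_mod_cast Nat.card_pos
  have h1 := Subgroup.card_mul_index (congrSubgroup (cls q s))
  have h2 : (congrSubgroup (cls q s)).index ≤ Nat.card (Residue e) := by
    rw [← ker_reduce hs h, Subgroup.index_ker]
    refine Nat.card_le_card_of_injective
      (fun y : (reduce (Dvd.intro_left s h.symm)).range => ((y : (Residue e)ˣ) : Residue e)) ?_
    intro y y' hy
    exact Subtype.ext (Units.ext hy)
  rw [← h1, Nat.cast_mul, mul_div_cancel_left₀ _ hK.ne', ← card_residue]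
  exact_mod_cast h2

/-! ### The induced characters -/

theorem isCoprime_lam {q : GaussianInt} (hq : IsCoprime q 2) : IsCoprime lam q := by
  have h : (⟨1, 1⟩ : GaussianInt) ∣ 2 := ⟨⟨1, -1⟩, by decide⟩
  exact (hq.of_isCoprime_of_dvd_right h).symm.pow_left

theorem ne_zero_of_isCoprime_two {q : GaussianInt} (hq : IsCoprime q 2) : q ≠ 0 := by
  rintro rfl
  rw [isCoprime_zero_left] at hq
  obtain ⟨v, hv⟩ := isUnit_iff_dvd_one.mp hq
  have := congrArg Zsqrtd.re hv
  simp at this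
  omega

/-- The value of `χ̃` at a class that is congruent to the unit `u` modulo `(1 + i)³`. -/
theorem tilde_apply {q : GaussianInt} (χ : ModChar q) {n : (Residue (lam * q))ˣ}
    {u : GaussianIntˣ} (hn : reduce (Dvd.intro q rfl : lam ∣ lam * q) n = unitMap lam u) :
    tilde χ n = χ ((unitMap q u)⁻¹ * reduce (Dvd.intro_left lam rfl : q ∣ lam * q) n) := by
  have h1 : unitPart q n = u := by
    rw [unitPart, MonoidHom.comp_apply, hn]
    exact (MulEquiv.ofBijective (unitMap lam) unitMap_lam_bijective).symm_apply_apply u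
  simp [tilde, primaryPart, h1, reduce_unitMap]

theorem tilde_apply_of_reduce_eq_one {q : GaussianInt} (χ : ModChar q) {n : (Residue (lam * q))ˣ}
    (hn : reduce (Dvd.intro q rfl : lam ∣ lam * q) n = 1) :
    tilde χ n = χ (reduce (Dvd.intro_left lam rfl : q ∣ lam * q) n) := by
  rw [tilde_apply χ (u := 1) (by rw [hn, map_one]), map_one, inv_one, one_mul]

theorem tilde_injective {q : GaussianInt} (hq : IsCoprime q 2) :
    Function.Injective (tilde (q := q)) := by
  intro χ χ' h
  ext x
  obtain ⟨n, h1, h2⟩ := exists_reduce_eq (isCoprime_lam hq) 1 x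
  rw [← h2, ← tilde_apply_of_reduce_eq_one χ h1, h, tilde_apply_of_reduce_eq_one χ' h1]

/-- If `χ` is primitive and odd, `χ̃` is primitive modulo `(1 + i)³ q`: at the prime `1 + i` this
is seen on the class that is `-1` modulo `(1 + i)³` and `1` modulo `q`. -/
theorem tilde_exists_ne_one {q : GaussianInt} (hq : IsCoprime q 2) {χ : ModChar q}
    (hχ : IsPrimitive χ) (hodd : IsOdd χ) {p : GaussianInt} (hp : Prime p) (hpq : p ∣ lam * q) :
    ∃ x ∈ congrSubgroup (cls (lam * q) p), tilde χ x ≠ 1 := by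
  have hc := isCoprime_lam hq
  rcases hp.dvd_or_dvd hpq with h | h
  · obtain ⟨n, h1, h2⟩ := exists_reduce_eq hc (unitMap lam (-1)) 1
    obtain ⟨a, ha, rfl⟩ := exists_unitCls n
    refine ⟨unitCls ha, ?_, ?_⟩
    · rw [unitCls_mem_congrSubgroup]
      rw [reduce_unitCls _ ha ha.of_mul_right_left, unitMap_eq (-1)
        (isCoprime_unit _ _), unitCls_eq_iff] at h1
      rw [reduce_unitCls _ ha ha.of_mul_right_right, ← unitCls_one, unitCls_eq_iff] at h2
      refine hc.mul_dvd ?_ (h2.mul_left p)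
      have hp1 : p ∣ ⟨1, 1⟩ := hp.dvd_of_dvd_pow h
      have hirr : Prime (⟨1, 1⟩ : GaussianInt) := by
        refine Irreducible.prime ⟨?_, ?_⟩
        · rw [← Zsqrtd.norm_eq_one_iff]; decide
        · intro x y hxy
          have h3 := congrArg Zsqrtd.norm hxy
          rw [Zsqrtd.norm_mul] at h3
          have h4 : x.norm.natAbs * y.norm.natAbs = 2 := by
            rw [← Int.natAbs_mul, ← h3]; decide
          rw [← Zsqrtd.norm_eq_one_iff, ← Zsqrtd.norm_eq_one_iff]
          exact (Nat.prime_mul_iff.mp (h4 ▸ Nat.prime_two)).symm.imp And.right And.right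
      obtain ⟨w, hw⟩ := (hp.associated_of_dvd hirr hp1).symm.dvd
      obtain ⟨v, hv⟩ := h1
      have ha1 : a - 1 = lam * v - 2 := by
        rw [← hv]
        simp only [Units.val_neg, Units.val_one]
        ring
      rw [ha1, hw]
      refine ⟨w * ⟨1, 1⟩ * v + w * ⟨0, 1⟩, ?_⟩
      have h5 : (⟨1, 1⟩ : GaussianInt) * 2 = - (lam * ⟨0, 1⟩) := by rw [lam_eq]; decide
      linear_combination (-w) * h5
    · rw [tilde_apply χ h1, h2, mul_one]
      intro h3
      have h4 : (unitMap q (-1))⁻¹ = (-1 : (Residue q)ˣ) := by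
        rw [inv_eq_iff_eq_inv]; ext; simp [unitMap]
      rw [h4] at h3
      have h5 : (χ (-1) : ℂ) = -1 := hodd
      rw [h3, Circle.coe_one] at h5
      norm_num at h5
  · obtain ⟨x, hx, hne⟩ := hχ.exists_ne_one (ne_zero_of_isCoprime_two hq) hp h
    obtain ⟨n, h1, h2⟩ := exists_reduce_eq hc 1 x
    refine ⟨n, ?_, ?_⟩
    · obtain ⟨a, ha, rfl⟩ := exists_unitCls n
      rw [reduce_unitCls _ ha ha.of_mul_right_left, ← unitCls_one, unitCls_eq_iff] at h1
      rw [reduce_unitCls _ ha ha.of_mul_right_right] at h2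
      rw [← h2, unitCls_mem_congrSubgroup] at hx
      rw [unitCls_mem_congrSubgroup]
      exact hc.mul_dvd (h1.mul_left p) hx
    · rwa [tilde_apply_of_reduce_eq_one χ h1, h2]

theorem card_units_lam_mul_le {q : GaussianInt} [hq : NeZero q] (h : IsCoprime q 2) :
    Nat.card (Residue (lam * q))ˣ ≤ Nat.card GaussianIntˣ * Nat.card (Residue q)ˣ := by
  rw [Nat.card_congr (Equiv.ofBijective _ unitMap_lam_bijective), ← Nat.card_prod]
  refine Nat.card_le_card_of_injective (fun n => (reduce (Dvd.intro q rfl : lam ∣ lam * q) n,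
    reduce (Dvd.intro_left lam rfl : q ∣ lam * q) n)) ?_
  intro x y hxy
  obtain ⟨a, ha, rfl⟩ := exists_unitCls x
  obtain ⟨b, hb, rfl⟩ := exists_unitCls y
  simp only [Prod.mk.injEq] at hxy
  rw [reduce_unitCls _ ha ha.of_mul_right_left, reduce_unitCls _ hb hb.of_mul_right_left,
    reduce_unitCls _ ha ha.of_mul_right_right, reduce_unitCls _ hb hb.of_mul_right_right,
    unitCls_eq_iff, unitCls_eq_iff] at hxy
  rw [unitCls_eq_iff]
  exact (isCoprime_lam h).mul_dvd hxy.1 hxy.2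

/-! ### Sums over the Gaussian integers -/

/-- The Gaussian integers as pairs of integers. -/
def toPair : GaussianInt ≃ ℤ × ℤ where
  toFun z := (z.re, z.im)
  invFun v := ⟨v.1, v.2⟩
  left_inv _ := rfl
  right_inv _ := rfl

instance countable_gaussianInt : Countable GaussianInt := Countable.of_equiv _ toPair.symm

theorem sq_max_le_nrm (a : GaussianInt) :
    ((max a.re.natAbs a.im.natAbs : ℕ) : ℝ) ^ 2 ≤ nrm a := by
  rw [nrm_eq]
  have h1 : ((a.re.natAbs : ℕ) : ℝ) ^ 2 = (a.re : ℝ) ^ 2 := by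
    rw [Nat.cast_natAbs, Int.cast_abs, sq_abs]
  have h2 : ((a.im.natAbs : ℕ) : ℝ) ^ 2 = (a.im : ℝ) ^ 2 := by
    rw [Nat.cast_natAbs, Int.cast_abs, sq_abs]
  rcases max_cases a.re.natAbs a.im.natAbs with ⟨h, -⟩ | ⟨h, -⟩ <;> rw [h]
  · rw [h1]; nlinarith [sq_nonneg (a.im : ℝ)]
  · rw [h2]; nlinarith [sq_nonneg (a.re : ℝ)]

theorem summable_nrm_rpow {k : ℝ} (hk : 1 < k) :
    Summable fun a : GaussianInt => nrm a ^ (-k) := by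
  have h := EisensteinSeries.summable_one_div_norm_rpow (k := 2 * k) (by linarith)
  let e : GaussianInt ≃ (Fin 2 → ℤ) := toPair.trans (finTwoArrowEquiv ℤ).symm
  have h2 := (e.summable_iff).mpr h
  refine Summable.of_nonneg_of_le (fun a => Real.rpow_nonneg (nrm_nonneg a) _) (fun a => ?_) h2
  have h3 : ‖e a‖ = ((max a.re.natAbs a.im.natAbs : ℕ) : ℝ) := by
    rw [EisensteinSeries.norm_eq_max_natAbs]; rfl
  rw [Function.comp_apply, h3]
  rcases eq_or_ne a 0 with rfl | ha
  · simp [Real.zero_rpow (show -k ≠ 0 by linarith), Real.zero_rpow (show -(2 * k) ≠ 0 by linarith)]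
  · have hpos : (0 : ℝ) < ((max a.re.natAbs a.im.natAbs : ℕ) : ℝ) := by
      have : 0 < max a.re.natAbs a.im.natAbs := by
        rw [lt_max_iff, Int.natAbs_pos, Int.natAbs_pos]
        by_contra! h
        exact ha (Zsqrtd.ext h.1 h.2)
      exact_mod_cast this
    calc nrm a ^ (-k) ≤ (((max a.re.natAbs a.im.natAbs : ℕ) : ℝ) ^ 2) ^ (-k) :=
          Real.rpow_le_rpow_of_nonpos (by positivity) (sq_max_le_nrm a) (by linarith)
      _ = _ := by
          rw [← Real.rpow_natCast, ← Real.rpow_mul hpos.le]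
          congr 1; push_cast; ring

/-- The sum of `1 / N(a)` over `N(a) ≤ X` is `O(log X)`: there are `8 k` points `a` with
`max(|Re a|, |Im a|) = k`, and each of them has norm at least `k ^ 2`. -/
theorem sum_inv_nrm_le {X : ℝ} (hX : 1 ≤ X) (F : Finset GaussianInt)
    (hF : ∀ a ∈ F, a ≠ 0 ∧ nrm a ≤ X) : ∑ a ∈ F, (nrm a)⁻¹ ≤ 8 * (1 + Real.log X) := by
  classical
  let r : GaussianInt → ℕ := fun a => max a.re.natAbs a.im.natAbs
  have hr1 : ∀ a ∈ F, r a ∈ Finset.Icc 1 ⌊X⌋₊ := by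
    intro a ha
    obtain ⟨h0, h1⟩ := hF a ha
    have hpos : 1 ≤ r a := by
      simp only [r]
      rw [Nat.one_le_iff_ne_zero, ← Nat.pos_iff_ne_zero, lt_max_iff, Int.natAbs_pos, Int.natAbs_pos]
      by_contra! h
      exact h0 (Zsqrtd.ext h.1 h.2)
    refine Finset.mem_Icc.mpr ⟨hpos, Nat.le_floor ?_⟩
    have h2 : (r a : ℝ) ^ 2 ≤ nrm a := sq_max_le_nrm a
    have h3 : (1 : ℝ) ≤ r a := by exact_mod_cast hpos
    nlinarith
  rw [← Finset.sum_fiberwise_of_maps_to hr1]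
  have hk : ∀ k ∈ Finset.Icc 1 ⌊X⌋₊, ∑ a ∈ F with r a = k, (nrm a)⁻¹ ≤ 8 * (k : ℝ)⁻¹ := by
    intro k hk
    have hk1 : (0 : ℝ) < k := by exact_mod_cast (Finset.mem_Icc.mp hk).1
    have hcard : #{a ∈ F | r a = k} ≤ 8 * k := by
      rw [← Int.card_box (by have := (Finset.mem_Icc.mp hk).1; omega : k ≠ 0)]
      refine Finset.card_le_card_of_injOn toPair (fun a ha => ?_) toPair.injective.injOn
      rw [Finset.mem_coe, Int.mem_box]
      exact (Finset.mem_filter.mp ha).2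
    calc ∑ a ∈ F with r a = k, (nrm a)⁻¹ ≤ ∑ a ∈ F with r a = k, ((k : ℝ) ^ 2)⁻¹ := by
          refine Finset.sum_le_sum fun a ha => ?_
          have h2 : (r a : ℝ) ^ 2 ≤ nrm a := sq_max_le_nrm a
          rw [(Finset.mem_filter.mp ha).2] at h2
          exact inv_anti₀ (by positivity) h2
      _ = #{a ∈ F | r a = k} * ((k : ℝ) ^ 2)⁻¹ := by rw [Finset.sum_const, nsmul_eq_mul]
      _ ≤ (8 * k) * ((k : ℝ) ^ 2)⁻¹ := by
          gcongr
          exact_mod_cast hcard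
      _ = 8 * (k : ℝ)⁻¹ := by field_simp
  refine (Finset.sum_le_sum hk).trans ?_
  rw [← Finset.mul_sum]
  have h1 := harmonic_le_one_add_log ⌊X⌋₊
  rw [harmonic_eq_sum_Icc] at h1
  push_cast at h1
  have h2 : Real.log ⌊X⌋₊ ≤ Real.log X :=
    Real.log_le_log (by exact_mod_cast Nat.floor_pos.mpr hX) (Nat.floor_le (by linarith))
  linarith

/-! ### The weights -/

section Weights

open MeasureTheory Set

/-- The weight `∫_T^∞ exp(-π n t) t^(-1/2) dt` in the approximate functional equation. -/
def weight (n T : ℝ) : ℝ := ∫ t in Ioi T, Real.exp (-Real.pi * n * t) * t ^ (-(1 / 2) : ℝ)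

theorem integrableOn_weight_zero {n : ℝ} (hn : 0 < n) :
    IntegrableOn (fun t : ℝ => Real.exp (-Real.pi * n * t) * t ^ (-(1 / 2) : ℝ)) (Ioi 0) := by
  have h := integrableOn_rpow_mul_exp_neg_mul_rpow (p := 1) (s := -(1 / 2)) (b := Real.pi * n)
    (by norm_num) one_pos (by positivity)
  refine h.congr_fun (fun t ht => ?_) measurableSet_Ioi
  simp only [Real.rpow_one]
  rw [mul_comm]; congr 2; ring

theorem integrableOn_weight {n T : ℝ} (hn : 0 < n) (hT : 0 ≤ T) :
    IntegrableOn (fun t : ℝ => Real.exp (-Real.pi * n * t) * t ^ (-(1 / 2) : ℝ)) (Ioi T) :=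
  (integrableOn_weight_zero hn).mono_set (Ioi_subset_Ioi hT)

theorem weight_nonneg (n : ℝ) {T : ℝ} (hT : 0 ≤ T) : 0 ≤ weight n T :=
  setIntegral_nonneg measurableSet_Ioi fun _ ht =>
    mul_nonneg (Real.exp_nonneg _) (Real.rpow_nonneg (hT.trans (le_of_lt ht)) _)

theorem weight_antitone {n T T' : ℝ} (hn : 0 < n) (hT : 0 ≤ T) (h : T ≤ T') :
    weight n T' ≤ weight n T := by
  refine setIntegral_mono_set (integrableOn_weight hn hT) ?_ (Ioi_subset_Ioi h).eventuallyLE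
  refine (ae_restrict_iff' measurableSet_Ioi).mpr (Filter.Eventually.of_forall fun _ ht => ?_)
  exact mul_nonneg (Real.exp_nonneg _) (Real.rpow_nonneg (hT.trans (le_of_lt ht)) _)

theorem weight_pos {n T : ℝ} (hn : 0 < n) (hT : 0 ≤ T) : 0 < weight n T := by
  rw [weight, setIntegral_pos_iff_support_of_nonneg_ae _ (integrableOn_weight hn hT)]
  · have : Ioi T ⊆ (Function.support fun t : ℝ =>
        Real.exp (-Real.pi * n * t) * t ^ (-(1 / 2) : ℝ)) ∩ Ioi T := fun t ht =>
      ⟨(mul_pos (Real.exp_pos _) (Real.rpow_pos_of_pos (hT.trans_lt ht) _)).ne', ht⟩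
    exact lt_of_lt_of_le (by simp) (measure_mono this)
  · refine (ae_restrict_iff' measurableSet_Ioi).mpr (Filter.Eventually.of_forall fun t ht => ?_)
    exact mul_nonneg (Real.exp_nonneg _) (Real.rpow_nonneg (hT.trans (le_of_lt ht)) _)

theorem weight_zero {n : ℝ} (hn : 0 < n) : weight n 0 = n ^ (-(1 / 2) : ℝ) := by
  have h := Real.integral_rpow_mul_exp_neg_mul_Ioi (a := 1 / 2) (r := Real.pi * n)
    (by norm_num) (by positivity)
  have h2 : weight n 0 =
      ∫ t in Ioi (0 : ℝ), t ^ ((1 / 2 : ℝ) - 1) * Real.exp (-(Real.pi * n * t)) := by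
    refine setIntegral_congr_fun measurableSet_Ioi fun t ht => ?_
    rw [mul_comm]; congr 2 <;> ring
  rw [h2, h, Real.Gamma_one_half_eq, Real.sqrt_eq_rpow, one_div, Real.inv_rpow (by positivity),
    Real.mul_rpow Real.pi_pos.le hn.le, Real.rpow_neg hn.le]
  have := (Real.rpow_pos_of_pos Real.pi_pos (1 / 2)).ne'
  field_simp

theorem weight_le {n T : ℝ} (hn : 0 < n) (hT : 0 ≤ T) : weight n T ≤ n ^ (-(1 / 2) : ℝ) := by
  rw [← weight_zero hn]; exact weight_antitone hn le_rfl hT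

theorem exists_exp_neg_le (k : ℝ) (hk : 0 ≤ k) :
    ∃ C : ℝ, 0 < C ∧ ∀ x : ℝ, 0 < x → Real.exp (-x) ≤ C * x ^ (-k) := by
  refine ⟨(⌈k⌉₊.factorial : ℝ), by positivity, fun x hx => ?_⟩
  have hxk := Real.rpow_pos_of_pos hx k
  rw [Real.exp_neg, Real.rpow_neg hx.le, ← div_eq_mul_inv, le_div_iff₀ hxk, ← div_eq_inv_mul,
    div_le_iff₀ (Real.exp_pos x)]
  have hf : (1 : ℝ) ≤ (⌈k⌉₊.factorial : ℝ) := by exact_mod_cast Nat.factorial_pos _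
  have he := Real.exp_pos x
  rcases le_total x 1 with h | h
  · calc x ^ k ≤ 1 := Real.rpow_le_one hx.le h hk
      _ ≤ 1 * Real.exp x := by rw [one_mul]; exact Real.one_le_exp hx.le
      _ ≤ _ := by gcongr
  · calc x ^ k ≤ x ^ (⌈k⌉₊ : ℝ) := Real.rpow_le_rpow_of_exponent_le h (Nat.le_ceil k)
      _ = x ^ ⌈k⌉₊ := Real.rpow_natCast _ _
      _ ≤ _ := by
        have := Real.pow_div_factorial_le_exp x hx.le ⌈k⌉₊
        rwa [div_le_iff₀ (by positivity), mul_comm] at this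

theorem exists_weight_le (k : ℝ) (hk : 1 ≤ k) :
    ∃ C : ℝ, 0 < C ∧ ∀ n T : ℝ, 0 < n → 0 < T →
      weight n T ≤ C * n ^ (-k) * T ^ (1 / 2 - k) := by
  obtain ⟨C, hC, h⟩ := exists_exp_neg_le k (by linarith)
  refine ⟨C * Real.pi ^ (-k) * (1 / (k - 1 / 2)), by
    have : 0 < k - 1 / 2 := by linarith
    positivity, fun n T hn hT => ?_⟩
  have h1 : weight n T ≤ ∫ t in Ioi T, C * (Real.pi * n) ^ (-k) * t ^ (-k - 1 / 2) := by
    refine setIntegral_mono_on (integrableOn_weight hn hT.le)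
      ((integrableOn_Ioi_rpow_of_lt (by linarith) hT).const_mul _) measurableSet_Ioi fun t ht => ?_
    have ht : 0 < t := hT.trans ht
    have h2 := h (Real.pi * n * t) (by positivity)
    rw [Real.mul_rpow (by positivity) ht.le] at h2
    calc _ = Real.exp (-(Real.pi * n * t)) * t ^ (-(1 / 2) : ℝ) := by congr 2; ring
      _ ≤ C * ((Real.pi * n) ^ (-k) * t ^ (-k)) * t ^ (-(1 / 2) : ℝ) := by gcongr
      _ = _ := by rw [sub_eq_add_neg, Real.rpow_add ht]; ring
  refine h1.trans (le_of_eq ?_)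
  rw [integral_const_mul, integral_Ioi_rpow_of_lt (by linarith) hT,
    Real.mul_rpow Real.pi_pos.le hn.le, show -k - 1 / 2 + 1 = 1 / 2 - k by ring,
    show (1 : ℝ) / 2 - k = -(k - 1 / 2) by ring, div_neg, neg_div, neg_neg]
  ring

end Weights

/-! ### Gauss sums -/

/-- The function `a ↦ exp(2πi Re(a / m))` on the Gaussian integers. -/
def expRe (m a : GaussianInt) : ℂ :=
  Complex.exp (2 * Real.pi * Complex.I *
    ((GaussianInt.toComplex a / GaussianInt.toComplex m).re : ℝ))

theorem expRe_add (m a b : GaussianInt) : expRe m (a + b) = expRe m a * expRe m b := by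
  rw [expRe, expRe, expRe, ← Complex.exp_add, map_add, add_div, Complex.add_re]
  congr 1; push_cast; ring

theorem expRe_eq_one {m a : GaussianInt} (h : m ∣ a) : expRe m a = 1 := by
  obtain ⟨b, rfl⟩ := h
  rcases eq_or_ne m 0 with rfl | hm
  · simp [expRe]
  · rw [expRe, map_mul, mul_div_cancel_left₀ _ (GaussianInt.toComplex_eq_zero.not.mpr hm),
      ← GaussianInt.intCast_re, Complex.exp_eq_one_iff]
    exact ⟨b.re, by push_cast; ring⟩

theorem expRe_congr {m a b : GaussianInt} (h : m ∣ a - b) : expRe m a = expRe m b := by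
  rw [← sub_add_cancel a b, expRe_add, expRe_eq_one h, one_mul]

theorem norm_expRe (m a : GaussianInt) : ‖expRe m a‖ = 1 := by
  rw [expRe, show (2 * Real.pi * Complex.I *
    ((GaussianInt.toComplex a / GaussianInt.toComplex m).re : ℝ) : ℂ) =
    ((2 * Real.pi * (GaussianInt.toComplex a / GaussianInt.toComplex m).re : ℝ) : ℂ) * Complex.I by
    push_cast; ring, Complex.norm_exp_ofReal_mul_I]

/-- The pairing `(a, b) ↦ exp(2πi Re(a b / m))` on the classes modulo `m` is nondegenerate. -/
theorem dvd_of_expRe_eq_one {m a : GaussianInt} (hm : m ≠ 0)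
    (h : ∀ b, expRe m (a * b) = 1) : m ∣ a := by
  have hm' := GaussianInt.toComplex_eq_zero.not.mpr hm
  have key : ∀ b, ∃ n : ℤ, (GaussianInt.toComplex (a * b) / GaussianInt.toComplex m).re = n := by
    intro b
    obtain ⟨n, hn⟩ := Complex.exp_eq_one_iff.mp (h b)
    refine ⟨n, ?_⟩
    have h2 : (2 * Real.pi * Complex.I : ℂ) ≠ 0 := Complex.two_pi_I_ne_zero
    rw [mul_comm] at hn
    exact_mod_cast mul_right_cancel₀ h2 hn
  obtain ⟨x, hx⟩ := key 1
  obtain ⟨y, hy⟩ := key ⟨0, 1⟩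
  refine ⟨⟨x, -y⟩, GaussianInt.toComplex_injective ?_⟩
  rw [map_mul, mul_comm, ← div_eq_iff hm']
  rw [map_mul, map_one, mul_one] at hx
  have hI : GaussianInt.toComplex ⟨0, 1⟩ = Complex.I := by simp [GaussianInt.toComplex_def]
  rw [map_mul, hI, mul_div_right_comm, Complex.mul_I_re] at hy
  apply Complex.ext
  · rw [hx, ← GaussianInt.intCast_re]
  · rw [← GaussianInt.intCast_im]; push_cast; linarith

theorem exists_rep {m : GaussianInt} (x : Residue m) : ∃ a, cls m a = x :=
  Ideal.Quotient.mk_surjective x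

/-- The additive character `a ↦ exp(2πi Re(a / m))` modulo `m`. -/
def addChar (m : GaussianInt) : AddChar (Residue m) ℂ where
  toFun x := expRe m (exists_rep x).choose
  map_zero_eq_one' := expRe_eq_one (cls_eq_zero.mp (exists_rep (0 : Residue m)).choose_spec)
  map_add_eq_mul' x y := by
    rw [← expRe_add]
    refine expRe_congr ?_
    rw [← mk_eq_mk_iff, map_add, (exists_rep (x + y)).choose_spec, (exists_rep x).choose_spec,
      (exists_rep y).choose_spec]

theorem addChar_cls (m a : GaussianInt) : addChar m (cls m a) = expRe m a :=
  expRe_congr ((mk_eq_mk_iff _ _ _).mp (exists_rep (cls m a)).choose_spec)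

theorem conj_addChar {m : GaussianInt} (x : Residue m) :
    (starRingEnd ℂ) (addChar m x) = addChar m (-x) := by
  obtain ⟨a, rfl⟩ := exists_rep x
  have h : addChar m (cls m a) * addChar m (-cls m a) = 1 := by
    rw [← AddChar.map_add_eq_mul, add_neg_cancel, AddChar.map_zero_eq_one]
  have hn : ‖addChar m (cls m a)‖ = 1 := by rw [addChar_cls, norm_expRe]
  rw [← Complex.inv_eq_conj hn]
  exact (eq_inv_of_mul_eq_one_right h).symm

theorem sum_addChar_mul {m : GaussianInt} [hm : NeZero m]
    [DecidableEq (Residue m)] (b : Residue m) :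
    ∑ x : Residue m, addChar m (x * b) = if b = 0 then (Nat.card (Residue m) : ℂ) else 0 := by
  have hprim : (addChar m).IsPrimitive := by
    intro b hb h
    obtain ⟨a, rfl⟩ := exists_rep b
    refine hb (cls_eq_zero.mpr (dvd_of_expRe_eq_one hm.out fun c => ?_))
    have h1 := DFunLike.congr_fun h (cls m c)
    rwa [AddChar.mulShift_apply, AddChar.one_apply, ← map_mul, addChar_cls] at h1
  rw [AddChar.sum_mulShift b hprim, Nat.card_eq_fintype_card]
  simp

/-- The Gauss sum of `ξ`, with the additive character twisted by `z`. -/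
def gauss {m : GaussianInt} [NeZero m] (ξ : ModChar m) (z : Residue m) : ℂ :=
  letI := Fintype.ofFinite (Residue m)ˣ
  ∑ x : (Residue m)ˣ, (ξ x : ℂ) * addChar m (x * z)

/-- `ξ` is nontrivial on the kernel of the reduction modulo `m / p` for every prime `p ∣ m`. For
`m ≠ 0` this means that `ξ` is primitive; this form is the one in which Gauss sums use it. -/
def NontrivialAtPrimes {m : GaussianInt} (ξ : ModChar m) : Prop :=
  ∀ p : GaussianInt, Prime p → p ∣ m → ∃ x ∈ congrSubgroup (cls m p), ξ x ≠ 1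

theorem gauss_mul_unit {m : GaussianInt} [NeZero m] (ξ : ModChar m) (z : Residue m)
    (u : (Residue m)ˣ) : gauss ξ (u * z) = (ξ u⁻¹ : ℂ) * gauss ξ z := by
  let _ := Fintype.ofFinite (Residue m)ˣ
  rw [gauss, gauss, Finset.mul_sum]
  refine Fintype.sum_equiv (Equiv.mulRight u) _ _ fun x => ?_
  change (ξ x : ℂ) * addChar m (x * (u * z)) =
    (ξ u⁻¹ : ℂ) * ((ξ (x * u) : ℂ) * addChar m (((x * u : (Residue m)ˣ) : Residue m) * z))
  rw [map_mul ξ, Circle.coe_mul, Units.val_mul, map_inv, Circle.coe_inv, mul_assoc (x : Residue m)]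
  have := Circle.coe_ne_zero (ξ u)
  field_simp

/-- For a primitive character the Gauss sum twisted by `a` is `ξ⁻¹(a)` times the Gauss sum, also when
`a` is not coprime to `m`. -/
theorem gauss_cls {m : GaussianInt} [hm : NeZero m] {ξ : ModChar m} (hξ : NontrivialAtPrimes ξ)
    (a : GaussianInt) : gauss ξ (cls m a) = ext0 ξ⁻¹ a * gauss ξ 1 := by
  by_cases h : IsCoprime a m
  · rw [ext0_of_coprime _ h, ← coe_unitCls h, ← mul_one ((unitCls h : (Residue m)ˣ) : Residue m),
      gauss_mul_unit, map_inv, MonoidHom.inv_apply]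
  · rw [ext0_of_not_coprime _ h, zero_mul]
    obtain ⟨p, hp, hpa, hpm⟩ : ∃ p, Prime p ∧ p ∣ a ∧ p ∣ m := by
      by_contra! hcon
      exact h (isCoprime_of_prime_dvd (fun h0 => hm.out h0.2) fun p hp => hcon p hp)
    obtain ⟨x, hx, hne⟩ := hξ p hp hpm
    have h1 : (x : Residue m) * cls m a = cls m a := by
      obtain ⟨b, rfl⟩ := hpa
      rw [map_mul]
      rw [mem_congrSubgroup] at hx
      linear_combination (cls m b) * hx
    have h2 := gauss_mul_unit ξ (cls m a) x
    rw [h1] at h2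
    have h3 : (1 - (ξ x⁻¹ : ℂ)) * gauss ξ (cls m a) = 0 := by linear_combination h2
    rcases mul_eq_zero.mp h3 with h4 | h4
    · refine absurd ?_ hne
      rw [map_inv] at h4
      rw [← inv_inj, inv_one]
      exact Circle.ext (by rw [Circle.coe_one]; linear_combination -h4)
    · exact h4

/-- The absolute value of the Gauss sum of a primitive character: evaluate the sum of `|gauss ξ z|²`
over all classes `z` by `gauss_cls` and by orthogonality. -/
theorem norm_gauss_sq {m : GaussianInt} [hm : NeZero m] {ξ : ModChar m}
    (hξ : NontrivialAtPrimes ξ) : ‖gauss ξ 1‖ ^ 2 = nrm m := by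
  classical
  let _ := Fintype.ofFinite (Residue m)ˣ
  have hφ : (Nat.card (Residue m)ˣ : ℂ) ≠ 0 := by exact_mod_cast Nat.card_pos.ne'
  have h1 : ∑ z : Residue m, gauss ξ z * (starRingEnd ℂ) (gauss ξ z) =
      (Nat.card (Residue m)ˣ : ℂ) * (Nat.card (Residue m) : ℂ) := by
    simp only [gauss, map_sum, Finset.sum_mul_sum, map_mul, conj_addChar]
    rw [Finset.sum_comm]
    have : ∀ x : (Residue m)ˣ, ∑ z : Residue m, ∑ y : (Residue m)ˣ,
        (ξ x : ℂ) * addChar m (x * z) * ((starRingEnd ℂ) (ξ y) * addChar m (-(y * z))) =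
        (Nat.card (Residue m) : ℂ) := by
      intro x
      rw [Finset.sum_comm]
      have h2 : ∀ y : (Residue m)ˣ, ∑ z : Residue m,
          (ξ x : ℂ) * addChar m (x * z) * ((starRingEnd ℂ) (ξ y) * addChar m (-(y * z))) =
          if y = x then (Nat.card (Residue m) : ℂ) else 0 := by
        intro y
        have h3 : ∀ z : Residue m,
            (ξ x : ℂ) * addChar m (x * z) * ((starRingEnd ℂ) (ξ y) * addChar m (-(y * z))) =
            ((ξ x : ℂ) * (starRingEnd ℂ) (ξ y)) * addChar m (z * (x - y)) := by
          intro z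
          rw [show z * ((x : Residue m) - y) = x * z + -(y * z) by ring, AddChar.map_add_eq_mul]
          ring
        simp only [h3]
        rw [← Finset.mul_sum, sum_addChar_mul]
        by_cases hxy : y = x
        · rw [if_pos hxy, hxy, sub_self, if_pos rfl, Complex.mul_conj, Complex.normSq_eq_norm_sq,
            Circle.norm_coe]
          simp
        · rw [if_neg hxy, if_neg, mul_zero]
          exact fun h => hxy (Units.ext (sub_eq_zero.mp h).symm)
      simp only [h2]
      simp
    rw [Finset.sum_congr rfl fun x _ => this x]
    simp [Nat.card_eq_fintype_card]
  have h2 : ∑ z : Residue m, gauss ξ z * (starRingEnd ℂ) (gauss ξ z) =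
      (Nat.card (Residue m)ˣ : ℂ) * (‖gauss ξ 1‖ ^ 2 : ℝ) := by
    have hval : ∀ z : Residue m, gauss ξ z * (starRingEnd ℂ) (gauss ξ z) =
        if IsUnit z then ((‖gauss ξ 1‖ ^ 2 : ℝ) : ℂ) else 0 := by
      intro z
      obtain ⟨a, rfl⟩ := exists_rep z
      rw [gauss_cls hξ, Complex.mul_conj, Complex.normSq_eq_norm_sq, norm_mul, mul_pow]
      by_cases h : IsCoprime a m
      · rw [ext0_of_coprime _ h, Circle.norm_coe, if_pos (isUnit_cls.mpr h)]; simp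
      · rw [ext0_of_not_coprime _ h, if_neg (fun h' => h (isUnit_cls.mp h'))]; simp
    simp only [hval]
    rw [← Finset.sum_filter, Finset.sum_const, nsmul_eq_mul]
    congr 2
    rw [Nat.card_eq_fintype_card, ← Finset.card_univ]
    symm
    refine Finset.card_bij (fun u _ => (u : Residue m)) (fun u _ => by simp) (fun u _ v _ h =>
      Units.ext h) fun z hz => ?_
    exact ⟨(Finset.mem_filter.mp hz).2.unit, Finset.mem_univ _, rfl⟩
  have h3 := mul_left_cancel₀ hφ (h1.symm.trans h2)
  rw [← card_residue]
  exact_mod_cast h3.symm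

/-! ### Theta series -/

section Theta

open MeasureTheory Filter Topology

theorem nrm_shift {m : GaussianInt} (hm : m ≠ 0) (r z : GaussianInt) :
    nrm (r + m * z) = nrm m *
      ((z.re + (GaussianInt.toComplex r / GaussianInt.toComplex m).re) ^ 2 +
        (z.im + (GaussianInt.toComplex r / GaussianInt.toComplex m).im) ^ 2) := by
  have hm' := GaussianInt.toComplex_eq_zero.not.mpr hm
  have h : GaussianInt.toComplex (r + m * z) =
      GaussianInt.toComplex m *
        (GaussianInt.toComplex z + GaussianInt.toComplex r / GaussianInt.toComplex m) := by
    rw [map_add, map_mul]; field_simp; ring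
  rw [nrm_eq_normSq, h, Complex.normSq_mul, ← nrm_eq_normSq, Complex.normSq_apply, Complex.add_re,
    Complex.add_im, GaussianInt.intCast_re, GaussianInt.intCast_im]
  ring

/-- The two-dimensional theta series of a class modulo `m` is a product of one-dimensional ones. -/
theorem hasSum_exp_shift {m : GaussianInt} (hm : m ≠ 0) (r : GaussianInt) {t : ℝ} (ht : 0 < t) :
    HasSum (fun z => Real.exp (-Real.pi * nrm (r + m * z) * t))
      (HurwitzZeta.evenKernel ((GaussianInt.toComplex r / GaussianInt.toComplex m).re : ℝ)
        (nrm m * t) *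
      HurwitzZeta.evenKernel ((GaussianInt.toComplex r / GaussianInt.toComplex m).im : ℝ)
        (nrm m * t)) := by
  have hN := mul_pos (nrm_pos hm) ht
  have h1 := HurwitzZeta.hasSum_int_evenKernel
    ((GaussianInt.toComplex r / GaussianInt.toComplex m).re : ℝ) hN
  have h2 := HurwitzZeta.hasSum_int_evenKernel
    ((GaussianInt.toComplex r / GaussianInt.toComplex m).im : ℝ) hN
  have h3 := h1.mul h2 (h1.summable.mul_of_nonneg h2.summable (fun _ => (Real.exp_pos _).le)
    (fun _ => (Real.exp_pos _).le))
  rw [← toPair.hasSum_iff] at h3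
  refine h3.congr_fun fun z => ?_
  simp only [Function.comp_apply, toPair, Equiv.coe_fn_mk]
  rw [← Real.exp_add, nrm_shift hm]
  congr 1; ring

theorem summable_exp_nrm {t : ℝ} (ht : 0 < t) :
    Summable fun a => Real.exp (-Real.pi * nrm a * t) := by
  simpa using (hasSum_exp_shift one_ne_zero 0 ht).summable

theorem hasSum_mul_prod {f g : ℤ → ℂ} {a b : ℂ} (hf : HasSum f a) (hg : HasSum g b) :
    HasSum (fun p : ℤ × ℤ => f p.1 * g p.2) (a * b) :=
  hf.mul hg (summable_mul_of_summable_norm hf.summable.norm hg.summable.norm)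

theorem expRe_mul (m r z : GaussianInt) : expRe m (r * z) =
    Complex.exp (2 * Real.pi * Complex.I *
      (((GaussianInt.toComplex r / GaussianInt.toComplex m).re : ℂ) * z.re -
        ((GaussianInt.toComplex r / GaussianInt.toComplex m).im : ℂ) * z.im)) := by
  rw [expRe, map_mul, mul_div_right_comm, Complex.mul_re, ← GaussianInt.intCast_re z,
    ← GaussianInt.intCast_im z]
  push_cast
  rfl

/-- The dual form of `hasSum_exp_shift`, given by Poisson summation. -/
theorem hasSum_expRe_mul_exp {m : GaussianInt} (r : GaussianInt) {t : ℝ} (ht : 0 < t) :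
    HasSum (fun z => expRe m (r * z) * (Real.exp (-Real.pi * nrm z * t) : ℂ))
      ((HurwitzZeta.cosKernel ((GaussianInt.toComplex r / GaussianInt.toComplex m).re : ℝ) t : ℂ) *
      (HurwitzZeta.cosKernel ((GaussianInt.toComplex r / GaussianInt.toComplex m).im : ℝ) t : ℂ))
        := by
  have h1 := HurwitzZeta.hasSum_int_cosKernel
    ((GaussianInt.toComplex r / GaussianInt.toComplex m).re : ℝ) ht
  have h2 := HurwitzZeta.hasSum_int_cosKernel
    ((GaussianInt.toComplex r / GaussianInt.toComplex m).im : ℝ) ht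
  have h3 := hasSum_mul_prod h1 h2
  let e : GaussianInt ≃ ℤ × ℤ :=
    ⟨fun z => (z.re, -z.im), fun v => ⟨v.1, -v.2⟩, fun z => by simp, fun v => by simp⟩
  rw [← e.hasSum_iff] at h3
  refine h3.congr_fun fun z => ?_
  have he : e z = (z.re, -z.im) := rfl
  rw [Function.comp_apply, he, expRe_mul, nrm_eq]
  push_cast
  simp only [← Complex.exp_add]
  congr 1; ring

/-- The theta series `∑ ξ(a) exp(-π N(a) t)`. -/
def theta {m : GaussianInt} (ξ : ModChar m) (t : ℝ) : ℂ :=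
  ∑' a, ext0 ξ a * (Real.exp (-Real.pi * nrm a * t) : ℂ)

theorem summable_theta {m : GaussianInt} (ξ : ModChar m) {t : ℝ} (ht : 0 < t) :
    Summable fun a => ext0 ξ a * (Real.exp (-Real.pi * nrm a * t) : ℂ) := by
  refine Summable.of_norm_bounded (summable_exp_nrm ht) fun a => ?_
  rw [norm_mul, Complex.norm_real, Real.norm_of_nonneg (Real.exp_pos _).le]
  exact mul_le_of_le_one_left (Real.exp_pos _).le (norm_ext0_le ξ a)

theorem hasSum_theta {m : GaussianInt} (ξ : ModChar m) {t : ℝ} (ht : 0 < t) :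
    HasSum (fun a => ext0 ξ a * (Real.exp (-Real.pi * nrm a * t) : ℂ)) (theta ξ t) :=
  (summable_theta ξ ht).hasSum

/-- Division with remainder by `m`, for a fixed choice of representatives of the classes. -/
def divEquiv {m : GaussianInt} (hm : m ≠ 0) : Residue m × GaussianInt ≃ GaussianInt :=
  Equiv.ofBijective (fun p => (exists_rep p.1).choose + m * p.2) <| by
    constructor
    · rintro ⟨x, z⟩ ⟨y, w⟩ h
      simp only at h
      have h1 : cls m ((exists_rep x).choose + m * z) = cls m ((exists_rep y).choose + m * w) := by
        rw [h]
      have h0 : cls m m = 0 := cls_eq_zero.mpr dvd_rfl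
      rw [map_add, map_add, map_mul, map_mul, h0, zero_mul, zero_mul, add_zero, add_zero,
        (exists_rep x).choose_spec, (exists_rep y).choose_spec] at h1
      subst h1
      rw [add_right_inj, mul_right_inj' hm] at h
      rw [h]
    · intro a
      obtain ⟨c, hc⟩ := (mk_eq_mk_iff m a _).mp (exists_rep (cls m a)).choose_spec.symm
      exact ⟨(cls m a, c), by simp only [← hc]; ring⟩

theorem divEquiv_apply {m : GaussianInt} (hm : m ≠ 0) (x : Residue m) (z : GaussianInt) :
    divEquiv hm (x, z) = (exists_rep x).choose + m * z := rfl

theorem ext0_congr {m : GaussianInt} (ξ : ModChar m) {a b : GaussianInt}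
    (h : cls m a = cls m b) : ext0 ξ a = ext0 ξ b := by
  by_cases ha : IsCoprime a m
  · have hb : IsCoprime b m := isUnit_cls.mp (h ▸ isUnit_cls.mpr ha)
    rw [ext0_of_coprime _ ha, ext0_of_coprime _ hb]
    congr 2
    exact Units.ext h
  · have hb : ¬ IsCoprime b m := fun hb => ha (isUnit_cls.mp (h ▸ isUnit_cls.mpr hb))
    rw [ext0_of_not_coprime _ ha, ext0_of_not_coprime _ hb]

theorem theta_eq_sum {m : GaussianInt} [hm : NeZero m] (ξ : ModChar m) {t : ℝ} (ht : 0 < t) :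
    theta ξ t = ∑ x : Residue m, ext0 ξ (exists_rep x).choose *
      ((HurwitzZeta.evenKernel ((GaussianInt.toComplex (exists_rep x).choose /
        GaussianInt.toComplex m).re : ℝ) (nrm m * t) *
      HurwitzZeta.evenKernel ((GaussianInt.toComplex (exists_rep x).choose /
        GaussianInt.toComplex m).im : ℝ) (nrm m * t) : ℝ) : ℂ) := by
  have h := (divEquiv hm.out).hasSum_iff.mpr (hasSum_theta ξ ht)
  refine (h.prod_fiberwise (g := fun x : Residue m => ext0 ξ (exists_rep x).choose *
      ((HurwitzZeta.evenKernel ((GaussianInt.toComplex (exists_rep x).choose /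
        GaussianInt.toComplex m).re : ℝ) (nrm m * t) *
      HurwitzZeta.evenKernel ((GaussianInt.toComplex (exists_rep x).choose /
        GaussianInt.toComplex m).im : ℝ) (nrm m * t) : ℝ) : ℂ)) fun x => ?_).unique
    (hasSum_fintype _)
  have h2 := (Complex.hasSum_ofReal.mpr
    (hasSum_exp_shift hm.out (exists_rep x).choose ht)).mul_left (ext0 ξ (exists_rep x).choose)
  refine h2.congr_fun fun z => ?_
  rw [Function.comp_apply, divEquiv_apply]
  congr 1
  refine ext0_congr ξ ?_
  rw [map_add, map_mul, cls_eq_zero.mpr dvd_rfl, zero_mul, add_zero]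

theorem continuousOn_theta {m : GaussianInt} [hm : NeZero m] (ξ : ModChar m) :
    ContinuousOn (theta ξ) (Set.Ioi 0) := by
  have h : ContinuousOn (fun t : ℝ => ∑ x : Residue m, ext0 ξ (exists_rep x).choose *
      ((HurwitzZeta.evenKernel ((GaussianInt.toComplex (exists_rep x).choose /
        GaussianInt.toComplex m).re : ℝ) (nrm m * t) *
      HurwitzZeta.evenKernel ((GaussianInt.toComplex (exists_rep x).choose /
        GaussianInt.toComplex m).im : ℝ) (nrm m * t) : ℝ) : ℂ)) (Set.Ioi 0) := by
    have hmul : ContinuousOn (fun t : ℝ => nrm m * t) (Set.Ioi 0) := by fun_prop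
    have hmaps : Set.MapsTo (fun t : ℝ => nrm m * t) (Set.Ioi 0) (Set.Ioi 0) := fun t ht =>
      mul_pos (nrm_pos hm.out) ht
    refine continuousOn_finsetSum _ fun x _ => continuousOn_const.mul ?_
    refine Complex.continuous_ofReal.comp_continuousOn (ContinuousOn.mul ?_ ?_)
    · exact (HurwitzZeta.continuousOn_evenKernel _).comp hmul hmaps
    · exact (HurwitzZeta.continuousOn_evenKernel _).comp hmul hmaps
  exact h.congr fun t ht => theta_eq_sum ξ ht

theorem sum_residue_ext0 {m : GaussianInt} [NeZero m] (ξ : ModChar m) (z : GaussianInt) :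
    ∑ x : Residue m, ext0 ξ (exists_rep x).choose * expRe m ((exists_rep x).choose * z) =
      gauss ξ (cls m z) := by
  classical
  let _ := Fintype.ofFinite (Residue m)ˣ
  rw [gauss]
  symm
  refine Finset.sum_of_injOn (fun u => (u : Residue m)) (fun u _ v _ h => Units.ext h)
    (fun u _ => by simp) (fun x _ hx => ?_) (fun u _ => ?_)
  · rw [ext0_of_not_coprime, zero_mul]
    intro h
    rw [← isUnit_cls, (exists_rep x).choose_spec] at h
    exact hx ⟨h.unit, by simp, rfl⟩
  · have hs := (exists_rep (u : Residue m)).choose_spec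
    have h : IsCoprime (exists_rep (u : Residue m)).choose m := by
      rw [← isUnit_cls, hs]; exact u.isUnit
    have hu : unitCls h = u := Units.ext hs
    rw [ext0_of_coprime ξ h, hu, ← addChar_cls, map_mul (cls m), hs]

/-- The transformation formula of the theta series of a primitive character. -/
theorem theta_one_div {m : GaussianInt} [hm : NeZero m] {ξ : ModChar m}
    (hξ : NontrivialAtPrimes ξ) {t : ℝ} (ht : 0 < t) :
    theta ξ (1 / t) = gauss ξ 1 / nrm m * t * theta ξ⁻¹ (t / nrm m) := by
  have hN := nrm_pos hm.out
  rw [theta_eq_sum ξ (by positivity)]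
  have h1 : ∀ x : Residue m, ext0 ξ (exists_rep x).choose *
      ((HurwitzZeta.evenKernel ((GaussianInt.toComplex (exists_rep x).choose /
        GaussianInt.toComplex m).re : ℝ) (nrm m * (1 / t)) *
      HurwitzZeta.evenKernel ((GaussianInt.toComplex (exists_rep x).choose /
        GaussianInt.toComplex m).im : ℝ) (nrm m * (1 / t)) : ℝ) : ℂ) =
      (t / nrm m : ℂ) * (ext0 ξ (exists_rep x).choose *
      ((HurwitzZeta.cosKernel ((GaussianInt.toComplex (exists_rep x).choose /
        GaussianInt.toComplex m).re : ℝ) (t / nrm m) : ℂ) *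
      (HurwitzZeta.cosKernel ((GaussianInt.toComplex (exists_rep x).choose /
        GaussianInt.toComplex m).im : ℝ) (t / nrm m) : ℂ))) := by
    intro x
    have h2 : 1 / (nrm m * (1 / t)) = t / nrm m := by field_simp
    have h3 : (nrm m * (1 / t)) ^ (1 / 2 : ℝ) * (nrm m * (1 / t)) ^ (1 / 2 : ℝ) =
        nrm m * (1 / t) := by
      rw [← Real.rpow_add (by positivity)]; norm_num
    have h4 : (1 / (nrm m * (1 / t)) ^ (1 / 2 : ℝ)) * (1 / (nrm m * (1 / t)) ^ (1 / 2 : ℝ)) =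
        t / nrm m := by
      rw [one_div_mul_one_div, h3, h2]
    rw [HurwitzZeta.evenKernel_functional_equation, HurwitzZeta.evenKernel_functional_equation, h2,
      mul_mul_mul_comm, h4]
    push_cast
    ring
  rw [Finset.sum_congr rfl fun x _ => h1 x, ← Finset.mul_sum]
  have h5 : HasSum (fun z => ∑ x : Residue m, ext0 ξ (exists_rep x).choose *
      (expRe m ((exists_rep x).choose * z) * (Real.exp (-Real.pi * nrm z * (t / nrm m)) : ℂ)))
      (∑ x : Residue m, ext0 ξ (exists_rep x).choose *
      ((HurwitzZeta.cosKernel ((GaussianInt.toComplex (exists_rep x).choose /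
        GaussianInt.toComplex m).re : ℝ) (t / nrm m) : ℂ) *
      (HurwitzZeta.cosKernel ((GaussianInt.toComplex (exists_rep x).choose /
        GaussianInt.toComplex m).im : ℝ) (t / nrm m) : ℂ))) :=
    hasSum_sum fun x _ => (hasSum_expRe_mul_exp _ (by positivity)).mul_left _
  have h6 : HasSum (fun z => ∑ x : Residue m, ext0 ξ (exists_rep x).choose *
      (expRe m ((exists_rep x).choose * z) * (Real.exp (-Real.pi * nrm z * (t / nrm m)) : ℂ)))
      (gauss ξ 1 * theta ξ⁻¹ (t / nrm m)) := by
    refine ((hasSum_theta ξ⁻¹ (by positivity)).mul_left (gauss ξ 1)).congr_fun fun z => ?_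
    simp only [← mul_assoc]
    rw [← Finset.sum_mul, sum_residue_ext0, gauss_cls hξ]
    ring
  rw [h5.unique h6]
  ring

/-! ### The Hecke L-function and its central value -/

theorem ext0_zero {m : GaussianInt} (hm : ¬ IsUnit m) (ξ : ModChar m) : ext0 ξ 0 = 0 :=
  ext0_of_not_coprime ξ fun h => hm (isCoprime_zero_left.mp h)

theorem exists_norm_theta_le {m : GaussianInt} (hm : ¬ IsUnit m) (ξ : ModChar m) {k : ℝ}
    (hk : 1 < k) : ∃ C : ℝ, ∀ t : ℝ, 0 < t → ‖theta ξ t‖ ≤ C * t ^ (-k) := by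
  obtain ⟨C, hC, h⟩ := exists_exp_neg_le k (by linarith)
  refine ⟨∑' a, C * Real.pi ^ (-k) * nrm a ^ (-k), fun t ht => ?_⟩
  have hs := ((summable_nrm_rpow hk).mul_left (C * Real.pi ^ (-k))).mul_right (t ^ (-k))
  rw [← tsum_mul_right]
  refine tsum_of_norm_bounded hs.hasSum fun a => ?_
  rcases eq_or_ne a 0 with rfl | ha
  · rw [ext0_zero hm, zero_mul, norm_zero, nrm_zero]
    have : (0 : ℝ) ≤ 0 ^ (-k) := Real.rpow_nonneg le_rfl _
    positivity
  · have hn := nrm_pos ha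
    rw [norm_mul, Complex.norm_real, Real.norm_of_nonneg (Real.exp_pos _).le]
    refine (mul_le_of_le_one_left (Real.exp_pos _).le (norm_ext0_le ξ a)).trans ?_
    have h2 := h (Real.pi * nrm a * t) (by positivity)
    rw [Real.mul_rpow (by positivity) ht.le, Real.mul_rpow Real.pi_pos.le hn.le] at h2
    calc _ = Real.exp (-(Real.pi * nrm a * t)) := by congr 1; ring
      _ ≤ _ := h2
      _ = _ := by ring

/-- Since `ξ(0) = 0`, the theta series has no constant term and decays faster than any power. -/
theorem isBigO_theta {m : GaussianInt} (hm : ¬ IsUnit m) (ξ : ModChar m) {c : ℝ} (hc : 0 < c)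
    (r : ℝ) : (fun t => theta ξ (t / c)) =O[atTop] (· ^ r) := by
  obtain ⟨C, hC⟩ := exists_norm_theta_le hm ξ (k := max 2 (-r)) (lt_max_of_lt_left one_lt_two)
  refine Asymptotics.IsBigO.of_bound (|C| * c⁻¹ ^ (-max 2 (-r))) ?_
  filter_upwards [eventually_ge_atTop (1 : ℝ)] with t ht
  have h0 : 0 < t := by linarith
  refine (hC (t / c) (by positivity)).trans ?_
  rw [Real.norm_of_nonneg (Real.rpow_nonneg h0.le _), div_eq_inv_mul,
    Real.mul_rpow (by positivity) h0.le, ← mul_assoc]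
  have h1 : t ^ (-max 2 (-r)) ≤ t ^ r :=
    Real.rpow_le_rpow_of_exponent_le ht (by linarith [le_max_right 2 (-r)])
  have h2 : (0 : ℝ) ≤ c⁻¹ ^ (-max 2 (-r)) := by positivity
  have h3 : (0 : ℝ) ≤ t ^ (-max 2 (-r)) := by positivity
  calc _ ≤ |C| * c⁻¹ ^ (-max 2 (-r)) * t ^ (-max 2 (-r)) := by
        gcongr; exact le_abs_self C
    _ ≤ _ := by gcongr

theorem gauss_ne_zero {m : GaussianInt} [hm : NeZero m] {ξ : ModChar m}
    (hξ : NontrivialAtPrimes ξ) : gauss ξ 1 ≠ 0 := by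
  intro h
  have := norm_gauss_sq hξ
  rw [h, norm_zero] at this
  have := nrm_pos hm.out
  simp_all

/-- The theta series of a primitive character and of its inverse, as a pair of functions related by
a functional equation. -/
def thetaPair {m : GaussianInt} [hm : NeZero m] (hu : ¬ IsUnit m) {ξ : ModChar m}
    (hξ : NontrivialAtPrimes ξ) : WeakFEPair ℂ where
  f := theta ξ
  g := fun t => theta ξ⁻¹ (t / nrm m)
  k := 1
  ε := gauss ξ 1 / nrm m
  f₀ := 0
  g₀ := 0
  hf_int := (continuousOn_theta ξ).locallyIntegrableOn measurableSet_Ioi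
  hg_int := ContinuousOn.locallyIntegrableOn ((continuousOn_theta ξ⁻¹).comp (by fun_prop)
    fun t ht => div_pos ht (nrm_pos hm.out)) measurableSet_Ioi
  hk := one_pos
  hε := div_ne_zero (gauss_ne_zero hξ) (by exact_mod_cast (nrm_pos hm.out).ne')
  h_feq t ht := by rw [theta_one_div hξ ht, Real.rpow_one, smul_eq_mul]
  hf_top r := by simpa using isBigO_theta hu ξ one_pos r
  hg_top r := by simpa using isBigO_theta hu ξ⁻¹ (nrm_pos hm.out) r

theorem isStrongFEPair_thetaPair {m : GaussianInt} [NeZero m] (hu : ¬ IsUnit m) {ξ : ModChar m}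
    (hξ : NontrivialAtPrimes ξ) : IsStrongFEPair (thetaPair hu hξ) := ⟨rfl, rfl⟩

/-- The weighted sum `∑ ξ(a) ∫_T^∞ exp(-π N(a) t) t^(-1/2) dt`. -/
def weightedSum {m : GaussianInt} (ξ : ModChar m) (T : ℝ) : ℂ :=
  ∑' a, ext0 ξ a * (weight (nrm a) T : ℂ)

theorem exists_weight_nrm_le (k : ℝ) (hk : 1 < k) : ∃ C : ℝ, 0 < C ∧ ∀ (T : ℝ), 0 < T →
    ∀ a : GaussianInt, a ≠ 0 → weight (nrm a) T ≤ C * T ^ (1 / 2 - k) * nrm a ^ (-k) := by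
  obtain ⟨C, hC, h⟩ := exists_weight_le k hk.le
  refine ⟨C, hC, fun T hT a ha => (h (nrm a) T (nrm_pos ha) hT).trans (le_of_eq (by ring))⟩

theorem summable_norm_weightedSum {m : GaussianInt} (hm : ¬ IsUnit m) (ξ : ModChar m) {T : ℝ}
    (hT : 0 < T) : Summable fun a => ‖ext0 ξ a‖ * weight (nrm a) T := by
  obtain ⟨C, hC, h⟩ := exists_weight_nrm_le 2 one_lt_two
  refine Summable.of_nonneg_of_le (fun a => mul_nonneg (norm_nonneg _) (weight_nonneg _ hT.le))
    (fun a => ?_) ((summable_nrm_rpow one_lt_two).mul_left (C * T ^ (1 / 2 - 2 : ℝ)))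
  rcases eq_or_ne a 0 with rfl | ha
  · rw [ext0_zero hm, norm_zero, zero_mul]
    have : (0 : ℝ) ≤ nrm 0 ^ (-2 : ℝ) := Real.rpow_nonneg (nrm_nonneg _) _
    positivity
  · exact (mul_le_of_le_one_left (weight_nonneg _ hT.le) (norm_ext0_le ξ a)).trans (h T hT a ha)

theorem summable_weightedSum {m : GaussianInt} (hm : ¬ IsUnit m) (ξ : ModChar m) {T : ℝ}
    (hT : 0 < T) : Summable fun a => ext0 ξ a * (weight (nrm a) T : ℂ) := by
  refine Summable.of_norm ((summable_norm_weightedSum hm ξ hT).congr fun a => ?_)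
  rw [norm_mul, Complex.norm_real, Real.norm_of_nonneg (weight_nonneg _ hT.le)]

theorem integral_theta {m : GaussianInt} (hm : ¬ IsUnit m) (ξ : ModChar m) {T : ℝ} (hT : 0 < T) :
    ∫ t in Set.Ioi T, ((t ^ (-(1 / 2) : ℝ) : ℝ) : ℂ) * theta ξ t = weightedSum ξ T := by
  let F : GaussianInt → ℝ → ℂ := fun a t =>
    ext0 ξ a * ((Real.exp (-Real.pi * nrm a * t) * t ^ (-(1 / 2) : ℝ) : ℝ) : ℂ)
  have hF1 : ∀ a, Integrable (F a) (volume.restrict (Set.Ioi T)) := by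
    intro a
    rcases eq_or_ne a 0 with rfl | ha
    · simp [F, ext0_zero hm]
    · exact ((integrableOn_weight (nrm_pos ha) hT.le).ofReal (𝕜 := ℂ)).const_mul _
  have hF2 : ∀ a, ∫ t in Set.Ioi T, ‖F a t‖ = ‖ext0 ξ a‖ * weight (nrm a) T := by
    intro a
    rw [weight, ← integral_const_mul]
    refine setIntegral_congr_fun measurableSet_Ioi fun t ht => ?_
    have h0 : 0 < t := hT.trans ht
    simp only [F, norm_mul, Complex.norm_real]
    rw [Real.norm_of_nonneg (Real.exp_pos _).le, Real.norm_of_nonneg (Real.rpow_nonneg h0.le _)]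
  have h := hasSum_integral_of_summable_integral_norm hF1
    ((summable_norm_weightedSum hm ξ hT).congr fun a => (hF2 a).symm)
  have hF3 : ∀ a, ∫ t in Set.Ioi T, F a t = ext0 ξ a * (weight (nrm a) T : ℂ) := by
    intro a
    simp only [F]
    rw [integral_const_mul, integral_complex_ofReal, weight]
  rw [weightedSum, ← tsum_congr hF3, h.tsum_eq]
  refine setIntegral_congr_fun measurableSet_Ioi fun t ht => ?_
  have h0 : 0 < t := hT.trans ht
  simp only [F]
  rw [← (hasSum_theta ξ h0).tsum_eq, ← tsum_mul_left]
  refine tsum_congr fun a => ?_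
  push_cast; ring

theorem cpow_half_sub_one {t : ℝ} (ht : 0 < t) :
    (t : ℂ) ^ ((1 / 2 : ℂ) - 1) = ((t ^ (-(1 / 2) : ℝ) : ℝ) : ℂ) := by
  rw [Complex.ofReal_cpow ht.le]; congr 1; push_cast; ring

/-- The part `(0, T]` of the Mellin integral at `1/2`, moved to `[1 / T, ∞)` by the transformation
formula. -/
theorem integral_theta_inv {m : GaussianInt} [hm : NeZero m] (hu : ¬ IsUnit m) {ξ : ModChar m}
    (hξ : NontrivialAtPrimes ξ) {T : ℝ} (hT : 0 < T) :
    ∫ t in Set.Ioc 0 T, ((t ^ (-(1 / 2) : ℝ) : ℝ) : ℂ) * theta ξ t =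
      gauss ξ 1 / (nrm m ^ (1 / 2 : ℝ) : ℝ) * weightedSum ξ⁻¹ (1 / (T * nrm m)) := by
  have hN := nrm_pos hm.out
  let F : ℝ → ℂ := Set.indicator (Set.Ici T⁻¹) fun t => theta ξ (1 / t)
  have h1 := mellin_comp_inv F (1 / 2)
  have h2 : mellin (fun t => F t⁻¹) (1 / 2) =
      ∫ t in Set.Ioc 0 T, ((t ^ (-(1 / 2) : ℝ) : ℝ) : ℂ) * theta ξ t := by
    rw [mellin, ← Set.Ioi_inter_Iic, ← setIntegral_indicator measurableSet_Iic]
    refine setIntegral_congr_fun measurableSet_Ioi fun t ht => ?_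
    have ht0 : 0 < t := ht
    by_cases h : t ≤ T
    · rw [Set.indicator_of_mem (by exact h : t ∈ Set.Iic T)]
      simp only [F]
      have hinv : 1 / t⁻¹ = t := by rw [one_div, inv_inv]
      rw [Set.indicator_of_mem (by exact inv_anti₀ ht0 h : t⁻¹ ∈ Set.Ici T⁻¹), smul_eq_mul,
        hinv, cpow_half_sub_one ht0]
    · rw [Set.indicator_of_notMem (by exact h : t ∉ Set.Iic T)]
      simp only [F]
      rw [Set.indicator_of_notMem, smul_zero]
      rw [Set.mem_Ici, inv_le_inv₀ hT ht0]
      exact h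
  have h3 : mellin F (-(1 / 2)) = ∫ t in Set.Ioi T⁻¹,
      (gauss ξ 1 / nrm m) * (((t ^ (-(1 / 2) : ℝ) : ℝ) : ℂ) * theta ξ⁻¹ (t / nrm m)) := by
    have h4 : mellin F (-(1 / 2)) = ∫ t in Set.Ioi 0, Set.indicator (Set.Ici T⁻¹)
        (fun t : ℝ => (t : ℂ) ^ (-(1 / 2 : ℂ) - 1) • theta ξ (1 / t)) t := by
      rw [mellin]
      refine setIntegral_congr_fun measurableSet_Ioi fun t ht => ?_
      simp only [F]
      rw [Set.indicator_smul]
    have hsub : Set.Ici T⁻¹ ⊆ Set.Ioi 0 := fun t ht => (inv_pos.mpr hT).trans_le ht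
    rw [h4, setIntegral_indicator measurableSet_Ici, Set.inter_eq_right.mpr hsub,
      integral_Ici_eq_integral_Ioi]
    refine setIntegral_congr_fun measurableSet_Ioi fun t ht => ?_
    have ht0 : 0 < t := (inv_pos.mpr hT).trans ht
    have ht' : (t : ℂ) ≠ 0 := by exact_mod_cast ht0.ne'
    have h5 : (t : ℂ) ^ (-(1 / 2 : ℂ) - 1) * t = ((t ^ (-(1 / 2) : ℝ) : ℝ) : ℂ) := by
      rw [← cpow_half_sub_one ht0, show (1 / 2 : ℂ) - 1 = -(1 / 2 : ℂ) - 1 + 1 by ring,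
        Complex.cpow_add _ _ ht', Complex.cpow_one]
    simp only [smul_eq_mul]
    rw [theta_one_div hξ ht0, ← h5]
    ring
  have h6 := integral_comp_mul_left_Ioi
    (fun t : ℝ => ((t ^ (-(1 / 2) : ℝ) : ℝ) : ℂ) * theta ξ⁻¹ t) T⁻¹ (inv_pos.mpr hN)
  have h7 : ∀ t ∈ Set.Ioi T⁻¹, ((t ^ (-(1 / 2) : ℝ) : ℝ) : ℂ) * theta ξ⁻¹ (t / nrm m) =
      ((nrm m ^ (-(1 / 2) : ℝ) : ℝ) : ℂ) *
      ((((nrm m)⁻¹ * t) ^ (-(1 / 2) : ℝ) : ℝ) * theta ξ⁻¹ ((nrm m)⁻¹ * t)) := by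
    intro t ht
    have ht0 : 0 < t := (inv_pos.mpr hT).trans ht
    rw [Real.mul_rpow (by positivity) ht0.le, Real.inv_rpow hN.le, div_eq_inv_mul t, ← mul_assoc,
      ← Complex.ofReal_mul]
    have := (Real.rpow_pos_of_pos hN (-(1 / 2))).ne'
    congr 2
    field_simp
  rw [← h2, h1, h3, integral_const_mul, setIntegral_congr_fun measurableSet_Ioi h7,
    integral_const_mul, h6, inv_inv, Complex.real_smul, integral_theta hu _ (by positivity),
    show (nrm m)⁻¹ * T⁻¹ = 1 / (T * nrm m) by field_simp, ← mul_assoc, ← mul_assoc]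
  congr 1
  have h8 : nrm m ^ (-(1 / 2) : ℝ) = (nrm m ^ (1 / 2 : ℝ))⁻¹ := Real.rpow_neg hN.le _
  have h9 : ((nrm m : ℝ) : ℂ) ≠ 0 := by exact_mod_cast hN.ne'
  rw [h8]
  push_cast
  field_simp

theorem card_quotient_eq_nrm (A : Ideal GaussianInt) :
    (Nat.card (GaussianInt ⧸ A) : ℝ) = nrm (Submodule.IsPrincipal.generator A) := by
  have h := card_quotient_span (Submodule.IsPrincipal.generator A)
  rwa [Ideal.span_singleton_generator] at h

/-- A nonzero Gaussian integer is the chosen generator of an ideal times a unit, in a unique way. -/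
def idealUnitEquiv : {A : Ideal GaussianInt // A ≠ ⊥} × GaussianIntˣ ≃ {a : GaussianInt // a ≠ 0} :=
  Equiv.ofBijective (fun p => ⟨Submodule.IsPrincipal.generator p.1.1 * p.2,
    mul_ne_zero ((Submodule.IsPrincipal.eq_bot_iff_generator_eq_zero _).not.mp p.1.2)
      p.2.ne_zero⟩) <| by
    constructor
    · rintro ⟨⟨A, hA⟩, u⟩ ⟨⟨B, hB⟩, v⟩ h
      have h : Submodule.IsPrincipal.generator A * u = Submodule.IsPrincipal.generator B * v :=
        congrArg Subtype.val h
      have hAB : A = B := by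
        rw [← Ideal.span_singleton_generator A, ← Ideal.span_singleton_generator B,
          Ideal.span_singleton_eq_span_singleton]
        refine ⟨u * v⁻¹, ?_⟩
        rw [Units.val_mul, ← mul_assoc, h, mul_assoc, Units.mul_inv, mul_one]
      subst hAB
      have h2 := mul_left_cancel₀
        ((Submodule.IsPrincipal.eq_bot_iff_generator_eq_zero _).not.mp hA) h
      rw [Units.ext h2]
    · rintro ⟨a, ha⟩
      obtain ⟨u, hu⟩ : Associated (Submodule.IsPrincipal.generator (Ideal.span {a})) a := by
        rw [← Ideal.span_singleton_eq_span_singleton, Ideal.span_singleton_generator]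
      exact ⟨⟨⟨Ideal.span {a}, by simpa using ha⟩, u⟩, Subtype.ext hu⟩

theorem ext0_mul_unit {m : GaussianInt} {ξ : ModChar m} (h1 : ∀ u, ξ (unitMap m u) = 1)
    (a : GaussianInt) (u : GaussianIntˣ) : ext0 ξ (a * u) = ext0 ξ a := by
  rw [← onIdeal_span ξ h1, ← onIdeal_span ξ h1]
  congr 1
  exact Ideal.span_singleton_mul_right_unit u.isUnit a

/-- Analytic continuation of the L-function and the approximate functional equation for its
central value. -/
theorem exists_isLFunction {m : GaussianInt} [hm : NeZero m] (hu : ¬ IsUnit m) {ξ : ModChar m}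
    (hξ : NontrivialAtPrimes ξ) (h1 : ∀ u, ξ (unitMap m u) = 1) :
    ∃ L : ℂ → ℂ, IsLFunction ξ L ∧ ∀ T : ℝ, 0 < T → ∃ ε : ℂ, ‖ε‖ = 1 ∧
      (Nat.card GaussianIntˣ : ℂ) * L (1 / 2) =
        weightedSum ξ T + ε * weightedSum ξ⁻¹ (1 / (T * nrm m)) := by
  have hN := nrm_pos hm.out
  have hstrong := isStrongFEPair_thetaPair hu hξ
  have hw : (Nat.card GaussianIntˣ : ℂ) ≠ 0 := by exact_mod_cast Nat.card_pos.ne'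
  have hmel : ∀ s, HasMellin (theta ξ) s ((thetaPair hu hξ).Λ s) := hstrong.hasMellin
  have hpi : (Real.pi : ℂ) ≠ 0 := by exact_mod_cast Real.pi_ne_zero
  refine ⟨fun s => (Real.pi : ℂ) ^ s * (Complex.Gamma s)⁻¹ * (thetaPair hu hξ).Λ s /
    Nat.card GaussianIntˣ, ⟨?_, fun s hs => ?_⟩, fun T hT => ?_⟩
  · have hd1 : Differentiable ℂ fun s : ℂ => (Real.pi : ℂ) ^ s :=
      fun s => (differentiableAt_id).const_cpow (Or.inl hpi)
    exact ((hd1.mul Complex.differentiable_one_div_Gamma).mul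
      hstrong.differentiable_Λ).div_const _
  · have hΓ : Complex.Gamma s ≠ 0 := Complex.Gamma_ne_zero_of_re_pos (by linarith)
    have h2 : HasSum (fun a => (Real.pi : ℂ) ^ (-s) * Complex.Gamma s * ext0 ξ a /
        (nrm a : ℂ) ^ s) (mellin (theta ξ) s) := by
      refine hasSum_mellin_pi_mul (fun a => ?_) (by linarith) (fun t ht => hasSum_theta ξ ht) ?_
      · rcases eq_or_ne a 0 with rfl | ha
        · exact Or.inl (ext0_zero hu ξ)
        · exact Or.inr (nrm_pos ha)
      · refine Summable.of_nonneg_of_le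
          (fun a => div_nonneg (norm_nonneg _) (Real.rpow_nonneg (nrm_nonneg a) _)) (fun a => ?_)
          (summable_nrm_rpow hs)
        rw [Real.rpow_neg (nrm_nonneg a), ← one_div]
        have := Real.rpow_nonneg (nrm_nonneg a) s.re
        gcongr
        exact norm_ext0_le ξ a
    rw [(hmel s).2] at h2
    have h3 := h2.mul_left ((Real.pi : ℂ) ^ s * (Complex.Gamma s)⁻¹)
    have h4 : HasSum (fun a => ext0 ξ a * (nrm a : ℂ) ^ (-s))
        ((Real.pi : ℂ) ^ s * (Complex.Gamma s)⁻¹ * (thetaPair hu hξ).Λ s) := by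
      refine h3.congr_fun fun a => ?_
      have h5 : (Real.pi : ℂ) ^ s ≠ 0 := by simp [Complex.cpow_eq_zero_iff, hpi]
      rw [Complex.cpow_neg, Complex.cpow_neg]
      field_simp
    have hsupp : Function.support (fun a => ext0 ξ a * (nrm a : ℂ) ^ (-s)) ⊆ {a | a ≠ 0} := by
      intro a ha h0
      exact ha (by simp only [show a = 0 from h0, ext0_zero hu, zero_mul])
    have h6 := idealUnitEquiv.hasSum_iff.mpr ((hasSum_subtype_iff_of_support_subset hsupp).mpr h4)
    have h7 := (h6.prod_fiberwise (g := fun A => (Nat.card GaussianIntˣ : ℂ) *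
      (onIdeal ξ A.1 * (Nat.card (GaussianInt ⧸ A.1) : ℂ) ^ (-s))) fun A => ?_).div_const
        (Nat.card GaussianIntˣ : ℂ)
    · refine h7.congr_fun fun A => ?_
      field_simp
    · have h8 : ∀ u : GaussianIntˣ, (((fun a => ext0 ξ a * (nrm a : ℂ) ^ (-s)) ∘ Subtype.val) ∘
          idealUnitEquiv) (A, u) = onIdeal ξ A.1 * (Nat.card (GaussianInt ⧸ A.1) : ℂ) ^ (-s) := by
        intro u
        have h9 : ((idealUnitEquiv (A, u) : {a : GaussianInt // a ≠ 0}) : GaussianInt) =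
            Submodule.IsPrincipal.generator A.1 * u := rfl
        have h10 : (Nat.card (GaussianInt ⧸ A.1) : ℂ) =
            ((nrm (Submodule.IsPrincipal.generator A.1) : ℝ) : ℂ) := by
          rw [← card_quotient_eq_nrm]; simp
        simp only [Function.comp_apply]
        rw [h9, ext0_mul_unit h1, nrm_mul, nrm_unit, mul_one, onIdeal, h10]
      have h11 := hasSum_fintype (fun _ : GaussianIntˣ =>
        onIdeal ξ A.1 * (Nat.card (GaussianInt ⧸ A.1) : ℂ) ^ (-s))
      rw [Finset.sum_const, Finset.card_univ, nsmul_eq_mul, ← Nat.card_eq_fintype_card] at h11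
      exact h11.congr_fun h8
  · refine ⟨gauss ξ 1 / (nrm m ^ (1 / 2 : ℝ) : ℝ), ?_, ?_⟩
    · rw [norm_div, Complex.norm_real, Real.norm_of_nonneg (by positivity), ← Real.sqrt_eq_rpow,
        ← norm_gauss_sq hξ, Real.sqrt_sq (norm_nonneg _),
        div_self (norm_ne_zero_iff.mpr (gauss_ne_zero hξ))]
    · have hint : IntegrableOn (fun t : ℝ => ((t ^ (-(1 / 2) : ℝ) : ℝ) : ℂ) * theta ξ t)
          (Set.Ioi 0) := by
        refine IntegrableOn.congr_fun (hmel (1 / 2)).1 (fun t ht => ?_) measurableSet_Ioi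
        rw [cpow_half_sub_one ht, smul_eq_mul]
      have h2 : (thetaPair hu hξ).Λ (1 / 2) =
          ∫ t in Set.Ioi 0, ((t ^ (-(1 / 2) : ℝ) : ℝ) : ℂ) * theta ξ t := by
        rw [← (hmel (1 / 2)).2, mellin]
        refine setIntegral_congr_fun measurableSet_Ioi fun t ht => ?_
        rw [cpow_half_sub_one ht, smul_eq_mul]
      rw [← Set.Ioc_union_Ioi_eq_Ioi hT.le, setIntegral_union Set.Ioc_disjoint_Ioi_same
        measurableSet_Ioi (hint.mono_set Set.Ioc_subset_Ioi_self)
        (hint.mono_set (Set.Ioi_subset_Ioi hT.le)), integral_theta_inv hu hξ hT,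
        integral_theta hu ξ hT] at h2
      beta_reduce
      rw [Complex.Gamma_one_half_eq, h2]
      have h5 : (Real.pi : ℂ) ^ (1 / 2 : ℂ) ≠ 0 := by simp [Complex.cpow_eq_zero_iff, hpi]
      field_simp
      ring

end Theta

/-! ### Counting primitive odd characters -/

open Classical in
/-- The primitive odd characters modulo `q`. -/
def primOdd (q : GaussianInt) [NeZero q] : Finset (ModChar q) :=
  univ.filter fun χ => IsPrimitive χ ∧ IsOdd χ

theorem mem_primOdd {q : GaussianInt} [NeZero q] {χ : ModChar q} :
    χ ∈ primOdd q ↔ IsPrimitive χ ∧ IsOdd χ := by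
  simp [primOdd]

theorem card_primOdd (q : GaussianInt) [NeZero q] : #(primOdd q) = psiStar q := by
  rw [psiStar, ← Set.ncard_coe_finset]
  congr 1
  ext χ
  simp [mem_primOdd]

theorem pairwise_isCoprime_cls (q : GaussianInt) :
    (primesOf q : Set GaussianInt).Pairwise fun p p' => IsCoprime (cls q p) (cls q p') :=
  fun _ hp _ hp' hne => (primesOf_pairwise q hp hp' hne).map (cls q)

theorem sum_primOdd (q : GaussianInt) [hq : NeZero q] (n : (Residue q)ˣ) :
    ∑ χ ∈ primOdd q, (χ n : ℂ) =
    ∑ S ∈ (primesOf q).powerset, (-1) ^ #S * ((Nat.card (Residue q)ˣ : ℂ) /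
        Nat.card (congrSubgroup (cls q (∏ p ∈ S, p)))) *
      (((congrSubgroup (cls q (∏ p ∈ S, p)) : Set (Residue q)ˣ).indicator 1 n -
        (congrSubgroup (cls q (∏ p ∈ S, p)) : Set (Residue q)ˣ).indicator 1 (-n)) / 2) := by
  simp only [map_prod]
  refine sum_odd_nontrivial (cls q) (primesOf q) (pairwise_isCoprime_cls q) (primOdd q)
    (fun χ => ?_) n
  rw [mem_primOdd]
  exact and_congr (isPrimitive_iff hq.out χ) Iff.rfl

/-- The cofactor `q / ∏ p` of a set of primes dividing `q`. -/
def cofactor (q : GaussianInt) (S : Finset GaussianInt) : GaussianInt := q / ∏ p ∈ S, p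

theorem prod_mul_cofactor {q : GaussianInt} {S : Finset GaussianInt} (hS : S ⊆ primesOf q) :
    (∏ p ∈ S, p) * cofactor q S = q := by
  exact EuclideanDomain.mul_div_cancel' (prod_ne_zero_of_subset hS) (prod_dvd_of_subset hS)

theorem unitCls_mem_iff_cofactor {q a : GaussianInt} {S : Finset GaussianInt}
    (hS : S ⊆ primesOf q) (ha : IsCoprime a q) :
    unitCls ha ∈ congrSubgroup (cls q (∏ p ∈ S, p)) ↔ cofactor q S ∣ a - 1 := by
  rw [unitCls_mem_congrSubgroup]
  conv_lhs => rw [← prod_mul_cofactor hS]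
  rw [mul_dvd_mul_iff_left (prod_ne_zero_of_subset hS)]

/-- The average of `χ(n)` is supported on the classes that are `±1` modulo some `q / ∏ p`. -/
theorem norm_sum_primOdd_le (q : GaussianInt) [hq : NeZero q] (n : (Residue q)ˣ) :
    ‖∑ χ ∈ primOdd q, (χ n : ℂ)‖ ≤ ∑ S ∈ (primesOf q).powerset, nrm (cofactor q S) *
      ((congrSubgroup (cls q (∏ p ∈ S, p)) : Set (Residue q)ˣ).indicator 1 n +
        (congrSubgroup (cls q (∏ p ∈ S, p)) : Set (Residue q)ˣ).indicator 1 (-n)) := by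
  classical
  rw [sum_primOdd]
  refine (norm_sum_le _ _).trans (Finset.sum_le_sum fun S hS => ?_)
  have h1 := card_div_card_congrSubgroup_le (prod_mul_cofactor (mem_powerset.mp hS)).symm
  have h2 : ‖((Nat.card (Residue q)ˣ : ℂ) / Nat.card (congrSubgroup (cls q (∏ p ∈ S, p))))‖ =
      (Nat.card (Residue q)ˣ : ℝ) / Nat.card (congrSubgroup (cls q (∏ p ∈ S, p))) := by
    rw [norm_div, Complex.norm_natCast, Complex.norm_natCast]
  rw [norm_mul, norm_mul, norm_pow, norm_neg, norm_one, one_pow, one_mul, h2]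
  refine mul_le_mul h1 ?_ (norm_nonneg _) (nrm_nonneg _)
  simp only [Set.indicator_apply]
  split_ifs <;> norm_num

/-- The proportion `∏ (1 - 1 / |K_p|)` of characters modulo `q` that are nontrivial on the kernel
`K_p` of the reduction modulo `q / p` for every prime `p ∣ q`. -/
def primDensity (q : GaussianInt) : ℝ :=
  ∏ p ∈ primesOf q, (1 - 1 / (Nat.card (congrSubgroup (cls q p)) : ℝ))

theorem isCoprime_two_of_dvd {q p : GaussianInt} (hq : IsCoprime q 2) (h : p ∣ q) :
    IsCoprime p 2 := hq.of_isCoprime_of_dvd_left h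

theorem three_le_nrm {q p : GaussianInt} (hq : IsCoprime q 2) (hp : Prime p) (h : p ∣ q) :
    3 ≤ nrm p := by
  have h1 := isCoprime_two_of_dvd hq h
  have hodd : ¬ (2 : ℤ) ∣ p.norm := by
    rintro ⟨k, hk⟩
    rw [Zsqrtd.norm_def] at hk
    have h2 : (2 : ℤ) ∣ p.re + p.im := by
      have : Even (p.re * p.re + p.im * p.im) := ⟨k, by linarith⟩
      rw [Int.even_add, Int.even_mul, Int.even_mul, or_self, or_self] at this
      exact (Int.even_add.mpr this).two_dvd
    obtain ⟨j, hj⟩ := h2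
    have h3 : (⟨1, 1⟩ : GaussianInt) ∣ p :=
      ⟨⟨j, j - p.re⟩, Zsqrtd.ext (by simp) (by simp; linarith)⟩
    have h4 : (⟨1, 1⟩ : GaussianInt) ∣ 2 := ⟨⟨1, -1⟩, by decide⟩
    have h5 := h1.isUnit_of_dvd' h3 h4
    rw [← Zsqrtd.norm_eq_one_iff] at h5
    revert h5; decide
  have hne1 : p.norm ≠ 1 := fun h2 => hp.not_isUnit
    ((Zsqrtd.norm_eq_one_iff' (by norm_num) _).mp h2)
  have hpos := GaussianInt.norm_pos.mpr hp.ne_zero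
  rw [nrm]
  exact_mod_cast (by omega : (3 : ℤ) ≤ p.norm)

/-- Without the condition `χ(-1) = -1` there are exactly `φ(q) * primDensity q` primitive characters.
The oddness condition halves this number up to `1/2`: as `q` is odd, `-1 ≡ 1` modulo `q / ∏ p`
only for `∏ p = q` up to units. -/
theorem two_mul_psiStar_ge {q : GaussianInt} [hq : NeZero q] (h2 : IsCoprime q 2) :
    (Nat.card (Residue q)ˣ : ℝ) * primDensity q - 1 ≤ 2 * psiStar q := by
  classical
  have h := sum_primOdd q 1
  simp only [map_one, Circle.coe_one, Finset.sum_const, nsmul_eq_mul, mul_one, card_primOdd,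
    Set.indicator_apply, SetLike.mem_coe, one_mem, if_true, Pi.one_apply] at h
  set φ := Nat.card (Residue q)ˣ
  let K : Finset GaussianInt → Subgroup (Residue q)ˣ := fun S =>
    congrSubgroup (cls q (∏ p ∈ S, p))
  have hreal : (psiStar q : ℝ) = ∑ S ∈ (primesOf q).powerset, (-1) ^ #S * ((φ : ℝ) /
      Nat.card (K S)) * ((1 - (if -1 ∈ K S then 1 else 0)) / 2) := by
    apply Complex.ofReal_injective
    push_cast
    rw [h]
    refine Finset.sum_congr rfl fun S _ => ?_
    simp only [K]
    split_ifs <;> simp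
  have hprod : ∑ S ∈ (primesOf q).powerset, (-1) ^ #S * ((φ : ℝ) / Nat.card (K S)) =
      φ * primDensity q := by
    simp only [primDensity, sub_eq_add_neg]
    rw [Finset.prod_one_add, Finset.mul_sum]
    refine Finset.sum_congr rfl fun S hS => ?_
    have hcard : Nat.card (K S) = ∏ p ∈ S, Nat.card (congrSubgroup (cls q p)) := by
      simp only [K, map_prod]
      exact card_congrSubgroup_prod ((pairwise_isCoprime_cls q).mono
        (by simpa using mem_powerset.mp hS))
    rw [Finset.prod_neg, hcard]
    simp only [one_div, Finset.prod_inv_distrib]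
    push_cast
    ring
  have herr : ∑ S ∈ (primesOf q).powerset, (-1) ^ #S * ((φ : ℝ) / Nat.card (K S)) *
      (if -1 ∈ K S then 1 else 0) ≤ 1 := by
    have hdvd : ∀ S ∈ (primesOf q).powerset, -1 ∈ K S → q ∣ ∏ p ∈ S, p := by
      intro S _ hmem
      simp only [K] at hmem
      rw [mem_congrSubgroup, Units.val_neg, Units.val_one, ← map_one (cls q), ← map_neg,
        ← map_sub, ← map_mul, cls_eq_zero, show (-1 - 1 : GaussianInt) = -2 by ring, mul_neg,
        dvd_neg] at hmem
      exact h2.dvd_of_dvd_mul_right hmem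
    rw [Finset.sum_eq_single (primesOf q)]
    · by_cases hmem : -1 ∈ K (primesOf q)
      · have htop : K (primesOf q) = ⊤ := by
          refine top_unique fun x _ => ?_
          simp only [K]
          rw [mem_congrSubgroup, cls_eq_zero.mpr (hdvd _ (by simp) hmem), zero_mul]
        have hφ : (φ : ℝ) ≠ 0 := by exact_mod_cast Nat.card_pos.ne'
        rw [if_pos hmem, htop, Subgroup.card_top, div_self hφ]
        rcases neg_one_pow_eq_or ℝ #(primesOf q) with h | h <;> rw [h] <;> norm_num
      · rw [if_neg hmem]; norm_num
    · intro S hS hne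
      rw [if_neg, mul_zero]
      intro hmem
      have hSs := mem_powerset.mp hS
      refine hne (Finset.Subset.antisymm hSs fun p hp => ?_)
      exact mem_of_dvd_prod hSs hp ((dvd_of_mem_primesOf hp).trans (hdvd S hS hmem))
    · simp
  have hsum : 2 * (psiStar q : ℝ) = φ * primDensity q -
      ∑ S ∈ (primesOf q).powerset, (-1) ^ #S * ((φ : ℝ) / Nat.card (K S)) *
      (if -1 ∈ K S then 1 else 0) := by
    rw [hreal, ← hprod, Finset.mul_sum, ← Finset.sum_sub_distrib]
    refine Finset.sum_congr rfl fun S _ => ?_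
    ring
  linarith

/-! ### Multiplicative estimates -/

theorem finite_nrm_le (X : ℝ) : {a : GaussianInt | nrm a ≤ X}.Finite := by
  have h : Set.Finite (Set.Icc (-⌈X⌉) ⌈X⌉ ×ˢ Set.Icc (-⌈X⌉) ⌈X⌉ : Set (ℤ × ℤ)) :=
    (Set.finite_Icc _ _).prod (Set.finite_Icc _ _)
  refine Set.Finite.of_injOn (f := toPair) (fun a ha => ?_) toPair.injective.injOn h
  have h1 : a.norm ≤ ⌈X⌉ := by
    have := (show (a.norm : ℝ) ≤ X from ha).trans (Int.le_ceil X)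
    exact_mod_cast this
  rw [Zsqrtd.norm_def] at h1
  simp only [toPair, Equiv.coe_fn_mk, Set.mem_prod, Set.mem_Icc]
  refine ⟨⟨?_, ?_⟩, ?_, ?_⟩ <;> nlinarith [sq_nonneg a.re, sq_nonneg a.im]

theorem nrm_le_of_dvd {a b : GaussianInt} (hb : b ≠ 0) (h : a ∣ b) : nrm a ≤ nrm b := by
  obtain ⟨c, rfl⟩ := h
  rw [nrm_mul]
  exact le_mul_of_one_le_right (nrm_nonneg a) (one_le_nrm (right_ne_zero_of_mul hb))

/-- The number `ω(q)` of prime factors is small: `B ^ ω(q) = O(N(q) ^ δ)` for all `B` and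
all `δ > 0`. -/
theorem exists_pow_card_primesOf_le {B δ : ℝ} (hB : 1 ≤ B) (hδ : 0 < δ) :
    ∃ C : ℝ, 0 < C ∧ ∀ q : GaussianInt, q ≠ 0 → B ^ #(primesOf q) ≤ C * nrm q ^ δ := by
  classical
  let F := (finite_nrm_le (B ^ δ⁻¹)).toFinset
  refine ⟨B ^ #F, by positivity, fun q hq => ?_⟩
  have h1 : ∀ p ∈ primesOf q, B ≤ (if p ∈ F then B else 1) * nrm p ^ δ := by
    intro p hp
    have hp1 := one_le_nrm (prime_of_mem_primesOf hp).ne_zero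
    by_cases h : p ∈ F
    · rw [if_pos h]
      exact le_mul_of_one_le_right (by linarith) (Real.one_le_rpow hp1 hδ.le)
    · rw [if_neg h, one_mul]
      have h2 : B ^ δ⁻¹ ≤ nrm p := by
        simp only [F, Set.Finite.mem_toFinset] at h
        exact (not_le.mp h).le
      calc B = (B ^ δ⁻¹) ^ δ := by
            rw [← Real.rpow_mul (by linarith), inv_mul_cancel₀ hδ.ne', Real.rpow_one]
        _ ≤ _ := Real.rpow_le_rpow (by positivity) h2 hδ.le
  calc B ^ #(primesOf q) = ∏ p ∈ primesOf q, B := by rw [Finset.prod_const]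
    _ ≤ ∏ p ∈ primesOf q, (if p ∈ F then B else 1) * nrm p ^ δ :=
        Finset.prod_le_prod (fun _ _ => by linarith) h1
    _ = (∏ p ∈ primesOf q, if p ∈ F then B else 1) * (∏ p ∈ primesOf q, nrm p) ^ δ := by
        rw [Finset.prod_mul_distrib, Real.finsetProd_rpow _ _ fun p _ => nrm_nonneg p]
    _ ≤ _ := by
        refine mul_le_mul ?_ ?_ (by
          exact Real.rpow_nonneg (Finset.prod_nonneg fun p _ => nrm_nonneg p) _) (by positivity)
        · rw [Finset.prod_ite, Finset.prod_const, Finset.prod_const_one, mul_one]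
          refine pow_le_pow_right₀ hB (Finset.card_le_card fun p hp => ?_)
          exact (Finset.mem_filter.mp hp).2
        · refine Real.rpow_le_rpow (Finset.prod_nonneg fun p _ => nrm_nonneg p) ?_ hδ.le
          rw [← nrm_prod]
          exact nrm_le_of_dvd hq (prod_dvd_of_subset subset_rfl)

/-- The product `∏ (1 + 1 / N(p))` over the primes `p ∣ q`. -/
def primeProd (q : GaussianInt) : ℝ := ∏ p ∈ primesOf q, (1 + (nrm p)⁻¹)

theorem primeProd_pos (q : GaussianInt) : 0 < primeProd q :=
  Finset.prod_pos fun p _ => by have := nrm_nonneg p; positivity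

theorem primeProd_le (q : GaussianInt) : primeProd q ≤ 2 ^ #(primesOf q) := by
  rw [primeProd, ← Finset.prod_const]
  refine Finset.prod_le_prod (fun p _ => by have := nrm_nonneg p; positivity) fun p hp => ?_
  have := inv_le_one_of_one_le₀ (one_le_nrm (prime_of_mem_primesOf hp).ne_zero)
  linarith

theorem primDensity_factor_ge {q p : GaussianInt} [NeZero q] (h2 : IsCoprime q 2)
    (hp : p ∈ primesOf q) :
    1 - 1 / (nrm p - 1) ≤ 1 - 1 / (Nat.card (congrSubgroup (cls q p)) : ℝ) := by
  have h3 := three_le_nrm h2 (prime_of_mem_primesOf hp) (dvd_of_mem_primesOf hp)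
  have h := nrm_sub_one_le_card_congrSubgroup (prime_of_mem_primesOf hp) (dvd_of_mem_primesOf hp)
  have := one_div_le_one_div_of_le (by linarith : 0 < nrm p - 1) h
  linarith

theorem half_pow_le_primDensity {q : GaussianInt} [NeZero q] (h2 : IsCoprime q 2) :
    (1 / 2) ^ #(primesOf q) ≤ primDensity q := by
  rw [primDensity, ← Finset.prod_const]
  refine Finset.prod_le_prod (fun _ _ => by norm_num) fun p hp => ?_
  have h3 := three_le_nrm h2 (prime_of_mem_primesOf hp) (dvd_of_mem_primesOf hp)
  have := one_div_le_one_div_of_le two_pos (by linarith : 2 ≤ nrm p - 1)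
  linarith [primDensity_factor_ge h2 hp]

theorem exp_neg_two_mul_le {y : ℝ} (h0 : 0 ≤ y) (h1 : y ≤ 1 / 2) : Real.exp (-(2 * y)) ≤ 1 - y := by
  rw [Real.exp_neg, inv_le_comm₀ (Real.exp_pos _) (by linarith)]
  have h2 : (1 - y)⁻¹ ≤ 2 * y + 1 := by
    rw [inv_le_iff_one_le_mul₀ (by linarith)]
    nlinarith
  exact h2.trans (Real.add_one_le_exp _)

/-- The products `∏ (1 - 1 / |K_p|)` and `∏ (1 + 1 / N(p))` are inverse to each other up to a
constant, because `(1 - 1 / (x - 1)) (1 + 1 / x) = 1 - 2 / (x (x - 1))`. -/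
theorem exists_le_primDensity_mul_primeProd : ∃ c : ℝ, 0 < c ∧ ∀ (q : GaussianInt) [NeZero q],
    IsCoprime q 2 → c ≤ primDensity q * primeProd q := by
  refine ⟨Real.exp (-(8 * ∑' a : GaussianInt, nrm a ^ (-2 : ℝ))), Real.exp_pos _,
    fun q _ h2 => ?_⟩
  have hsum : ∑ p ∈ primesOf q, nrm p ^ (-2 : ℝ) ≤ ∑' a : GaussianInt, nrm a ^ (-2 : ℝ) :=
    (summable_nrm_rpow one_lt_two).sum_le_tsum _ fun a _ => Real.rpow_nonneg (nrm_nonneg a) _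
  calc _ ≤ Real.exp (-(8 * ∑ p ∈ primesOf q, nrm p ^ (-2 : ℝ))) :=
        Real.exp_le_exp.mpr (by linarith)
    _ = ∏ p ∈ primesOf q, Real.exp (-(8 * nrm p ^ (-2 : ℝ))) := by
        rw [← Real.exp_sum, Finset.sum_neg_distrib, Finset.mul_sum]
    _ ≤ ∏ p ∈ primesOf q,
        ((1 - 1 / (Nat.card (congrSubgroup (cls q p)) : ℝ)) * (1 + (nrm p)⁻¹)) := by
        refine Finset.prod_le_prod (fun _ _ => (Real.exp_pos _).le) fun p hp => ?_
        have h3 := three_le_nrm h2 (prime_of_mem_primesOf hp) (dvd_of_mem_primesOf hp)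
        have h4 := primDensity_factor_ge h2 hp
        set x := nrm p
        have hx1 : 0 < x - 1 := by linarith
        have hx : 0 < x := by linarith
        have h5 : (1 - 1 / (x - 1)) * (1 + x⁻¹) = 1 - 2 / (x * (x - 1)) := by
          field_simp; ring
        have h6 : 2 / (x * (x - 1)) ≤ 4 * x ^ (-2 : ℝ) := by
          rw [Real.rpow_neg hx.le, show (2 : ℝ) = ((2 : ℕ) : ℝ) by norm_num, Real.rpow_natCast,
            ← div_eq_mul_inv, div_le_div_iff₀ (by positivity) (by positivity)]
          push_cast
          nlinarith
        have h7 : 2 / (x * (x - 1)) ≤ 1 / 2 := by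
          rw [div_le_div_iff₀ (by positivity) (by positivity)]
          nlinarith
        calc _ ≤ Real.exp (-(2 * (2 / (x * (x - 1))))) := Real.exp_le_exp.mpr (by linarith)
          _ ≤ 1 - 2 / (x * (x - 1)) := exp_neg_two_mul_le (by positivity) h7
          _ = (1 - 1 / (x - 1)) * (1 + x⁻¹) := h5.symm
          _ ≤ _ := by gcongr
    _ = _ := by rw [primDensity, primeProd, Finset.prod_mul_distrib]

/-- Mertens-type bound: the condition `(a, q) = 1` saves the factor `∏ (1 + 1 / N(p))` in the sum of
`1 / N(a)`, because the products of `a` with squarefree divisors of `q` are distinct. -/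
theorem sum_inv_nrm_coprime_le {q : GaussianInt} (hq : q ≠ 0) {X : ℝ} (hX : 1 ≤ X)
    (F : Finset GaussianInt) (hF : ∀ a ∈ F, a ≠ 0 ∧ nrm a ≤ X ∧ IsCoprime a q) :
    (∑ a ∈ F, (nrm a)⁻¹) * primeProd q ≤ 8 * (1 + Real.log (X * nrm q)) := by
  classical
  have hinj : Set.InjOn (fun z : GaussianInt × Finset GaussianInt => z.1 * ∏ p ∈ z.2, p)
      (F ×ˢ (primesOf q).powerset : Finset _) := by
    rintro ⟨a, S⟩ h ⟨b, T⟩ h' he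
    simp only [Finset.coe_product, Set.mem_prod, Finset.mem_coe, mem_powerset] at h h' he
    have key : ∀ (a b : GaussianInt) (S T : Finset GaussianInt), IsCoprime b q →
        S ⊆ primesOf q → T ⊆ primesOf q →
        a * ∏ p ∈ S, p = b * ∏ p ∈ T, p → S ⊆ T := by
      intro a b S T hb hS hT he p hp
      have hpp := prime_of_mem_primesOf (hS hp)
      have h1 : p ∣ b * ∏ p ∈ T, p := he ▸ (dvd_prod_of_mem _ hp).mul_left a
      rcases hpp.dvd_or_dvd h1 with h2 | h2
      · exact absurd (hb.isUnit_of_dvd' h2 (dvd_of_mem_primesOf (hS hp))) hpp.not_isUnit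
      · exact mem_of_dvd_prod hT (hS hp) h2
    have hST : S = T := Finset.Subset.antisymm
      (key a b S T (hF b h'.1).2.2 h.2 h'.2 he) (key b a T S (hF a h.1).2.2 h'.2 h.2 he.symm)
    subst hST
    rw [mul_left_inj' (prod_ne_zero_of_subset h.2)] at he
    rw [he]
  have h1 : (∑ a ∈ F, (nrm a)⁻¹) * primeProd q =
      ∑ n ∈ (F ×ˢ (primesOf q).powerset).image
        (fun z : GaussianInt × Finset GaussianInt => z.1 * ∏ p ∈ z.2, p), (nrm n)⁻¹ := by
    rw [Finset.sum_image hinj, primeProd, Finset.prod_one_add, Finset.sum_mul_sum,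
      Finset.sum_product]
    refine Finset.sum_congr rfl fun a _ => Finset.sum_congr rfl fun S _ => ?_
    rw [nrm_mul, mul_inv, nrm_prod, Finset.prod_inv_distrib]
  rw [h1]
  refine sum_inv_nrm_le (by nlinarith [one_le_nrm hq]) _ fun n hn => ?_
  obtain ⟨⟨a, S⟩, hz, rfl⟩ := Finset.mem_image.mp hn
  obtain ⟨ha, hS⟩ := Finset.mem_product.mp hz
  obtain ⟨ha0, haX, -⟩ := hF a ha
  have hS := mem_powerset.mp hS
  refine ⟨mul_ne_zero ha0 (prod_ne_zero_of_subset hS), ?_⟩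
  rw [nrm_mul]
  exact mul_le_mul haX (nrm_le_of_dvd hq (prod_dvd_of_subset hS)) (nrm_nonneg _) (by linarith)

/-! ### The second moment -/

theorem not_isUnit_lam_mul (q : GaussianInt) : ¬ IsUnit (lam * q) := by
  intro h
  obtain ⟨u, hu⟩ := isUnit_of_mul_isUnit_left h
  have := nrm_unit u
  rw [hu, nrm_lam] at this
  norm_num at this

theorem nrm_lam_mul (q : GaussianInt) : nrm (lam * q) = 8 * nrm q := by rw [nrm_mul, nrm_lam]

theorem sum_ext0_mul_conj {m : GaussianInt} [NeZero m] {a b : GaussianInt} (ha : IsCoprime a m)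
    (hb : IsCoprime b m) [Decidable (m ∣ a - b)] :
    ∑ ξ : ModChar m, ext0 ξ a * (starRingEnd ℂ) (ext0 ξ b) =
      if m ∣ a - b then (Nat.card (Residue m)ˣ : ℂ) else 0 := by
  classical
  have hiff : unitCls ha * (unitCls hb)⁻¹ = 1 ↔ m ∣ a - b := by
    rw [mul_inv_eq_one, unitCls_eq_iff]
  rw [← if_congr hiff rfl rfl, ← sum_char_apply]
  refine Finset.sum_congr rfl fun ξ _ => ?_
  rw [ext0_of_coprime ξ ha, ext0_of_coprime ξ hb, map_mul, map_inv, Circle.coe_mul,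
    Circle.coe_inv_eq_conj]

/-- Orthogonality for sums over integers that are distinct modulo `m`. -/
theorem sum_norm_sq_eq {m : GaussianInt} [NeZero m] (F : Finset GaussianInt)
    (hc : ∀ a ∈ F, IsCoprime a m) (hinj : ∀ a ∈ F, ∀ b ∈ F, m ∣ a - b → a = b)
    (v : GaussianInt → ℝ) :
    ∑ ξ : ModChar m, ‖∑ a ∈ F, ext0 ξ a * (v a : ℂ)‖ ^ 2 =
      Nat.card (Residue m)ˣ * ∑ a ∈ F, v a ^ 2 := by
  classical
  apply Complex.ofReal_injective
  push_cast
  have h1 : ∀ ξ : ModChar m, ((‖∑ a ∈ F, ext0 ξ a * (v a : ℂ)‖ : ℝ) : ℂ) ^ 2 =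
      ∑ a ∈ F, ∑ b ∈ F, (v a * v b : ℂ) * (ext0 ξ a * (starRingEnd ℂ) (ext0 ξ b)) := by
    intro ξ
    rw [← Complex.ofReal_pow, ← Complex.normSq_eq_norm_sq, ← Complex.mul_conj, map_sum,
      Finset.sum_mul_sum]
    refine Finset.sum_congr rfl fun a _ => Finset.sum_congr rfl fun b _ => ?_
    rw [map_mul, Complex.conj_ofReal]; ring
  simp only [h1]
  rw [Finset.sum_comm, Finset.mul_sum]
  refine Finset.sum_congr rfl fun a ha => ?_
  rw [Finset.sum_comm]
  have h2 : ∀ b ∈ F, ∑ ξ : ModChar m,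
      (v a * v b : ℂ) * (ext0 ξ a * (starRingEnd ℂ) (ext0 ξ b)) =
      if a = b then (Nat.card (Residue m)ˣ : ℂ) * (v a : ℂ) ^ 2 else 0 := by
    intro b hb
    rw [← Finset.mul_sum, sum_ext0_mul_conj (hc a ha) (hc b hb)]
    by_cases hab : a = b
    · subst hab
      rw [if_pos rfl, if_pos (by simp)]; ring
    · rw [if_neg hab, if_neg (fun h => hab (hinj a ha b hb h)), mul_zero]
  rw [Finset.sum_congr rfl h2, Finset.sum_ite_eq, if_pos ha]

theorem nrm_sub_le (a b : GaussianInt) : nrm (a - b) ≤ 2 * nrm a + 2 * nrm b := by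
  rw [nrm_eq, nrm_eq, nrm_eq, Zsqrtd.re_sub, Zsqrtd.im_sub]
  push_cast
  nlinarith [sq_nonneg ((a.re : ℝ) + b.re), sq_nonneg ((a.im : ℝ) + b.im)]

theorem weight_nrm_sq_le {a : GaussianInt} (ha : a ≠ 0) {T : ℝ} (hT : 0 ≤ T) :
    weight (nrm a) T ^ 2 ≤ (nrm a)⁻¹ := by
  have hn := nrm_pos ha
  calc weight (nrm a) T ^ 2 ≤ (nrm a ^ (-(1 / 2) : ℝ)) ^ 2 := by
        have := weight_nonneg (nrm a) hT
        gcongr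
        exact weight_le hn hT
    _ = (nrm a)⁻¹ := by
        rw [← Real.rpow_natCast, ← Real.rpow_mul hn.le, ← Real.rpow_neg_one]
        norm_num

open Classical in
/-- The integers coprime to `m` of norm less than `N(m) / 4`; they are incongruent modulo `m`. -/
def smallCoprime (m : GaussianInt) : Finset GaussianInt :=
  (finite_nrm_le (nrm m)).toFinset.filter fun a => nrm a < nrm m / 4 ∧ IsCoprime a m

theorem mem_smallCoprime {m a : GaussianInt} :
    a ∈ smallCoprime m ↔ nrm a < nrm m / 4 ∧ IsCoprime a m := by
  simp only [smallCoprime, Finset.mem_filter, Set.Finite.mem_toFinset, Set.mem_ofPred_eq,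
    and_iff_right_iff_imp, and_imp]
  intro h _
  linarith [nrm_nonneg m]

/-- The part of `weightedSum` over the integers of norm at least `N(m) / 4` is small. -/
theorem exists_norm_weightedSum_sub_le : ∃ C : ℝ, 0 < C ∧ ∀ (m : GaussianInt), m ≠ 0 →
    ¬ IsUnit m → ∀ ξ : ModChar m,
      ‖weightedSum ξ (nrm m ^ (-(1 / 2) : ℝ)) - ∑ a ∈ smallCoprime m, ext0 ξ a *
        (weight (nrm a) (nrm m ^ (-(1 / 2) : ℝ)) : ℂ)‖ ≤ C * nrm m ^ (-(3 / 4) : ℝ) := by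
  -- Decay of order 5 turns the tail into `N(m)^(9/4 - 3)` times a convergent sum of `N(a)⁻²`.
  obtain ⟨C, hC, h⟩ := exists_weight_nrm_le 5 (by norm_num)
  have hS := summable_nrm_rpow one_lt_two
  have hS0 : 0 ≤ ∑' a : GaussianInt, nrm a ^ (-2 : ℝ) :=
    tsum_nonneg fun a => Real.rpow_nonneg (nrm_nonneg a) _
  refine ⟨C * 4 ^ (3 : ℝ) * (∑' a : GaussianInt, nrm a ^ (-2 : ℝ) + 1), by positivity,
    fun m hm hu ξ => ?_⟩
  have hN := nrm_pos hm
  set N := nrm m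
  have hT : 0 < N ^ (-(1 / 2) : ℝ) := by positivity
  have hsum := summable_weightedSum hu ξ hT
  rw [weightedSum, ← hsum.sum_add_tsum_compl (s := smallCoprime m), add_sub_cancel_left]
  have hb : ∀ x : ((smallCoprime m : Set GaussianInt)ᶜ : Set GaussianInt),
      ‖ext0 ξ x * (weight (nrm x) (N ^ (-(1 / 2) : ℝ)) : ℂ)‖ ≤
        C * 4 ^ (3 : ℝ) * N ^ (-(3 / 4) : ℝ) * nrm (x : GaussianInt) ^ (-2 : ℝ) := by
    rintro ⟨a, ha⟩
    simp only [Set.mem_compl_iff, Finset.mem_coe, mem_smallCoprime, not_and'] at ha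
    have hr : 0 ≤ C * 4 ^ (3 : ℝ) * N ^ (-(3 / 4) : ℝ) * nrm a ^ (-2 : ℝ) :=
      mul_nonneg (by positivity) (Real.rpow_nonneg (nrm_nonneg a) _)
    by_cases hc : IsCoprime a m
    · have ha0 : a ≠ 0 := by
        rintro rfl
        exact hu (isCoprime_zero_left.mp hc)
      have hn := nrm_pos ha0
      have h4 : N / 4 ≤ nrm a := not_lt.mp (ha hc)
      rw [norm_mul, Complex.norm_real, Real.norm_of_nonneg (weight_nonneg _ hT.le)]
      refine (mul_le_of_le_one_left (weight_nonneg _ hT.le) (norm_ext0_le ξ a)).trans ?_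
      refine (h _ hT a ha0).trans ?_
      have h5 : nrm a ^ (-5 : ℝ) ≤ (N / 4) ^ (-3 : ℝ) * nrm a ^ (-2 : ℝ) := by
        rw [show (-5 : ℝ) = -3 + -2 by norm_num, Real.rpow_add hn]
        exact mul_le_mul_of_nonneg_right
          (Real.rpow_le_rpow_of_nonpos (by positivity) h4 (by norm_num)) (by positivity)
      have h6 : (N ^ (-(1 / 2) : ℝ)) ^ (1 / 2 - 5 : ℝ) * (N / 4) ^ (-3 : ℝ) =
          4 ^ (3 : ℝ) * N ^ (-(3 / 4) : ℝ) := by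
        rw [← Real.rpow_mul hN.le, Real.div_rpow hN.le (by norm_num), Real.rpow_neg (x := 4)
          (by norm_num), div_inv_eq_mul, ← mul_assoc, ← Real.rpow_add hN, mul_comm]
        norm_num
      calc _ ≤ C * (N ^ (-(1 / 2) : ℝ)) ^ (1 / 2 - 5 : ℝ) *
            ((N / 4) ^ (-3 : ℝ) * nrm a ^ (-2 : ℝ)) := by gcongr
        _ = C * ((N ^ (-(1 / 2) : ℝ)) ^ (1 / 2 - 5 : ℝ) * (N / 4) ^ (-3 : ℝ)) *
            nrm a ^ (-2 : ℝ) := by ring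
        _ = _ := by rw [h6]; ring
    · rw [ext0_of_not_coprime ξ hc, zero_mul, norm_zero]
      exact hr
  have hS' := hS.mul_left (C * 4 ^ (3 : ℝ) * N ^ (-(3 / 4) : ℝ))
  refine (tsum_of_norm_bounded (hS'.subtype _).hasSum hb).trans ?_
  refine (hS'.tsum_subtype_le _ _ fun a => ?_).trans ?_
  · exact mul_nonneg (by positivity) (Real.rpow_nonneg (nrm_nonneg a) _)
  · rw [tsum_mul_left]
    have : 0 < N ^ (-(3 / 4) : ℝ) := by positivity
    calc _ ≤ C * 4 ^ (3 : ℝ) * N ^ (-(3 / 4) : ℝ) *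
          (∑' a : GaussianInt, nrm a ^ (-2 : ℝ) + 1) := by gcongr; linarith
      _ = _ := by ring

/-- The second moment of the weighted sums over all characters modulo `(1 + i)³ q`. -/
theorem exists_second_moment_le : ∃ C : ℝ, 0 < C ∧ ∀ (q : GaussianInt) [NeZero q],
    IsCoprime q 2 → 3 ≤ nrm q →
      ∑ ξ : ModChar (lam * q), ‖weightedSum ξ (nrm (lam * q) ^ (-(1 / 2) : ℝ))‖ ^ 2 ≤
        C * (Nat.card (Residue q)ˣ * Real.log (nrm q) / primeProd q) := by
  obtain ⟨C₁, hC₁, h₁⟩ := exists_norm_weightedSum_sub_le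
  obtain ⟨C₂, hC₂, h₂⟩ := exists_pow_card_primesOf_le one_le_two one_pos
  have hw : (0 : ℝ) < Nat.card GaussianIntˣ := by exact_mod_cast Nat.card_pos
  refine ⟨Nat.card GaussianIntˣ * (2 * 48 + 2 * C₁ ^ 2 * C₂), by positivity, fun q hq0 hq hq3 => ?_⟩
  have hq1 := one_le_nrm hq0.out
  have hqpos : 0 < nrm q := by linarith
  have hm0 : lam * q ≠ 0 := mul_ne_zero lam_ne_zero hq0.out
  have hu := not_isUnit_lam_mul q
  have hNq := nrm_lam_mul q
  have hN1 := one_le_nrm hm0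
  have hE := primeProd_pos q
  have hlog : 1 ≤ Real.log (nrm q) := by
    rw [Real.le_log_iff_exp_le hqpos]
    exact (Real.exp_one_lt_d9.le.trans (by norm_num)).trans hq3
  set m := lam * q with hmdef
  set N := nrm m
  set T := N ^ (-(1 / 2) : ℝ)
  have hT : 0 ≤ T := by positivity
  set F := smallCoprime m
  have hF0 : ∀ a ∈ F, a ≠ 0 := by
    rintro a ha rfl
    exact hu (isCoprime_zero_left.mp (mem_smallCoprime.mp ha).2)
  -- Congruent integers of norm less than `N(m) / 4` are equal: only the diagonal contributes.
  have hinj : ∀ a ∈ F, ∀ b ∈ F, m ∣ a - b → a = b := by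
    intro a ha b hb hab
    by_contra hne
    have h1 := nrm_le_of_dvd (sub_ne_zero.mpr hne) hab
    linarith [nrm_sub_le a b, (mem_smallCoprime.mp ha).1, (mem_smallCoprime.mp hb).1]
  have horth := sum_norm_sq_eq F (fun a ha => (mem_smallCoprime.mp ha).2) hinj
    (fun a => weight (nrm a) T)
  have hdiag : (∑ a ∈ F, weight (nrm a) T ^ 2) ≤ 48 * Real.log (nrm q) / primeProd q := by
    have h1 : (∑ a ∈ F, weight (nrm a) T ^ 2) ≤ ∑ a ∈ F, (nrm a)⁻¹ :=
      Finset.sum_le_sum fun a ha => weight_nrm_sq_le (hF0 a ha) hT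
    have h2 := sum_inv_nrm_coprime_le hq0.out hN1 F fun a ha => ⟨hF0 a ha, by
      have := (mem_smallCoprime.mp ha).1
      linarith, (mem_smallCoprime.mp ha).2.of_mul_right_right⟩
    have h3 : Real.log (N * nrm q) ≤ 3 + 2 * Real.log (nrm q) := by
      have h8 : Real.log 8 ≤ 3 := by
        rw [show (8 : ℝ) = 2 ^ 3 by norm_num, Real.log_pow]
        have := Real.log_two_lt_d9
        push_cast; linarith
      rw [hNq, Real.log_mul (by positivity) hqpos.ne', Real.log_mul (by norm_num) hqpos.ne']
      linarith
    rw [le_div_iff₀ hE]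
    calc _ ≤ (∑ a ∈ F, (nrm a)⁻¹) * primeProd q := by gcongr
      _ ≤ 8 * (1 + Real.log (N * nrm q)) := h2
      _ ≤ 48 * Real.log (nrm q) := by linarith
  have htail : (C₁ * N ^ (-(3 / 4) : ℝ)) ^ 2 ≤ C₁ ^ 2 * C₂ * Real.log (nrm q) / primeProd q := by
    have h1 : (N ^ (-(3 / 4) : ℝ)) ^ 2 ≤ N⁻¹ := by
      rw [← Real.rpow_natCast, ← Real.rpow_mul (by linarith), ← Real.rpow_neg_one]
      exact Real.rpow_le_rpow_of_exponent_le hN1 (by norm_num)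
    have h2 : primeProd q ≤ C₂ * N := by
      have := h₂ q hq0.out
      rw [Real.rpow_one] at this
      have h3 := primeProd_le q
      nlinarith
    rw [le_div_iff₀ hE, mul_pow]
    have hN0 : N ≠ 0 := by linarith
    calc C₁ ^ 2 * (N ^ (-(3 / 4) : ℝ)) ^ 2 * primeProd q ≤ C₁ ^ 2 * N⁻¹ * (C₂ * N) := by
          gcongr
      _ = C₁ ^ 2 * C₂ * 1 := by field_simp
      _ ≤ _ := by gcongr
  have hbound : ∀ ξ : ModChar m, ‖weightedSum ξ T‖ ^ 2 ≤
      2 * ‖∑ a ∈ F, ext0 ξ a * (weight (nrm a) T : ℂ)‖ ^ 2 +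
        2 * (C₁ * N ^ (-(3 / 4) : ℝ)) ^ 2 := by
    intro ξ
    have h1 := h₁ m hm0 hu ξ
    have h2 := norm_le_norm_add_norm_sub' (weightedSum ξ T)
      (∑ a ∈ F, ext0 ξ a * (weight (nrm a) T : ℂ))
    have h3 := norm_nonneg (weightedSum ξ T)
    have h4 := h2.trans (add_le_add_right h1 _)
    calc _ ≤ (‖∑ a ∈ F, ext0 ξ a * (weight (nrm a) T : ℂ)‖ + C₁ * N ^ (-(3 / 4) : ℝ)) ^ 2 := by
          gcongr
      _ ≤ _ := by
          nlinarith [sq_nonneg (‖∑ a ∈ F, ext0 ξ a * (weight (nrm a) T : ℂ)‖ -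
            C₁ * N ^ (-(3 / 4) : ℝ))]
  have hcard : (Fintype.card (ModChar m) : ℝ) = Nat.card (Residue m)ˣ := by
    have h1 := sum_norm_sq_eq (m := m) {1} (by simp [isCoprime_one_left]) (by simp) (fun _ => 1)
    have h2 : ∀ ξ : ModChar m, ext0 ξ 1 = 1 := fun ξ => by
      rw [ext0_of_coprime ξ isCoprime_one_left, unitCls_one, map_one, Circle.coe_one]
    simpa [h2] using h1
  have hφ := card_units_lam_mul_le hq
  calc _ ≤ ∑ ξ : ModChar m, (2 * ‖∑ a ∈ F, ext0 ξ a * (weight (nrm a) T : ℂ)‖ ^ 2 +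
        2 * (C₁ * N ^ (-(3 / 4) : ℝ)) ^ 2) := Finset.sum_le_sum fun ξ _ => hbound ξ
    _ = Nat.card (Residue m)ˣ * (2 * (∑ a ∈ F, weight (nrm a) T ^ 2) +
        2 * (C₁ * N ^ (-(3 / 4) : ℝ)) ^ 2) := by
        rw [Finset.sum_add_distrib, ← Finset.mul_sum, horth, Finset.sum_const, Finset.card_univ,
          nsmul_eq_mul, hcard]
        ring
    _ ≤ (Nat.card GaussianIntˣ * Nat.card (Residue q)ˣ) *
        (2 * (48 * Real.log (nrm q) / primeProd q) +
          2 * (C₁ ^ 2 * C₂ * Real.log (nrm q) / primeProd q)) := by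
        refine mul_le_mul (by exact_mod_cast hφ) (by linarith) ?_ (by positivity)
        have := Finset.sum_nonneg fun a (_ : a ∈ F) => sq_nonneg (weight (nrm a) T)
        positivity
    _ = _ := by ring

/-! ### The first moment -/

theorem sum_ext0_tilde_unit (q : GaussianInt) [NeZero q] (u : GaussianIntˣ) :
    ∑ χ ∈ primOdd q, ext0 (tilde χ) u = psiStar q := by
  have h : ∀ χ ∈ primOdd q, ext0 (tilde χ) (u : GaussianInt) = 1 := fun χ _ => by
    rw [ext0_of_coprime _ (isCoprime_unit u _), ← unitMap_eq, tilde_unitMap, Circle.coe_one]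
  rw [Finset.sum_congr rfl h, Finset.sum_const, card_primOdd, nsmul_one]

/-- The average of `χ̃(a)` over the primitive odd characters is supported on those `a` that are
congruent to a unit modulo a large divisor of `q`. -/
theorem norm_sum_ext0_tilde_le {q : GaussianInt} [NeZero q] (a : GaussianInt)
    [∀ e b : GaussianInt, Decidable (e ∣ b)] :
    ‖∑ χ ∈ primOdd q, ext0 (tilde χ) a‖ ≤ ∑ S ∈ (primesOf q).powerset, nrm (cofactor q S) *
      ∑ u : GaussianIntˣ, if cofactor q S ∣ a - u then 1 else 0 := by
  classical
  have hnonneg : ∀ (S : Finset GaussianInt) (u : GaussianIntˣ),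
      (0 : ℝ) ≤ if cofactor q S ∣ a - u then 1 else 0 := fun S u => by split_ifs <;> norm_num
  by_cases ha : IsCoprime a (lam * q)
  swap
  · rw [Finset.sum_eq_zero fun χ _ => ext0_of_not_coprime _ ha, norm_zero]
    exact Finset.sum_nonneg fun S _ => mul_nonneg (nrm_nonneg _)
      (Finset.sum_nonneg fun u _ => hnonneg S u)
  obtain ⟨u, hu⟩ := unitMap_lam_bijective.2 (reduce (Dvd.intro q rfl) (unitCls ha))
  have haq : IsCoprime a q := ha.of_mul_right_right
  have hb : IsCoprime (((u⁻¹ : GaussianIntˣ) : GaussianInt) * a) q :=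
    (isCoprime_unit _ q).mul_left haq
  have hval : ∀ χ : ModChar q, ext0 (tilde χ) a = χ (unitCls hb) := fun χ => by
    rw [ext0_of_coprime _ ha, tilde_apply χ hu.symm, reduce_unitCls _ ha haq, ← map_inv,
      unitMap_eq _ (isCoprime_unit _ q), unitCls_mul]
  rw [Finset.sum_congr rfl fun χ _ => hval χ]
  refine (norm_sum_primOdd_le q _).trans (Finset.sum_le_sum fun S hS =>
    mul_le_mul_of_nonneg_left ?_ (nrm_nonneg _))
  have hS' := mem_powerset.mp hS
  have hneg : -unitCls hb = unitCls hb.neg_left := by ext; simp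
  have hdvd : ∀ v w : GaussianIntˣ, ((v⁻¹ : GaussianIntˣ) : GaussianInt) * w = 1 →
      (cofactor q S ∣ ((v⁻¹ : GaussianIntˣ) : GaussianInt) * a - 1 ↔ cofactor q S ∣ a - w) := by
    intro v w hvw
    rw [← hvw, ← mul_sub, ((v⁻¹).isUnit).dvd_mul_left]
  have h1 : unitCls hb ∈ congrSubgroup (cls q (∏ p ∈ S, p)) ↔ cofactor q S ∣ a - u := by
    rw [unitCls_mem_iff_cofactor hS', hdvd u u (by simp)]
  have h2 : -unitCls hb ∈ congrSubgroup (cls q (∏ p ∈ S, p)) ↔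
      cofactor q S ∣ a - ((-u : GaussianIntˣ) : GaussianInt) := by
    rw [hneg, unitCls_mem_iff_cofactor hS', ← hdvd (-u) (-u) (by simp)]
    simp
  have hne : u ≠ -u := by
    intro h
    have h3 := congrArg (fun v : GaussianIntˣ => (v : GaussianInt)) h
    have h4 := congrArg Zsqrtd.re h3
    have h5 := congrArg Zsqrtd.im h3
    have h6 := sq_add_sq_of_unit u
    simp only [Units.val_neg, Zsqrtd.re_neg, Zsqrtd.im_neg] at h4 h5
    have h7 : (u : GaussianInt).re = 0 := by omega
    have h8 : (u : GaussianInt).im = 0 := by omega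
    rw [h7, h8] at h6
    norm_num at h6
  calc _ = ∑ v ∈ ({u, -u} : Finset GaussianIntˣ),
        (if cofactor q S ∣ a - v then (1 : ℝ) else 0) := by
        rw [Finset.sum_pair hne]
        simp only [Set.indicator_apply, SetLike.mem_coe, h1, h2, Pi.one_apply]
    _ ≤ _ := Finset.sum_le_sum_of_subset_of_nonneg (subset_univ _) fun v _ _ => hnonneg S v

/-- The sum of `N(a)⁻ᵏ` over the class of a unit `u` modulo `e`, without `u` itself: for
`a = u + e z` with `z ≠ 0` the norm of `a` is at least `N(e) N(z) / 4`. The term `a = 0`, which can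
occur if `e` is a unit, vanishes because `0 ^ (-k) = 0`. -/
theorem sum_congr_unit_le {k : ℝ} (hk : 1 < k) {e : GaussianInt} (he : e ≠ 0) (u : GaussianIntˣ)
    [∀ a : GaussianInt, Decidable (e ∣ a - u ∧ a ≠ u)] :
    (Summable fun a : GaussianInt => if e ∣ a - u ∧ a ≠ u then nrm a ^ (-k) else 0) ∧
    ∑' a : GaussianInt, (if e ∣ a - u ∧ a ≠ u then nrm a ^ (-k) else 0) ≤
      4 ^ k * nrm e ^ (-k) * ∑' z : GaussianInt, nrm z ^ (-k) := by
  set B : GaussianInt → ℝ := fun a => if e ∣ a - u ∧ a ≠ u then nrm a ^ (-k) else 0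
  have hpow : ∀ a : GaussianInt, 0 ≤ nrm a ^ (-k) := fun a => Real.rpow_nonneg (nrm_nonneg a) _
  have hB0 : ∀ a, 0 ≤ B a := fun a => by simp only [B]; split_ifs; exacts [hpow a, le_rfl]
  have hB : Summable B := by
    refine Summable.of_nonneg_of_le hB0 (fun a => ?_) (summable_nrm_rpow hk)
    simp only [B]; split_ifs; exacts [le_rfl, hpow a]
  refine ⟨hB, ?_⟩
  let f : GaussianInt → GaussianInt := fun z => u + e * z
  have hf : Function.Injective f := fun z z' h => mul_left_cancel₀ he (add_left_cancel h)
  have hsupp : Function.support B ⊆ Set.range f := by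
    intro a ha
    have h : e ∣ a - u ∧ a ≠ u := by
      by_contra h
      exact ha (if_neg h)
    obtain ⟨z, hz⟩ := h.1
    exact ⟨z, by simp only [f]; rw [← hz]; ring⟩
  rw [← hf.tsum_eq hsupp, ← tsum_mul_left]
  refine Summable.tsum_le_tsum (fun z => ?_) (hB.comp_injective hf)
    ((summable_nrm_rpow hk).mul_left _)
  have hC : 0 ≤ 4 ^ k * nrm e ^ (-k) := mul_nonneg (by positivity) (hpow e)
  have hrhs : 0 ≤ 4 ^ k * nrm e ^ (-k) * nrm z ^ (-k) := mul_nonneg hC (hpow z)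
  by_cases h : e ∣ f z - u ∧ f z ≠ u
  swap
  · simp only [B]
    rw [if_neg h]; exact hrhs
  simp only [B]
  rw [if_pos h]
  rcases eq_or_ne (f z) 0 with h0 | h0
  · rw [h0, nrm_zero, Real.zero_rpow (by linarith)]; exact hrhs
  have hz : z ≠ 0 := by
    rintro rfl
    exact h.2 (by simp [f])
  have h1 : nrm e * nrm z ≤ 4 * nrm (f z) := by
    have h2 := nrm_sub_le (f z) u
    have h3 := one_le_nrm h0
    have h4 : f z - u = e * z := by simp only [f]; ring
    rw [h4, nrm_mul, nrm_unit] at h2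
    linarith
  have he' := nrm_pos he
  have hz' := nrm_pos hz
  have hf' := nrm_pos h0
  calc nrm (f z) ^ (-k) ≤ (nrm e * nrm z / 4) ^ (-k) :=
        Real.rpow_le_rpow_of_nonpos (by positivity) (by linarith) (by linarith)
    _ = _ := by
        rw [Real.div_rpow (by positivity) (by norm_num), Real.mul_rpow he'.le hz'.le,
          Real.rpow_neg (by norm_num : (0 : ℝ) ≤ 4), div_inv_eq_mul]
        ring

theorem cofactor_ne_zero {q : GaussianInt} (hq : q ≠ 0) {S : Finset GaussianInt}
    (hS : S ⊆ primesOf q) : cofactor q S ≠ 0 := by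
  intro h
  have := prod_mul_cofactor hS
  rw [h, mul_zero] at this
  exact hq this.symm

/-- The first moment of the weighted sums. The main term comes from the units. The decay `N(a)⁻ᵏ` of
the weights with `k = 9/8` makes the sums over the other `a` converge and leaves an error of
less than `N(q)` even for `T` of size `1 / N(q)`. -/
theorem exists_first_moment_le : ∃ C : ℝ, 0 < C ∧ ∀ (q : GaussianInt) [NeZero q], ∀ T : ℝ, 0 < T →
    ‖∑ χ ∈ primOdd q, weightedSum (tilde χ) T -
        Nat.card GaussianIntˣ * psiStar q * weight 1 T‖ ≤
      C * 2 ^ #(primesOf q) * T ^ (-(5 / 8) : ℝ) := by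
  classical
  have hk : (1 : ℝ) < 9 / 8 := by norm_num
  obtain ⟨C, hC, hCw⟩ := exists_weight_nrm_le (9 / 8) hk
  set Z := ∑' z : GaussianInt, nrm z ^ (-(9 / 8) : ℝ)
  have hZ : 0 ≤ Z := tsum_nonneg fun z => Real.rpow_nonneg (nrm_nonneg z) _
  have hw : (0 : ℝ) < Nat.card GaussianIntˣ := by exact_mod_cast Nat.card_pos
  refine ⟨Nat.card GaussianIntˣ * C * 4 ^ (9 / 8 : ℝ) * (Z + 1), by positivity, fun q hq T hT => ?_⟩
  have hu := not_isUnit_lam_mul q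
  set P : ℝ := T ^ (-(5 / 8) : ℝ)
  have hP : 0 < P := Real.rpow_pos_of_pos hT _
  let h : GaussianInt → ℂ := fun a => ∑ χ ∈ primOdd q, ext0 (tilde χ) a
  have hsum : HasSum (fun a => h a * (weight (nrm a) T : ℂ))
      (∑ χ ∈ primOdd q, weightedSum (tilde χ) T) := by
    have := hasSum_sum (s := primOdd q)
      fun χ _ => (summable_weightedSum hu (tilde χ) hT).hasSum
    simpa only [h, Finset.sum_mul, weightedSum] using this
  let U : Finset GaussianInt := univ.image fun u : GaussianIntˣ => (u : GaussianInt)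
  have hU : ∀ u : GaussianIntˣ, (u : GaussianInt) ∈ U := fun u => mem_image_of_mem _ (mem_univ u)
  let D : GaussianInt → ℂ := fun a => if a ∈ U then psiStar q * (weight 1 T : ℂ) else 0
  have hD : HasSum D (Nat.card GaussianIntˣ * psiStar q * weight 1 T) := by
    have h1 : HasSum D (∑ a ∈ U, D a) := hasSum_sum_of_ne_finset_zero fun a ha => if_neg ha
    have h2 : ∑ a ∈ U, D a = Nat.card GaussianIntˣ * psiStar q * weight 1 T := by
      rw [Finset.sum_image fun u _ v _ huv => Units.ext huv,
        Finset.sum_congr rfl fun u _ => if_pos (hU u), Finset.sum_const, Finset.card_univ,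
        ← Nat.card_eq_fintype_card, nsmul_eq_mul, mul_assoc]
    rwa [h2] at h1
  let B : Finset GaussianInt → GaussianIntˣ → GaussianInt → ℝ := fun S u a =>
    if cofactor q S ∣ a - u ∧ a ≠ u then nrm a ^ (-(9 / 8) : ℝ) else 0
  have he : ∀ S ∈ (primesOf q).powerset, cofactor q S ≠ 0 := fun S hS =>
    cofactor_ne_zero hq.out (mem_powerset.mp hS)
  have hB0 : ∀ S u a, 0 ≤ B S u a := fun S u a => by
    simp only [B]; split_ifs; exacts [Real.rpow_nonneg (nrm_nonneg a) _, le_rfl]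
  let G : GaussianInt → ℝ := fun a => ∑ S ∈ (primesOf q).powerset, nrm (cofactor q S) *
    ∑ u : GaussianIntˣ, C * P * B S u a
  have hG : HasSum G (∑ S ∈ (primesOf q).powerset, nrm (cofactor q S) *
      ∑ u : GaussianIntˣ, C * P * ∑' a, B S u a) :=
    hasSum_sum fun S hS => (hasSum_sum fun u _ =>
      ((sum_congr_unit_le hk (he S hS) u).1.hasSum.mul_left _)).mul_left _
  have hbound : ∀ a, ‖h a * (weight (nrm a) T : ℂ) - D a‖ ≤ G a := by
    intro a
    have hG0 : 0 ≤ G a := Finset.sum_nonneg fun S _ => mul_nonneg (nrm_nonneg _)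
      (Finset.sum_nonneg fun u _ => mul_nonneg (by positivity) (hB0 S u a))
    by_cases haU : a ∈ U
    · obtain ⟨u, -, rfl⟩ := mem_image.mp haU
      simp only [h, D]
      rw [if_pos haU, sum_ext0_tilde_unit, nrm_unit, sub_self, norm_zero]
      exact hG0
    simp only [D]
    rw [if_neg haU, sub_zero]
    rcases eq_or_ne a 0 with rfl | ha
    · simp only [h]
      rw [Finset.sum_eq_zero fun χ _ => ext0_zero hu _, zero_mul, norm_zero]
      exact hG0
    have hwt : weight (nrm a) T ≤ C * P * nrm a ^ (-(9 / 8) : ℝ) := by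
      have := hCw T hT a ha
      rwa [show (1 / 2 - 9 / 8 : ℝ) = -(5 / 8) by norm_num] at this
    have hw0 := weight_nonneg (nrm a) hT.le
    rw [norm_mul, Complex.norm_real, Real.norm_of_nonneg hw0]
    refine (mul_le_mul_of_nonneg_right (norm_sum_ext0_tilde_le a) hw0).trans ?_
    rw [Finset.sum_mul]
    refine Finset.sum_le_sum fun S _ => ?_
    rw [mul_assoc, Finset.sum_mul]
    refine mul_le_mul_of_nonneg_left (Finset.sum_le_sum fun u _ => ?_) (nrm_nonneg _)
    have hau : a ≠ u := fun hau => haU (hau ▸ hU u)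
    simp only [B]
    by_cases hd : cofactor q S ∣ a - u
    · rw [if_pos hd, if_pos ⟨hd, hau⟩, one_mul]; exact hwt
    · rw [if_neg hd, if_neg fun h => hd h.1, zero_mul, mul_zero]
  have hmain : ‖∑ χ ∈ primOdd q, weightedSum (tilde χ) T -
      Nat.card GaussianIntˣ * psiStar q * weight 1 T‖ ≤ _ :=
    (hsum.sub hD).tsum_eq ▸ tsum_of_norm_bounded hG hbound
  refine hmain.trans ?_
  have hterm : ∀ S ∈ (primesOf q).powerset, nrm (cofactor q S) *
      ∑ u : GaussianIntˣ, C * P * ∑' a, B S u a ≤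
      Nat.card GaussianIntˣ * C * 4 ^ (9 / 8 : ℝ) * (Z + 1) * P := by
    intro S hS
    set n := nrm (cofactor q S)
    have hn : 1 ≤ n := one_le_nrm (he S hS)
    have hn1 : n * n ^ (-(9 / 8) : ℝ) ≤ 1 := by
      rw [← Real.rpow_one_add' (by linarith) (by norm_num)]
      exact Real.rpow_le_one_of_one_le_of_nonpos hn (by norm_num)
    have h1 : ∑ u : GaussianIntˣ, C * P * ∑' a, B S u a ≤ ∑ u : GaussianIntˣ,
        C * P * (4 ^ (9 / 8 : ℝ) * n ^ (-(9 / 8) : ℝ) * Z) :=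
      Finset.sum_le_sum fun u _ => mul_le_mul_of_nonneg_left
        (sum_congr_unit_le hk (he S hS) u).2 (by positivity)
    rw [Finset.sum_const, Finset.card_univ, ← Nat.card_eq_fintype_card, nsmul_eq_mul] at h1
    calc _ ≤ n * (Nat.card GaussianIntˣ * (C * P * (4 ^ (9 / 8 : ℝ) * n ^ (-(9 / 8) : ℝ) * Z))) :=
          mul_le_mul_of_nonneg_left h1 (by linarith)
      _ = Nat.card GaussianIntˣ * C * 4 ^ (9 / 8 : ℝ) * Z * P * (n * n ^ (-(9 / 8) : ℝ)) := by ring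
      _ ≤ Nat.card GaussianIntˣ * C * 4 ^ (9 / 8 : ℝ) * (Z + 1) * P * 1 := by
          gcongr
          linarith
      _ = _ := mul_one _
  refine (Finset.sum_le_sum hterm).trans (le_of_eq ?_)
  rw [Finset.sum_const, Finset.card_powerset, nsmul_eq_mul]
  push_cast
  ring

/-- The trivial bound. -/
theorem exists_norm_weightedSum_le : ∃ C : ℝ, 0 < C ∧ ∀ m : GaussianInt, ¬ IsUnit m →
    ∀ (ξ : ModChar m) (T : ℝ), 0 < T → ‖weightedSum ξ T‖ ≤ C * T ^ (-(3 / 2) : ℝ) := by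
  obtain ⟨C, hC, hCw⟩ := exists_weight_nrm_le 2 one_lt_two
  set Z := ∑' z : GaussianInt, nrm z ^ (-2 : ℝ)
  have hZ : 0 ≤ Z := tsum_nonneg fun z => Real.rpow_nonneg (nrm_nonneg z) _
  refine ⟨C * (Z + 1), by positivity, fun m hm ξ T hT => ?_⟩
  have hP : 0 < T ^ (-(3 / 2) : ℝ) := Real.rpow_pos_of_pos hT _
  have h := tsum_of_norm_bounded (f := fun a => ext0 ξ a * (weight (nrm a) T : ℂ))
    ((summable_nrm_rpow one_lt_two).hasSum.mul_left (C * T ^ (-(3 / 2) : ℝ))) fun a => by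
      have hw0 := weight_nonneg (nrm a) hT.le
      rw [norm_mul, Complex.norm_real, Real.norm_of_nonneg hw0]
      rcases eq_or_ne a 0 with rfl | ha
      · rw [ext0_zero hm, norm_zero, zero_mul]
        exact mul_nonneg (by positivity) (Real.rpow_nonneg (nrm_nonneg _) _)
      · have := hCw T hT a ha
        rw [show (1 / 2 - 2 : ℝ) = -(3 / 2) by norm_num] at this
        exact (mul_le_of_le_one_left hw0 (norm_ext0_le ξ a)).trans this
  calc _ ≤ C * T ^ (-(3 / 2) : ℝ) * Z := h
    _ ≤ C * T ^ (-(3 / 2) : ℝ) * (Z + 1) := by gcongr; linarith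
    _ = _ := by ring

/-- The number `ψ*(q)` is at least `φ(q) * primDensity q / 4`, and it exceeds the error term of the
first moment by any given factor once `N(q)` is large. -/
theorem exists_le_psiStar {C : ℝ} (hC : 1 ≤ C) : ∃ N : ℝ, ∀ (q : GaussianInt) [NeZero q],
    IsCoprime q 2 → N ≤ nrm q → C * 2 ^ #(primesOf q) * nrm q ^ (5 / 8 : ℝ) ≤ psiStar q ∧
      (Nat.card (Residue q)ˣ : ℝ) * primDensity q ≤ 4 * psiStar q := by
  obtain ⟨C₁, hC₁, h₁⟩ := exists_pow_card_primesOf_le (B := 8) (δ := 1 / 4) (by norm_num)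
    (by norm_num)
  -- The exponents `1/4 + 5/8 = 7/8` leave `N(q)^(1/8)` to beat the constants.
  refine ⟨(4 * C * C₁) ^ (8 : ℝ), fun q hq h2 hN => ?_⟩
  set n := nrm q
  set ω := #(primesOf q)
  have hn : 1 ≤ n := one_le_nrm hq.out
  have hn0 : 0 < n := by linarith
  have hn1 : 4 * C * C₁ ≤ n ^ (1 / 8 : ℝ) := by
    calc 4 * C * C₁ = ((4 * C * C₁) ^ (8 : ℝ)) ^ (1 / 8 : ℝ) := by
          rw [← Real.rpow_mul (by positivity)]; norm_num
      _ ≤ _ := Real.rpow_le_rpow (by positivity) hN (by norm_num)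
  have hX : n / 4 ^ ω ≤ (Nat.card (Residue q)ˣ : ℝ) * primDensity q := by
    have h3 := nrm_le_card_units q
    have h4 := half_pow_le_primDensity h2
    calc n / 4 ^ ω = n / 2 ^ ω * (1 / 2) ^ ω := by
          rw [div_pow, one_pow, show (4 : ℝ) = 2 * 2 by norm_num, mul_pow]; field_simp
      _ ≤ _ := mul_le_mul (by rw [div_le_iff₀ (by positivity)]; linarith) h4 (by positivity)
          (by positivity)
  have hbig : 4 * (C * 2 ^ ω * n ^ (5 / 8 : ℝ)) ≤ n / 4 ^ ω := by
    rw [le_div_iff₀ (by positivity)]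
    have h3 : (2 : ℝ) ^ ω * 4 ^ ω = 8 ^ ω := by rw [← mul_pow]; norm_num
    calc 4 * (C * 2 ^ ω * n ^ (5 / 8 : ℝ)) * 4 ^ ω
        = 4 * C * 8 ^ ω * n ^ (5 / 8 : ℝ) := by rw [← h3]; ring
      _ ≤ 4 * C * (C₁ * n ^ (1 / 4 : ℝ)) * n ^ (5 / 8 : ℝ) := by gcongr; exact h₁ q hq.out
      _ = 4 * C * C₁ * n ^ (7 / 8 : ℝ) := by
          rw [show (7 / 8 : ℝ) = 1 / 4 + 5 / 8 by norm_num, Real.rpow_add hn0]; ring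
      _ ≤ n ^ (1 / 8 : ℝ) * n ^ (7 / 8 : ℝ) := by gcongr
      _ = n := by rw [← Real.rpow_add hn0]; norm_num
  have hge : 1 ≤ C * 2 ^ ω * n ^ (5 / 8 : ℝ) :=
    one_le_mul_of_one_le_of_one_le (one_le_mul_of_one_le_of_one_le hC
      (one_le_pow₀ (by norm_num))) (Real.one_le_rpow hn (by norm_num))
  have hψ := two_mul_psiStar_ge h2
  constructor <;> linarith

/-! ### Nonvanishing -/

theorem exists_LFunction_tilde {q : GaussianInt} [NeZero q] (hq : IsCoprime q 2) {χ : ModChar q}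
    (hχ : χ ∈ primOdd q) : ∃ L : ℂ → ℂ, IsLFunction (tilde χ) L ∧ ∀ T : ℝ, 0 < T →
      ∃ ε : ℂ, ‖ε‖ = 1 ∧ (Nat.card GaussianIntˣ : ℂ) * L (1 / 2) =
        weightedSum (tilde χ) T + ε * weightedSum (tilde χ)⁻¹ (1 / (T * nrm (lam * q))) := by
  obtain ⟨h1, h2⟩ := mem_primOdd.mp hχ
  exact exists_isLFunction (not_isUnit_lam_mul q)
    (fun p hp hpq => tilde_exists_ne_one hq h1 h2 hp hpq) (tilde_unitMap χ)

/-- A lower bound for the first moment. The sums are split at `T = 1 / (K N((1 + i)³ q))` with a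
large constant `K`, so that the dual sums are small. -/
theorem exists_le_norm_sum : ∃ c : ℝ, 0 < c ∧ ∃ N : ℝ, ∀ (q : GaussianInt) [NeZero q],
    IsCoprime q 2 → N ≤ nrm q → ∀ ℓ : ModChar q → ℂ,
    (∀ χ ∈ primOdd q, ∀ T : ℝ, 0 < T → ∃ ε : ℂ, ‖ε‖ = 1 ∧ ℓ χ =
      weightedSum (tilde χ) T + ε * weightedSum (tilde χ)⁻¹ (1 / (T * nrm (lam * q)))) →
    c * psiStar q ≤ ‖∑ χ ∈ primOdd q, ℓ χ‖ := by
  obtain ⟨C₁, hC₁, h₁⟩ := exists_first_moment_le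
  obtain ⟨C₂, hC₂, h₂⟩ := exists_norm_weightedSum_le
  set v := weight 1 1
  have hv : 0 < v := weight_pos one_pos zero_le_one
  set K : ℝ := max 1 (2 * C₂ / v)
  have hK1 : 1 ≤ K := le_max_left _ _
  have hK0 : 0 < K := by linarith
  have hdual : C₂ * K ^ (-(3 / 2) : ℝ) ≤ v / 2 := by
    have h3 : K ^ (-(3 / 2) : ℝ) ≤ K⁻¹ := by
      rw [← Real.rpow_neg_one]
      exact Real.rpow_le_rpow_of_exponent_le hK1 (by norm_num)
    have h4 : 2 * C₂ / v ≤ K := le_max_right _ _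
    rw [div_le_iff₀ hv] at h4
    calc _ ≤ C₂ * K⁻¹ := by gcongr
      _ ≤ v / 2 := by rw [← div_eq_mul_inv, div_le_iff₀ hK0]; linarith
  set A := C₁ * (8 * K) ^ (5 / 8 : ℝ)
  obtain ⟨N, hN⟩ := exists_le_psiStar (C := max 1 (4 * A / v)) (le_max_left _ _)
  refine ⟨v / 4, by positivity, N, fun q hq h2 hNq ℓ hℓ => ?_⟩
  have hn := one_le_nrm hq.out
  have hm := nrm_lam_mul q
  set M := nrm (lam * q)
  have hM1 : 1 ≤ M := by linarith
  set T : ℝ := 1 / (K * M)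
  have hT : 0 < T := by positivity
  have hT1 : T ≤ 1 := by
    rw [div_le_one (by positivity)]
    exact one_le_mul_of_one_le_of_one_le hK1 hM1
  have hTK : 1 / (T * M) = K := by simp only [T]; field_simp
  have hTpow : T ^ (-(5 / 8) : ℝ) = (8 * K) ^ (5 / 8 : ℝ) * nrm q ^ (5 / 8 : ℝ) := by
    rw [← Real.mul_rpow (by positivity) (by linarith), Real.rpow_neg hT.le,
      ← Real.inv_rpow hT.le]
    simp only [T, one_div, inv_inv, hm]
    congr 1; ring
  have herr := h₁ q T hT
  rw [hTpow] at herr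
  have hdiff : ‖∑ χ ∈ primOdd q, ℓ χ - ∑ χ ∈ primOdd q, weightedSum (tilde χ) T‖ ≤
      psiStar q * (v / 2) := by
    rw [← Finset.sum_sub_distrib, ← card_primOdd, ← nsmul_eq_mul]
    refine norm_sum_le_of_le _ (fun χ hχ => ?_) |>.trans (le_of_eq (Finset.sum_const _))
    obtain ⟨ε, hε, h⟩ := hℓ χ hχ T hT
    rw [h, hTK, add_sub_cancel_left, norm_mul, hε, one_mul]
    exact (h₂ _ (not_isUnit_lam_mul q) _ K hK0).trans hdual
  have hsmall : C₁ * 2 ^ #(primesOf q) * ((8 * K) ^ (5 / 8 : ℝ) * nrm q ^ (5 / 8 : ℝ)) ≤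
      psiStar q * (v / 4) := by
    have h3 := (hN q h2 hNq).1
    have h4 : 4 * A / v * 2 ^ #(primesOf q) * nrm q ^ (5 / 8 : ℝ) ≤ psiStar q :=
      le_trans (by gcongr; exact le_max_right _ _) h3
    calc _ = (4 * A / v * 2 ^ #(primesOf q) * nrm q ^ (5 / 8 : ℝ)) * (v / 4) := by
          simp only [A]; field_simp
      _ ≤ _ := by gcongr
  have hmain : psiStar q * v ≤ ‖(Nat.card GaussianIntˣ * psiStar q * weight 1 T : ℂ)‖ := by
    have hw : (1 : ℝ) ≤ Nat.card GaussianIntˣ := by exact_mod_cast Nat.card_pos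
    have hvT : v ≤ weight 1 T := weight_antitone one_pos hT.le hT1
    rw [norm_mul, norm_mul, Complex.norm_natCast, Complex.norm_natCast, Complex.norm_real,
      Real.norm_of_nonneg (hv.le.trans hvT)]
    calc _ = 1 * psiStar q * v := by ring
      _ ≤ _ := by gcongr
  set X := ∑ χ ∈ primOdd q, ℓ χ
  set Y := ∑ χ ∈ primOdd q, weightedSum (tilde χ) T
  set W : ℂ := Nat.card GaussianIntˣ * psiStar q * weight 1 T
  have htri : ‖W‖ ≤ ‖X‖ + ‖X - Y‖ + ‖Y - W‖ := by
    calc ‖W‖ = ‖X - (X - Y) - (Y - W)‖ := by congr 1; ring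
      _ ≤ _ := (norm_sub_le _ _).trans (add_le_add_left (norm_sub_le _ _) _)
  linarith

/-- An upper bound for the second moment over the primitive odd characters, from the second moment
over all characters modulo `(1 + i)³ q`. The sums are split at `T = N((1 + i)³ q)^(-1/2)`, which
makes the dual sum have the same length. -/
theorem exists_sum_norm_sq_le : ∃ C : ℝ, 0 < C ∧ ∀ (q : GaussianInt) [NeZero q],
    IsCoprime q 2 → 3 ≤ nrm q → ∀ ℓ : ModChar q → ℂ,
    (∀ χ ∈ primOdd q, ∀ T : ℝ, 0 < T → ∃ ε : ℂ, ‖ε‖ = 1 ∧ ℓ χ =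
      weightedSum (tilde χ) T + ε * weightedSum (tilde χ)⁻¹ (1 / (T * nrm (lam * q)))) →
    ∑ χ ∈ primOdd q, ‖ℓ χ‖ ^ 2 ≤
      C * (Nat.card (Residue q)ˣ * primDensity q * Real.log (nrm q)) := by
  obtain ⟨C, hC, h⟩ := exists_second_moment_le
  obtain ⟨c, hc, hc'⟩ := exists_le_primDensity_mul_primeProd
  refine ⟨4 * C / c, by positivity, fun q hq h2 h3 ℓ hℓ => ?_⟩
  have hM : 0 < nrm (lam * q) := nrm_pos (neZero_lam_mul q).out
  have hE := primeProd_pos q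
  have hlog : 0 ≤ Real.log (nrm q) := Real.log_nonneg (by linarith)
  set T : ℝ := nrm (lam * q) ^ (-(1 / 2) : ℝ)
  have hT : 0 < T := Real.rpow_pos_of_pos hM _
  have hTT : 1 / (T * nrm (lam * q)) = T := by
    have : T * T * nrm (lam * q) = 1 := by
      simp only [T]
      rw [← Real.rpow_add hM, ← Real.rpow_add_one hM.ne']; norm_num
    rw [div_eq_iff (by positivity), ← this]; ring
  have hle : ∀ f : ModChar (lam * q) → ℝ, (∀ ξ, 0 ≤ f ξ) →
      ∑ χ ∈ primOdd q, f (tilde χ) ≤ ∑ ξ, f ξ := by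
    classical
    intro f hf
    rw [← Finset.sum_image (f := f) (g := tilde) fun χ _ χ' _ hχ => tilde_injective h2 hχ]
    exact Finset.sum_le_sum_of_subset_of_nonneg (subset_univ _) fun ξ _ _ => hf ξ
  have h1 := hle (fun ξ => ‖weightedSum ξ T‖ ^ 2) fun _ => by positivity
  have h1' := hle (fun ξ => ‖weightedSum ξ⁻¹ T‖ ^ 2) fun _ => by positivity
  replace h1' := h1'.trans_eq
    (Equiv.sum_comp (Equiv.inv (ModChar (lam * q))) fun ξ => ‖weightedSum ξ T‖ ^ 2)
  have h4 := h q h2 h3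
  have h5 : (Nat.card (Residue q)ˣ * Real.log (nrm q) / primeProd q : ℝ) ≤
      Nat.card (Residue q)ˣ * primDensity q * Real.log (nrm q) / c := by
    rw [div_le_div_iff₀ hE hc]
    calc _ ≤ Nat.card (Residue q)ˣ * Real.log (nrm q) * (primDensity q * primeProd q) := by
          gcongr; exact hc' q h2
      _ = _ := by ring
  calc ∑ χ ∈ primOdd q, ‖ℓ χ‖ ^ 2 ≤ ∑ χ ∈ primOdd q, (2 * ‖weightedSum (tilde χ) T‖ ^ 2 +
        2 * ‖weightedSum (tilde χ)⁻¹ T‖ ^ 2) := by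
        refine Finset.sum_le_sum fun χ hχ => ?_
        obtain ⟨ε, hε, h6⟩ := hℓ χ hχ T hT
        rw [hTT] at h6
        have h7 := norm_add_le (weightedSum (tilde χ) T) (ε * weightedSum (tilde χ)⁻¹ T)
        rw [← h6, norm_mul, hε, one_mul] at h7
        have h8 := norm_nonneg (ℓ χ)
        nlinarith [sq_nonneg (‖weightedSum (tilde χ) T‖ - ‖weightedSum (tilde χ)⁻¹ T‖)]
    _ = 2 * ∑ χ ∈ primOdd q, ‖weightedSum (tilde χ) T‖ ^ 2 +
        2 * ∑ χ ∈ primOdd q, ‖weightedSum (tilde χ)⁻¹ T‖ ^ 2 := by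
        rw [Finset.sum_add_distrib, ← Finset.mul_sum, ← Finset.mul_sum]
    _ ≤ 4 * (C * (Nat.card (Residue q)ˣ * Real.log (nrm q) / primeProd q)) := by linarith
    _ ≤ 4 * (C * (Nat.card (Residue q)ˣ * primDensity q * Real.log (nrm q) / c)) := by gcongr
    _ = _ := by ring

end GaussHecke

end

open GaussHecke Finset in
theorem corollary1p2 :
    ∃ c : ℝ, 0 < c ∧ ∃ N₀ : ℝ, ∀ q : GaussianInt, IsCoprime q 2 → N₀ ≤ (q.norm : ℝ) →
      c * ((GaussHecke.psiStar q : ℝ) / Real.log (q.norm : ℝ)) ≤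
        ((GaussHecke.nonvanishing q).ncard : ℝ) := by
  classical
  obtain ⟨c₁, hc₁, N₁, h₁⟩ := exists_le_norm_sum
  obtain ⟨C₂, hC₂, h₂⟩ := exists_sum_norm_sq_le
  obtain ⟨N₂, h₃⟩ := exists_le_psiStar le_rfl
  refine ⟨c₁ ^ 2 / (4 * C₂), by positivity, max 3 (max N₁ N₂), fun q hq hN => ?_⟩
  change _ * (_ / Real.log (nrm q)) ≤ _
  have hN' : max 3 (max N₁ N₂) ≤ nrm q := hN
  obtain ⟨hN3, hN12⟩ := max_le_iff.mp hN'
  obtain ⟨hN1, hN2⟩ := max_le_iff.mp hN12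
  have : NeZero q := ⟨ne_zero_of_isCoprime_two hq⟩
  have hlog : 0 < Real.log (nrm q) := Real.log_pos (by linarith)
  choose! L hL hLT using fun χ (hχ : χ ∈ primOdd q) => exists_LFunction_tilde hq hχ
  let ℓ : ModChar q → ℂ := fun χ => Nat.card GaussianIntˣ * L χ (1 / 2)
  have hfirst := h₁ q hq hN1 ℓ hLT
  have hsecond := h₂ q hq hN3 ℓ hLT
  have hψ := (h₃ q hq hN2).2
  let A := (primOdd q).filter fun χ => ℓ χ ≠ 0
  have hA : (#A : ℝ) ≤ (nonvanishing q).ncard := by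
    rw [← card_image_of_injective A (tilde_injective hq), ← Set.ncard_coe_finset]
    refine Nat.cast_le.mpr (Set.ncard_le_ncard ?_ (Set.toFinite _))
    intro ξ hξ
    obtain ⟨χ, hχ, rfl⟩ := mem_image.mp (mem_coe.mp hξ)
    obtain ⟨hχ1, hχ2⟩ := mem_filter.mp hχ
    obtain ⟨h4, h5⟩ := mem_primOdd.mp hχ1
    exact ⟨χ, h4, h5, rfl, L χ, hL χ hχ1, right_ne_zero_of_mul hχ2⟩
  have hCS : ‖∑ χ ∈ primOdd q, ℓ χ‖ ^ 2 ≤ #A * ∑ χ ∈ primOdd q, ‖ℓ χ‖ ^ 2 := by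
    rw [← Finset.sum_filter_ne_zero]
    calc _ ≤ (∑ χ ∈ A, ‖ℓ χ‖) ^ 2 := by gcongr; exact norm_sum_le _ _
      _ ≤ #A * ∑ χ ∈ A, ‖ℓ χ‖ ^ 2 := sq_sum_le_card_mul_sum_sq
      _ ≤ _ := by
        gcongr
        exact filter_subset _ _
  set ψ : ℝ := (psiStar q : ℝ)
  have hψ0 : 0 ≤ ψ := Nat.cast_nonneg _
  rcases hψ0.eq_or_lt with h0 | hpos
  · rw [← h0, zero_div, mul_zero]; positivity
  have key : (c₁ * ψ) ^ 2 ≤ (nonvanishing q).ncard * (C₂ * (4 * ψ * Real.log (nrm q))) := by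
    calc _ ≤ ‖∑ χ ∈ primOdd q, ℓ χ‖ ^ 2 := by gcongr
      _ ≤ #A * ∑ χ ∈ primOdd q, ‖ℓ χ‖ ^ 2 := hCS
      _ ≤ (nonvanishing q).ncard * (C₂ * (4 * ψ * Real.log (nrm q))) := by
        refine mul_le_mul hA (hsecond.trans ?_) (by positivity) (Nat.cast_nonneg _)
        gcongr
  rw [div_mul_div_comm, div_le_iff₀ (by positivity)]
  refine le_of_mul_le_mul_right ?_ hpos
  calc _ = (c₁ * ψ) ^ 2 := by ring
    _ ≤ _ := key
    _ = _ := by ring
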